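/- **Setting.** Let $\Omega\subset\mathbb R^3$ be a bounded domain with Lipschitz boundary $\Gamma$ and unit normal $\mathbf n$, and let $\varepsilon,\mu>0$ be constants. Let $C,\delta>0$, put $w(s)=Ce^{-\delta s}$, and let $\nu_E,\nu_H\in C^2([0,\infty);\mathbb R)$ satisfy, for $\nu\in\{\nu_E,\nu_H\}$, $$\lim_{t\to\infty}\nu'(t)=0,\qquad |\nu''(t)|\le w(t)\quad\text{for all } t\ge 0 .$$ Let $J(\Omega)=\{\chi\in L^2(\Omega)^3:\operatorname{div}\chi=0\}$ and $\hat J(\Omega)=\{\chi\in J(\Omega):\chi\cdot\mathbf n=0\text{ on }\Gamma\}$ (complex-valued fields), and for a Hilbert space $X$ let $L^2_w((0,\infty);X)$ be the $L^2$ space of $X$-valued functions with respect to the measure $w(s)\,ds$. Let $$\mathcal H=J(\Omega)\times\hat J(\Omega)\times L^2_w((0,\infty);J(\Omega))\times L^2_w((0,\infty);\hat J(\Omega)),$$ $$\|(E,H,\eta_E,\eta_H)\|_{\mathcal H}^2=\int_\Omega(\varepsilon|E|^2+\mu|H|^2)\,dx+\int_0^\infty\!\!\int_\Omega(|\eta_E(x,s)|^2+|\eta_H(x,s)|^2)\,dx\,w(s)\,ds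 ,$$ and let $\mathcal A$ be the operator on $\mathcal H$ with $$\mathcal A\begin{pmatrix}E\\H\\\eta_E\\\eta_H\end{pmatrix}=\begin{pmatrix}\varepsilon^{-1}\bigl(-\nu_E(0)E+\int_0^\infty\nu_E''(s)\eta_E(\cdot,s)\,ds+\operatorname{curl}H\bigr)\\ \mu^{-1}\bigl(-\nu_H(0)H+\int_0^\infty\nu_H''(s)\eta_H(\cdot,s)\,ds-\operatorname{curl}E\bigr)\\-\partial_s\eta_E+E\\-\partial_s\eta_H+H\end{pmatrix},$$ whose domain consists of all $(E,H,\eta_E,\eta_H)\in\mathcal H$ with $\operatorname{curl}E,\operatorname{curl}H\in L^2(\Omega)^3$, $E\times\mathbf n=0$ on $\Gamma$ (that is, $E$ lies in $H_0(\operatorname{curl},\Omega)$, the closure of $C_c^\infty(\Omega)^3$ in the graph norm of $\operatorname{curl}$), $\partial_s\eta_E\in L^2_w((0,\infty);J(\Omega))$, $\partial_s\eta_H\in L^2_w((0,\infty);\hat J(\Omega))$ and $\eta_E(0)=\eta_H(0)=0$. For such a kernel $\nu$ and $\omega\in\mathbb R$, the expression $i\omega\,\mathcal L\nu(i\omega)$,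 where $\mathcal L$ is the Laplace transform, stands for $$i\omega\,\mathcal L\nu(i\omega):=\nu(0)+\int_0^\infty e^{-i\omega s}\nu'(s)\,ds ,$$ the limit of $\lambda\int_0^\infty e^{-\lambda s}\nu(s)\,ds$ as $\lambda\to i\omega$, $\operatorname{Re}\lambda>0$. **Lemma 3.1.** Assume passivity, i.e. $\operatorname{Re}\bigl(i\omega\,\mathcal L\nu_E(i\omega)\bigr)\ge0$ and $\operatorname{Re}\bigl(i\omega\,\mathcal L\nu_H(i\omega)\bigr)\ge0$ for all $\omega\in\mathbb R$. Then $\mathcal A$ generates a $C_0$-semigroup $(T(t))_{t\ge0}$ on $\mathcal H$, and this semigroup is uniformly bounded: there is a constant $M>0$ such that $$\|T(t)\|\le M\qquad\text{for all }t\ge0 .$$ -/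

import Mathlib

open Set Filter Topology MeasureTheory
open scoped ENNReal NNReal

noncomputable section

namespace Maxwell

/-- Physical space `ℝ³`. -/
abbrev R3 := EuclideanSpace ℝ (Fin 3)

/-- Values of the (complex) electromagnetic fields. -/
abbrev C3 := EuclideanSpace ℂ (Fin 3)

/-- A bounded domain of `ℝ³` with Lipschitz boundary: a bounded connected nonempty open set which,
near each of its boundary points and after a rotation of the coordinates, is the set of points
lying strictly above the graph of a Lipschitz function of two variables. -/
structure IsBoundedLipschitzDomain (Ω : Set R3) : Prop where
  isOpen : IsOpen Ω
  isConnected : IsConnected Ω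
  isBounded : Bornology.IsBounded Ω
  lipschitz_boundary : ∀ x ∈ frontier Ω,
    ∃ (e : R3 ≃ₗᵢ[ℝ] R3) (γ : EuclideanSpace ℝ (Fin 2) → ℝ) (K : ℝ≥0),
      LipschitzWith K γ ∧ ∀ᶠ y in 𝓝 x, (y ∈ Ω ↔ γ !₂[e y 0, e y 1] < e y 2)

/-! ### Differential operators on `Ω` -/

/-- `φ ∈ C_c^∞(U; F)`: smooth on the whole space, with compact support contained in `U`. -/
def IsTest {V F : Type*} [NormedAddCommGroup V] [NormedSpace ℝ V]
    [NormedAddCommGroup F] [NormedSpace ℝ F] (U : Set V) (φ : V → F) : Prop :=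
  ContDiff ℝ (⊤ : ℕ∞) φ ∧ HasCompactSupport φ ∧ tsupport φ ⊆ U

/-- The partial derivative `∂_j f (x)`. -/
def pderiv {F : Type*} [NormedAddCommGroup F] [NormedSpace ℝ F]
    (j : Fin 3) (f : R3 → F) (x : R3) : F :=
  fderiv ℝ f x (EuclideanSpace.single j 1)

/-- The classical gradient of a complex function. -/
def grad (φ : R3 → ℂ) (x : R3) : C3 :=
  !₂[pderiv 0 φ x, pderiv 1 φ x, pderiv 2 φ x]

/-- The classical curl of a complex vector field. -/
def curl (φ : R3 → C3) (x : R3) : C3 :=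
  !₂[pderiv 1 φ x 2 - pderiv 2 φ x 1,
     pderiv 2 φ x 0 - pderiv 0 φ x 2,
     pderiv 0 φ x 1 - pderiv 1 φ x 0]

/-- `L²(Ω)³`, with complex values. -/
abbrev L2 (Ω : Set R3) := Lp C3 2 (volume.restrict Ω)

/-- `J(Ω)`, the divergence free fields: `χ ∈ L²(Ω)³` with `∫_Ω χ · conj (∇φ) = 0` for all
`φ ∈ C_c^∞(Ω)`. -/
def J (Ω : Set R3) : Submodule ℂ (L2 Ω) :=
  (Submodule.span ℂ {g : L2 Ω | ∃ φ : R3 → ℂ, IsTest Ω φ ∧ g =ᵐ[volume.restrict Ω] grad φ})ᗮ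

/-- `Ĵ(Ω)`, the divergence free fields with vanishing normal trace on `∂Ω`: `χ ∈ L²(Ω)³` with
`∫_Ω χ · conj (∇φ) = 0` for all restrictions `φ` to `Ω` of functions in `C_c^∞(ℝ³)`. -/
def Jhat (Ω : Set R3) : Submodule ℂ (L2 Ω) :=
  (Submodule.span ℂ {g : L2 Ω | ∃ φ : R3 → ℂ, IsTest univ φ ∧ g =ᵐ[volume.restrict Ω] grad φ})ᗮ

/-- The pairs `(φ, curl φ)`, `φ ∈ C_c^∞(Ω)³`, as elements of `L²(Ω)³ × L²(Ω)³`. -/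
def testCurlGraph (Ω : Set R3) : Set (L2 Ω × L2 Ω) :=
  {p | ∃ φ : R3 → C3, IsTest Ω φ ∧
    p.1 =ᵐ[volume.restrict Ω] φ ∧ p.2 =ᵐ[volume.restrict Ω] curl φ}

/-- `curl u = v` in the sense of distributions on `Ω`:
`∫_Ω u · conj (curl φ) = ∫_Ω v · conj φ` for all `φ ∈ C_c^∞(Ω)³`. -/
def IsWeakCurl {Ω : Set R3} (u v : L2 Ω) : Prop :=
  ∀ p ∈ testCurlGraph Ω, inner ℂ p.2 u = inner ℂ p.1 v

/-- `u ∈ H₀(curl, Ω)`, i.e. `u, curl u ∈ L²(Ω)³` and `u × n = 0` on `∂Ω`: `u` belongs to the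
closure of `C_c^∞(Ω)³` for the graph norm of the curl. -/
def ZeroTangentialTrace {Ω : Set R3} (u : L2 Ω) : Prop :=
  ∃ v : L2 Ω, (u, v) ∈ closure (testCurlGraph Ω)

/-! ### Kernels and passivity -/

/-- `ν'` on `[0, ∞)`, one-sided at `0`. -/
def d1 (ν : ℝ → ℝ) : ℝ → ℝ := derivWithin ν (Ici 0)

/-- `ν''` on `[0, ∞)`, one-sided at `0`. -/
def d2 (ν : ℝ → ℝ) : ℝ → ℝ := iteratedDerivWithin 2 ν (Ici 0)

/-- The admissible kernels `ν ∈ C²([0, ∞))`, with constants `C` and `δ`. -/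
structure IsKernel (C δ : ℝ) (ν : ℝ → ℝ) : Prop where
  contDiffOn : ContDiffOn ℝ 2 ν (Ici 0)
  tendsto_d1 : Tendsto (d1 ν) atTop (𝓝 0)
  abs_d2_le : ∀ t, 0 ≤ t → |d2 ν t| ≤ C * Real.exp (-δ * t)

/-- The boundary value on the imaginary axis of `lam * (ℒ ν)(lam)`, i.e. the meaning of
`iω (ℒ ν)(iω)` for an admissible kernel `ν`. As `ν` need not tend to `0` at infinity,
`∫_0^∞ e^{-iωs} ν(s) ds` may diverge; `iω (ℒ ν)(iω) = ν(0) + (ℒ ν')(iω)` always makes sense, since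
`ν'` decays exponentially, and it is the product of `iω` with the Fourier transform of the
distribution obtained from `ν` by extension by zero. -/
def symbol (ν : ℝ → ℝ) (ω : ℝ) : ℂ :=
  (ν 0 : ℂ) + ∫ s in Ioi (0 : ℝ), Complex.exp (-(Complex.I * ω * s)) * (d1 ν s : ℂ)

/-- Passivity: `Re (iω (ℒ ν)(iω)) ≥ 0` for all real `ω`. -/
def IsPassive (ν : ℝ → ℝ) : Prop := ∀ ω : ℝ, 0 ≤ (symbol ν ω).re

/-! ### The state space -/

/-- The measure `w(s) ds` on `(0, ∞)`, with `w(s) = C e^{-δ s}`. -/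
def histMeasure (C δ : ℝ) : Measure ℝ :=
  (volume.restrict (Ioi 0)).withDensity fun s => ENNReal.ofReal (C * Real.exp (-δ * s))

/-- `L²_w((0, ∞); X)`. -/
abbrev L2w (C δ : ℝ) (X : Type*) [NormedAddCommGroup X] := Lp X 2 (histMeasure C δ)

/-- The vector space `J(Ω) × Ĵ(Ω) × L²_w((0, ∞); J(Ω)) × L²_w((0, ∞); Ĵ(Ω))`; the parameters
`ε` and `μ` enter only in its inner product, defined below. -/
def StateSpace (Ω : Set R3) (C δ _ε _μ : ℝ) : Type :=
  J Ω × Jhat Ω × L2w C δ (J Ω) × L2w C δ (Jhat Ω)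

namespace StateSpace

variable {Ω : Set R3} {C δ ε μ : ℝ}

instance : AddCommGroup (StateSpace Ω C δ ε μ) :=
  inferInstanceAs (AddCommGroup (J Ω × Jhat Ω × L2w C δ (J Ω) × L2w C δ (Jhat Ω)))

instance : Module ℂ (StateSpace Ω C δ ε μ) :=
  inferInstanceAs (Module ℂ (J Ω × Jhat Ω × L2w C δ (J Ω) × L2w C δ (Jhat Ω)))

/-- The electric field. -/
def E (U : StateSpace Ω C δ ε μ) : J Ω := U.1

/-- The magnetic field. -/
def H (U : StateSpace Ω C δ ε μ) : Jhat Ω := U.2.1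

/-- The electric history. -/
def ηE (U : StateSpace Ω C δ ε μ) : L2w C δ (J Ω) := U.2.2.1

/-- The magnetic history. -/
def ηH (U : StateSpace Ω C δ ε μ) : L2w C δ (Jhat Ω) := U.2.2.2

/-- The inner product of the state space
`∫_Ω (ε E · conj E' + μ H · conj H') + ∫_0^∞ ∫_Ω (ηE · conj ηE' + ηH · conj ηH') dx w(s) ds`
(Mathlib's inner products are conjugate linear in the first variable). -/
@[reducible] def innerCore [hε : Fact (0 < ε)] [hμ : Fact (0 < μ)] :
    InnerProductSpace.Core ℂ (StateSpace Ω C δ ε μ) where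
  inner U V := (ε : ℂ) * inner ℂ U.E V.E + (μ : ℂ) * inner ℂ U.H V.H
    + inner ℂ U.ηE V.ηE + inner ℂ U.ηH V.ηH
  conj_inner_symm U V := by
    have h1 := inner_conj_symm (𝕜 := ℂ) U.E V.E
    have h2 := inner_conj_symm (𝕜 := ℂ) U.H V.H
    have h3 := inner_conj_symm (𝕜 := ℂ) U.ηE V.ηE
    have h4 := inner_conj_symm (𝕜 := ℂ) U.ηH V.ηH
    simp only [map_add, map_mul, Complex.conj_ofReal, h1, h2, h3, h4]
  re_inner_nonneg U := by
    have hε' := hε.out.le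
    have hμ' := hμ.out.le
    have h1 := mul_nonneg hε' (inner_self_nonneg (𝕜 := ℂ) (x := U.E))
    have h2 := mul_nonneg hμ' (inner_self_nonneg (𝕜 := ℂ) (x := U.H))
    have h3 := inner_self_nonneg (𝕜 := ℂ) (x := U.ηE)
    have h4 := inner_self_nonneg (𝕜 := ℂ) (x := U.ηH)
    simp only [RCLike.re_to_complex, Complex.add_re, Complex.re_ofReal_mul] at *
    linarith
  add_left U V W := by
    have h1 : (U + V).E = U.E + V.E := rfl
    have h2 : (U + V).H = U.H + V.H := rfl
    have h3 : (U + V).ηE = U.ηE + V.ηE := rfl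
    have h4 : (U + V).ηH = U.ηH + V.ηH := rfl
    have k1 := inner_add_left (𝕜 := ℂ) U.E V.E W.E
    have k2 := inner_add_left (𝕜 := ℂ) U.H V.H W.H
    have k3 := inner_add_left (𝕜 := ℂ) U.ηE V.ηE W.ηE
    have k4 := inner_add_left (𝕜 := ℂ) U.ηH V.ηH W.ηH
    simp only [h1, h2, h3, h4, k1, k2, k3, k4]
    ring
  smul_left U V r := by
    have h1 : (r • U).E = r • U.E := rfl
    have h2 : (r • U).H = r • U.H := rfl
    have h3 : (r • U).ηE = r • U.ηE := rfl
    have h4 : (r • U).ηH = r • U.ηH := rfl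
    have k1 := inner_smul_left (𝕜 := ℂ) U.E V.E r
    have k2 := inner_smul_left (𝕜 := ℂ) U.H V.H r
    have k3 := inner_smul_left (𝕜 := ℂ) U.ηE V.ηE r
    have k4 := inner_smul_left (𝕜 := ℂ) U.ηH V.ηH r
    simp only [h1, h2, h3, h4, k1, k2, k3, k4]
    ring
  definite U h := by
    have hε' := hε.out
    have hμ' := hμ.out
    have k1 := inner_self_nonneg (𝕜 := ℂ) (x := U.E)
    have k2 := inner_self_nonneg (𝕜 := ℂ) (x := U.H)
    have k3 := inner_self_nonneg (𝕜 := ℂ) (x := U.ηE)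
    have k4 := inner_self_nonneg (𝕜 := ℂ) (x := U.ηH)
    have h' := congrArg Complex.re h
    simp only [RCLike.re_to_complex, Complex.add_re, Complex.re_ofReal_mul,
      Complex.zero_re] at k1 k2 k3 k4 h'
    have m1 := mul_nonneg hε'.le k1
    have m2 := mul_nonneg hμ'.le k2
    have e1 : (inner ℂ U.E U.E).re = 0 := by
      rcases mul_eq_zero.1 (show ε * (inner ℂ U.E U.E).re = 0 by linarith) with h | h
      · exact absurd h hε'.ne'
      · exact h
    have e2 : (inner ℂ U.H U.H).re = 0 := by
      rcases mul_eq_zero.1 (show μ * (inner ℂ U.H U.H).re = 0 by linarith) with h | h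
      · exact absurd h hμ'.ne'
      · exact h
    have e3 : (inner ℂ U.ηE U.ηE).re = 0 := by linarith
    have e4 : (inner ℂ U.ηH U.ηH).re = 0 := by linarith
    have z1 : U.E = 0 := (re_inner_self_nonpos (𝕜 := ℂ) (x := U.E)).1 e1.le
    have z2 : U.H = 0 := (re_inner_self_nonpos (𝕜 := ℂ) (x := U.H)).1 e2.le
    have z3 : U.ηE = 0 := (re_inner_self_nonpos (𝕜 := ℂ) (x := U.ηE)).1 e3.le
    have z4 : U.ηH = 0 := (re_inner_self_nonpos (𝕜 := ℂ) (x := U.ηH)).1 e4.le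
    exact Prod.ext z1 (Prod.ext z2 (Prod.ext z3 z4))

instance [Fact (0 < ε)] [Fact (0 < μ)] : NormedAddCommGroup (StateSpace Ω C δ ε μ) :=
  innerCore.toNormedAddCommGroup

instance [Fact (0 < ε)] [Fact (0 < μ)] : InnerProductSpace ℂ (StateSpace Ω C δ ε μ) :=
  InnerProductSpace.ofCore innerCore.toCore

end StateSpace

/-! ### The evolution operator -/

/-- `∂_s η = ζ` on `(0, ∞)` in the weak sense and `η(0) = 0`, the latter for the continuous
representative of `η` on `[0, ∞)`. -/
def IsHistoryDeriv {X : Type*} [NormedAddCommGroup X] [NormedSpace ℝ X] (η ζ : ℝ → X) : Prop :=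
  (∀ φ : ℝ → ℝ, IsTest (Ioi 0) φ →
    ∫ s in Ioi (0 : ℝ), deriv φ s • η s = -∫ s in Ioi (0 : ℝ), φ s • ζ s) ∧
  ∃ g : ℝ → X, ContinuousOn g (Ici 0) ∧ g 0 = 0 ∧ η =ᵐ[volume.restrict (Ioi 0)] g

/-- The operator `𝒜`, given by its graph: `IsOperator νE νH U V` means that
`U = (E, H, ηE, ηH)` lies in the domain of `𝒜`, that is,
`curl E, curl H ∈ L²(Ω)³`, `E × n = 0` on `∂Ω`, `∂_s ηE ∈ L²_w((0, ∞); J(Ω))`,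
`∂_s ηH ∈ L²_w((0, ∞); Ĵ(Ω))`, `ηE(0) = ηH(0) = 0`, and that `V = 𝒜 U`, that is,
`ε V.E = -νE(0) E + ∫_0^∞ νE''(s) ηE(s) ds + curl H`,
`μ V.H = -νH(0) H + ∫_0^∞ νH''(s) ηH(s) ds - curl E`,
`V.ηE = -∂_s ηE + E`, `V.ηH = -∂_s ηH + H`. -/
def IsOperator {Ω : Set R3} {C δ ε μ : ℝ} (νE νH : ℝ → ℝ) (U V : StateSpace Ω C δ ε μ) : Prop :=
  ∃ (curlE curlH : L2 Ω) (ζE : L2w C δ (J Ω)) (ζH : L2w C δ (Jhat Ω)),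
    IsWeakCurl (U.E : L2 Ω) curlE ∧ IsWeakCurl (U.H : L2 Ω) curlH ∧
    ZeroTangentialTrace (U.E : L2 Ω) ∧
    IsHistoryDeriv (fun s => (U.ηE s : L2 Ω)) (fun s => (ζE s : L2 Ω)) ∧
    IsHistoryDeriv (fun s => (U.ηH s : L2 Ω)) (fun s => (ζH s : L2 Ω)) ∧
    ε • (V.E : L2 Ω) =
      -(νE 0 • (U.E : L2 Ω)) + (∫ s in Ioi (0 : ℝ), d2 νE s • (U.ηE s : L2 Ω)) + curlH ∧
    μ • (V.H : L2 Ω) =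
      -(νH 0 • (U.H : L2 Ω)) + (∫ s in Ioi (0 : ℝ), d2 νH s • (U.ηH s : L2 Ω)) - curlE ∧
    (∀ᵐ s ∂(histMeasure C δ), V.ηE s = -ζE s + U.E) ∧
    (∀ᵐ s ∂(histMeasure C δ), V.ηH s = -ζH s + U.H)

/-! ### Semigroups -/

/-- `(T(t))_{t ≥ 0}` is a `C₀`-semigroup of bounded operators on `X` whose generator has the
graph `A`: `A x y` holds iff `(T(h) x - x) / h → y` as `h → 0+`. Only the `T(t)` with `t ≥ 0` are
relevant. -/
structure IsSemigroupGeneratedBy {X : Type*} [NormedAddCommGroup X] [NormedSpace ℂ X]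
    (T : ℝ → X →L[ℂ] X) (A : X → X → Prop) : Prop where
  zero : T 0 = ContinuousLinearMap.id ℂ X
  add : ∀ s t, 0 ≤ s → 0 ≤ t → T (s + t) = (T s).comp (T t)
  tendsto : ∀ x, Tendsto (fun t => T t x) (𝓝[>] 0) (𝓝 x)
  generator : ∀ x y, A x y ↔
    Tendsto (fun h : ℝ => ((h⁻¹ : ℝ) : ℂ) • (T h x - x)) (𝓝[>] 0) (𝓝 y)

end Maxwell

end

/-!
The evolution operator splits into an unbounded part without memory, `(E, H, ηE, ηH) ↦
(ε⁻¹ curl H, -μ⁻¹ curl E, -∂_s ηE, -∂_s ηH)`, and a bounded part `StateModel.coupling`, which holds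
the damping, the memory integrals and the sources `E`, `H` of the histories; the memory integrals
are bounded because `|ν''| ≤ w`. The unbounded part is maximal dissipative, so the Lumer-Phillips
theorem and its stability under bounded perturbations (`IsMaxDissipative.exists_semigroup`,
`IsMaxDissipative.add_bounded`) yield the semigroup. Unbounded operators are represented by their
graphs throughout.

Maximal dissipativity rests on two facts. The curl on `H₀(curl, Ω)` is adjoint to the weak curl, so
the curl block does no work, and its resolvent is an orthogonal projection onto the closed graph of
a multiple of the curl (`exists_curl_system`, `exists_maxwell_resolvent`); curls are automatically
divergence free, and those of fields in `H₀(curl, Ω)` are tangential. The weak derivative `∂_s` with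
zero initial value is the inverse of the Volterra operator (`isHistoryDeriv_iff`), and integration
by parts against the weight `C e^{-δ s}` gives `Re ⟨η, -∂_s η⟩ = -δ/2 ‖η‖²` (`re_inner_volterra`).
The shifts of histories therefore decay like `e^{-δ t / 2}` (`isMaxDissipative_transportGraph`).

These bounds alone allow exponential growth of the whole system; uniform boundedness comes from
passivity. By Duhamel's formula, the memory term along a trajectory equals `-(ν' ∗ field)`, up to
the contribution of the initial history, which decays exponentially (`shift_const`,
`memory_history_eq`). By Plancherel's theorem, a passive kernel satisfies
`Re ∫_0^t ⟨f, ν(0) f + ν' ∗ f⟩ ≥ 0` (`IsPassive.intervalIntegral_nonneg`), so the work done on the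
fields in any time interval `[0, t]` is at most a constant times the supremum of the fields on
`[0, t]` times the norm of the initial history (`work_le`). The energy balance up to the time at
which the field energy is maximal bounds the fields independently of `t`; the fields bound the
histories (`norm_history_le`); and the bound extends from the dense domain of the generator to the
whole space (`StateModel.exists_norm_le`).

The evolution is treated for abstract Hilbert spaces of fields and an adjoint pair of operators in
place of the curls (`StateModel`, `IsCurlPair`); `isOperator_iff` and `isCurlPair_curlGraph` connect
it with Maxwell's equations.
-/

set_option linter.unusedSectionVars false

noncomputable section

namespace Maxwell

/-! ### Generation of contraction semigroups -/

section Generation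

variable {X : Type*} [NormedAddCommGroup X] [InnerProductSpace ℂ X]

/-- A maximal dissipative linear relation, shifted by `ω`: the graph `G` of an operator `A` on a
Hilbert space such that `A - ω` is dissipative and `lam - A` is onto for all `lam > ω`. That `G` is
single valued is part of the definition; that its domain is dense follows. -/
structure IsMaxDissipative (ω : ℝ) (G : Submodule ℂ (X × X)) : Prop where
  re_inner_le : ∀ p ∈ G, (inner ℂ p.1 p.2).re ≤ ω * ‖p.1‖ ^ 2
  exists_sub_eq : ∀ lam : ℝ, ω < lam → ∀ f : X, ∃ p ∈ G, (lam : ℂ) • p.1 - p.2 = f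
  eq_zero : ∀ y, ((0 : X), y) ∈ G → y = 0

variable {ω : ℝ} {G : Submodule ℂ (X × X)}

lemma re_inner_ofReal_smul_self (r : ℝ) (x : X) :
    (inner ℂ x ((r : ℂ) • x)).re = r * ‖x‖ ^ 2 := by
  rw [inner_smul_right, inner_self_eq_norm_sq_to_K, Complex.re_ofReal_mul]
  norm_cast

lemma re_inner_le_norm_mul (x y : X) : (inner ℂ x y).re ≤ ‖x‖ * ‖y‖ :=
  (Complex.re_le_norm _).trans (norm_inner_le_norm x y)

lemma re_inner_clm_le (B : X →L[ℂ] X) (x : X) : (inner ℂ x (B x)).re ≤ ‖B‖ * ‖x‖ ^ 2 := by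
  have h1 := re_inner_le_norm_mul x (B x)
  have h2 := B.le_opNorm x
  nlinarith [norm_nonneg x]

lemma IsMaxDissipative.mul_norm_le (hG : IsMaxDissipative ω G) (lam : ℝ) {p : X × X}
    (hp : p ∈ G) : (lam - ω) * ‖p.1‖ ≤ ‖(lam : ℂ) • p.1 - p.2‖ := by
  have h1 := hG.re_inner_le p hp
  have h2 := re_inner_le_norm_mul p.1 ((lam : ℂ) • p.1 - p.2)
  rw [inner_sub_right, Complex.sub_re, re_inner_ofReal_smul_self] at h2
  rcases (norm_nonneg p.1).eq_or_lt with h0 | h0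
  · rw [← h0]; simp
  · nlinarith

/-- The domain of a maximal dissipative operator is dense: a vector `z` orthogonal to it is
`lam x - A x` for some `x` in the domain, and testing with `x` yields `x = 0`. -/
lemma IsMaxDissipative.dense (hG : IsMaxDissipative ω G) [CompleteSpace X] :
    Dense (Prod.fst '' (G : Set (X × X))) := by
  have key : (G.map (LinearMap.fst ℂ X X))ᗮ = ⊥ := by
    rw [Submodule.eq_bot_iff]
    intro z hz
    obtain ⟨p, hp, hpz⟩ := hG.exists_sub_eq (ω + 1) (by linarith) z
    have h0 : inner ℂ p.1 z = 0 :=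
      (Submodule.mem_orthogonal _ _).1 hz _ (Submodule.mem_map_of_mem (f := LinearMap.fst ℂ X X) hp)
    have h1 := hG.re_inner_le p hp
    have h2 : (inner ℂ p.1 z).re = 0 := by rw [h0]; rfl
    rw [← hpz, inner_sub_right, Complex.sub_re, re_inner_ofReal_smul_self] at h2
    have h3 : p.1 = 0 := by
      have : ‖p.1‖ ^ 2 ≤ 0 := by linarith
      have := pow_eq_zero_iff (two_ne_zero) |>.1 (le_antisymm this (by positivity))
      simpa using this
    have h4 : p.2 = 0 := hG.eq_zero _ (by rw [← h3]; exact hp)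
    rw [← hpz, h3, h4]; simp
  have := (Submodule.topologicalClosure_eq_top_iff (K := G.map (LinearMap.fst ℂ X X))).2 key
  have h := Submodule.dense_iff_topologicalClosure_eq_top.2 this
  rwa [Submodule.map_coe] at h

/-- The resolvent of a maximal dissipative operator. -/
lemma IsMaxDissipative.exists_resolvent (hG : IsMaxDissipative ω G) {lam : ℝ} (hl : ω < lam) :
    ∃ R : X →L[ℂ] X, (∀ f, ‖R f‖ ≤ (lam - ω)⁻¹ * ‖f‖) ∧ (∀ f, (R f, (lam : ℂ) • R f - f) ∈ G) ∧
      ∀ p ∈ G, R ((lam : ℂ) • p.1 - p.2) = p.1 := by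
  have hpos : 0 < lam - ω := by linarith
  choose P hP hPf using hG.exists_sub_eq lam hl
  have huniq : ∀ p ∈ G, ∀ q ∈ G, (lam : ℂ) • p.1 - p.2 = (lam : ℂ) • q.1 - q.2 → p.1 = q.1 := by
    intro p hp q hq h
    have h1 := hG.mul_norm_le lam (G.sub_mem hp hq)
    have h2 : (lam : ℂ) • (p - q).1 - (p - q).2 = 0 := by
      simp only [Prod.fst_sub, Prod.snd_sub, smul_sub]
      rw [← sub_eq_zero] at h
      rw [← h]; abel
    rw [h2, norm_zero] at h1
    have : ‖(p - q).1‖ = 0 := le_antisymm (by nlinarith) (norm_nonneg _)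
    simpa [sub_eq_zero] using this
  have hPG : ∀ f, ((P f).1, (lam : ℂ) • (P f).1 - f) ∈ G := by
    intro f
    have h : (P f).2 = (lam : ℂ) • (P f).1 - f := by
      have := hPf f
      rw [sub_eq_iff_eq_add] at this
      rw [this]; abel
    rw [← h]; exact hP f
  let L : X →ₗ[ℂ] X :=
    { toFun := fun f => (P f).1
      map_add' := fun f g => by
        refine huniq _ (hP _) ((P f).1 + (P g).1, (P f).2 + (P g).2) (G.add_mem (hP f) (hP g)) ?_
        rw [hPf]
        simp only [smul_add]
        rw [add_sub_add_comm, hPf, hPf]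
      map_smul' := fun c f => by
        refine huniq _ (hP _) (c • (P f).1, c • (P f).2) (G.smul_mem c (hP f)) ?_
        rw [hPf]
        simp only
        rw [smul_comm, ← smul_sub, hPf] }
  have hL : ∀ f, ‖L f‖ ≤ (lam - ω)⁻¹ * ‖f‖ := by
    intro f
    have h := hG.mul_norm_le lam (hP f)
    rw [hPf] at h
    rw [inv_mul_eq_div, le_div_iff₀ hpos]
    change ‖(P f).1‖ * _ ≤ _
    linarith
  refine ⟨L.mkContinuous _ hL, hL, hPG, fun p hp => huniq _ (hP _) _ hp (hPf _)⟩

variable [CompleteSpace X]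

lemma exp_add_of_commute_clm {A B : X →L[ℂ] X} (h : Commute A B) :
    NormedSpace.exp (A + B) = NormedSpace.exp A * NormedSpace.exp B := by
  let +nondep : NormedAlgebra ℚ (X →L[ℂ] X) := NormedAlgebra.restrictScalars ℚ ℂ _
  exact NormedSpace.exp_add_of_commute h

/-- The exponential of a dissipative bounded operator is a contraction. -/
lemma norm_exp_smul_apply_le (A : X →L[ℂ] X) (hA : ∀ x, (inner ℂ x (A x)).re ≤ 0) {t : ℝ}
    (ht : 0 ≤ t) (x : X) : ‖NormedSpace.exp ((t : ℝ) • A) x‖ ≤ ‖x‖ := by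
  let u : ℝ → X := fun s => NormedSpace.exp (s • A) x
  have hu : ∀ s, HasDerivAt u (A (u s)) s := fun s => by
    exact ((ContinuousLinearMap.apply ℂ X x).restrictScalars ℝ).hasFDerivAt.comp_hasDerivAt s
      (hasDerivAt_exp_smul_const' (𝕂 := ℝ) A s)
  have hn : ∀ s, HasDerivAt (fun s => ‖u s‖ ^ 2) (2 * (inner ℂ (u s) (A (u s))).re) s := by
    intro s
    let _ := InnerProductSpace.rclikeToReal ℂ X
    have h := (hu s).norm_sq
    rwa [real_inner_eq_re_inner ℂ] at h
  have hanti : Antitone (fun s => ‖u s‖ ^ 2) :=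
    antitone_of_deriv_nonpos (fun s => (hn s).differentiableAt)
      (fun s => by rw [(hn s).deriv]; linarith [hA (u s)])
  have h := hanti ht
  have h0 : u 0 = x := by simp [u]
  simp only [h0] at h
  exact (sq_le_sq₀ (norm_nonneg _) (norm_nonneg _)).1 h

/-- The Yosida approximations `A n = lam (lam R(lam) - 1)`, `lam = n + 1`, where `R(lam)` is the
resolvent: they are bounded, dissipative, commute, and converge to the operator on its domain. -/
lemma IsMaxDissipative.exists_yosida (hG : IsMaxDissipative 0 G) :
    ∃ A : ℕ → X →L[ℂ] X, (∀ n x, (inner ℂ x (A n x)).re ≤ 0) ∧ (∀ n m, Commute (A n) (A m)) ∧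
      (∀ p ∈ G, Tendsto (fun n => A n p.1) atTop (𝓝 p.2)) ∧
      ∀ n, ∀ p ∈ G, ‖A n p.1‖ ≤ ‖p.2‖ := by
  have hpos : ∀ n : ℕ, (0 : ℝ) < n + 1 := fun n => by positivity
  choose R hRn hRG hR using fun n : ℕ => hG.exists_resolvent (hpos n)
  simp only [sub_zero] at hRn
  let lam : ℕ → ℂ := fun n => ((n + 1 : ℝ) : ℂ)
  have hlam : ∀ n, ‖lam n‖ = n + 1 := fun n => by
    rw [Complex.norm_real, Real.norm_of_nonneg (hpos n).le]
  let A : ℕ → X →L[ℂ] X := fun n => lam n • (lam n • R n - 1)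
  have hAx : ∀ n x, A n x = lam n • (lam n • R n x - x) := fun n x => rfl
  have hAG : ∀ n, ∀ p ∈ G, A n p.1 = lam n • R n p.2 := by
    intro n p hp
    have h := hR n p hp
    rw [map_sub, map_smul, sub_eq_iff_eq_add] at h
    rw [hAx, show lam n • R n p.1 = p.1 + R n p.2 from h, add_sub_cancel_left]
  have hlR : ∀ n x, ‖lam n • R n x‖ ≤ ‖x‖ := by
    intro n x
    rw [norm_smul, hlam]
    have := mul_le_mul_of_nonneg_left (hRn n x) (hpos n).le
    rwa [mul_inv_cancel_left₀ (hpos n).ne'] at this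
  -- The resolvent identity makes the resolvents commute.
  have hcommR : ∀ n m, R n * R m = R m * R n := by
    have key : ∀ n m f, (lam n - lam m) • R n (R m f) = R m f - R n f := by
      intro n m f
      have h := hR n _ (hRG m f)
      have h2 : (lam n : ℂ) • R m f - (lam m • R m f - f) = (lam n - lam m) • R m f + f := by
        rw [sub_smul]; abel
      rw [show (((n + 1 : ℝ) : ℂ)) • (R m f, ((m + 1 : ℝ) : ℂ) • R m f - f).1 -
        (R m f, ((m + 1 : ℝ) : ℂ) • R m f - f).2 = _ from h2, map_add, map_smul] at h
      exact eq_sub_of_add_eq h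
    intro n m
    rcases eq_or_ne n m with rfl | hnm
    · rfl
    ext f
    have hne : lam n - lam m ≠ 0 := by
      simp only [lam, ne_eq, sub_eq_zero, Complex.ofReal_inj, add_left_inj, Nat.cast_inj]
      exact hnm
    have h1 := key n m f
    have h2 := key m n f
    apply smul_right_injective X hne
    change (lam n - lam m) • R n (R m f) = (lam n - lam m) • R m (R n f)
    rw [h1, ← neg_sub (lam m), neg_smul, h2]; abel
  -- On the domain `lam R(lam) p - p = R(lam) (A p)` tends to `0`; the domain is dense.
  have hlim : ∀ y, Tendsto (fun n => lam n • R n y) atTop (𝓝 y) := by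
    intro y
    rw [Metric.tendsto_atTop]
    intro e he
    obtain ⟨_, hpy, ⟨p, hp, rfl⟩⟩ := Metric.dense_iff.1 hG.dense y (e / 3) (by positivity)
    obtain ⟨N, hN⟩ := exists_nat_gt (‖p.2‖ / (e / 3))
    refine ⟨N, fun n hn => ?_⟩
    have h1 : ‖lam n • R n p.1 - p.1‖ < e / 3 := by
      have h := hR n p hp
      rw [map_sub, map_smul, sub_eq_iff_eq_add] at h
      rw [show lam n • R n p.1 = p.1 + R n p.2 from h, add_sub_cancel_left]
      refine (hRn n p.2).trans_lt ?_
      rw [inv_mul_eq_div, div_lt_iff₀ (hpos n)]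
      rw [div_lt_iff₀ (by positivity)] at hN
      have : (N : ℝ) ≤ n := by exact_mod_cast hn
      nlinarith
    have h2 := hlR n (y - p.1)
    rw [Metric.mem_ball, dist_comm, dist_eq_norm] at hpy
    rw [dist_eq_norm]
    calc ‖lam n • R n y - y‖
        = ‖lam n • R n (y - p.1) + (lam n • R n p.1 - p.1) - (y - p.1)‖ := by
          congr 1; rw [map_sub, smul_sub]; abel
      _ ≤ ‖lam n • R n (y - p.1)‖ + ‖lam n • R n p.1 - p.1‖ + ‖y - p.1‖ :=
          (norm_sub_le _ _).trans (add_le_add_left (norm_add_le _ _) _)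
      _ < e := by linarith
  refine ⟨A, ?_, ?_, ?_, ?_⟩
  · -- With `y = lam R x - x` one has `x = lam R x - y`, and `y = A (R x)` is dissipative.
    intro n x
    have h1 := hG.re_inner_le _ (hRG n x)
    rw [zero_mul] at h1
    set y := lam n • R n x - x with hy
    have hx : x = lam n • R n x - y := by rw [hy]; abel
    have h1' : (inner ℂ (R n x) y).re ≤ 0 := h1
    rw [hAx, ← hy, inner_smul_right, Complex.re_ofReal_mul]
    refine mul_nonpos_of_nonneg_of_nonpos (hpos n).le ?_
    rw [hx, inner_sub_left, Complex.sub_re, inner_smul_left, Complex.conj_ofReal,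
      Complex.re_ofReal_mul]
    have h3 : 0 ≤ (inner ℂ y y).re := inner_self_nonneg (𝕜 := ℂ)
    nlinarith [hpos n]
  · intro n m
    have hR' : Commute (R n) (R m) := hcommR n m
    exact (((hR'.smul_left _).smul_right _).sub_left (Commute.one_left _) |>.sub_right
      (Commute.one_right _)).smul_left _ |>.smul_right _
  · intro p hp
    simp only [hAG _ p hp]
    exact hlim p.2
  · intro n p hp
    rw [hAG n p hp]
    exact hlR n p.2

/-- The derivative of an orbit of the group generated by a bounded operator. -/
lemma hasDerivAt_exp_smul_apply (A : X →L[ℂ] X) (x : X) (s : ℝ) :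
    HasDerivAt (fun s : ℝ => NormedSpace.exp (s • A) x) (NormedSpace.exp (s • A) (A x)) s :=
  ((ContinuousLinearMap.apply ℂ X x).restrictScalars ℝ).hasFDerivAt.comp_hasDerivAt s
    (hasDerivAt_exp_smul_const (𝕂 := ℝ) A s)

lemma norm_exp_smul_apply_sub_le (A B : X →L[ℂ] X) (hA : ∀ x, (inner ℂ x (A x)).re ≤ 0)
    (hB : ∀ x, (inner ℂ x (B x)).re ≤ 0) (hAB : Commute A B) {t : ℝ} (ht : 0 ≤ t) (x : X) :
    ‖NormedSpace.exp (t • A) x - NormedSpace.exp (t • B) x‖ ≤ t * ‖A x - B x‖ := by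
  -- `exp (t A) - exp (t B)` is the increment of `s ↦ exp (t B) exp (s (A - B))`.
  have hd : ∀ s ∈ Icc (0 : ℝ) t, HasDerivWithinAt
      (fun s : ℝ => NormedSpace.exp (t • B) (NormedSpace.exp (s • (A - B)) x))
      (NormedSpace.exp (t • B) (NormedSpace.exp (s • (A - B)) ((A - B) x))) (Icc 0 t) s := by
    intro s _
    exact (((NormedSpace.exp (t • B)).restrictScalars ℝ).hasFDerivAt.comp_hasDerivAt s
      (hasDerivAt_exp_smul_apply (A - B) x s)).hasDerivWithinAt
  have hcomb : ∀ s z, NormedSpace.exp (t • B) (NormedSpace.exp (s • (A - B)) z) =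
      NormedSpace.exp ((t - s) • B) (NormedSpace.exp (s • A) z) := by
    intro s z
    have h1 : Commute (t • B) (s • (A - B)) :=
      ((hAB.symm.sub_right (Commute.refl B)).smul_left t).smul_right s
    have h2 : Commute ((t - s) • B) (s • A) := (hAB.symm.smul_left _).smul_right s
    rw [← mul_apply_eq_comp, ← mul_apply_eq_comp,
      ← exp_add_of_commute_clm h1, ← exp_add_of_commute_clm h2]
    congr 2
    rw [sub_smul, smul_sub]; abel
  have h := norm_image_sub_le_of_norm_deriv_le_segment' hd (C := ‖A x - B x‖) (fun s hs => by
    rw [hcomb]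
    exact (norm_exp_smul_apply_le B hB (by linarith [hs.2]) _).trans
      (norm_exp_smul_apply_le A hA hs.1 _)) t (right_mem_Icc.2 ht)
  rw [hcomb t x] at h
  simp only [sub_self, zero_smul, NormedSpace.exp_zero, one_apply_eq_self,
    sub_zero] at h
  linarith

/-- The Lumer-Phillips theorem: a maximal dissipative operator generates a contraction semigroup,
obtained as the limit of the exponentials of its Yosida approximations. -/
theorem IsMaxDissipative.exists_contraction_semigroup (hG : IsMaxDissipative 0 G) :
    ∃ T : ℝ → X →L[ℂ] X, IsSemigroupGeneratedBy T (fun x y => (x, y) ∈ G) ∧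
      ∀ t, 0 ≤ t → ∀ x, ‖T t x‖ ≤ ‖x‖ := by
  obtain ⟨A, hdiss, hcomm, hlim, hbd⟩ := hG.exists_yosida
  let e : ℕ → ℝ → X →L[ℂ] X := fun n t => NormedSpace.exp (t • A n)
  have he : ∀ n t, 0 ≤ t → ∀ x, ‖e n t x‖ ≤ ‖x‖ := fun n t ht x =>
    norm_exp_smul_apply_le (A n) (hdiss n) ht x
  -- The exponentials form Cauchy sequences on the domain, hence everywhere, being contractions.
  have hconv : ∀ t, 0 ≤ t → ∀ x, ∃ z, Tendsto (fun n => e n t x) atTop (𝓝 z) := by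
    intro t ht x
    apply cauchySeq_tendsto_of_complete
    rw [Metric.cauchySeq_iff]
    intro r hr
    obtain ⟨_, hpx, ⟨p, hp, rfl⟩⟩ := Metric.dense_iff.1 hG.dense x (r / 3) (by positivity)
    rw [Metric.mem_ball, dist_comm, dist_eq_norm] at hpx
    obtain ⟨N, hN⟩ := Metric.cauchySeq_iff.1 (hlim p hp).cauchySeq (r / 3 / (t + 1))
      (by positivity)
    refine ⟨N, fun n hn m hm => ?_⟩
    have h1 := norm_exp_smul_apply_sub_le (A n) (A m) (hdiss n) (hdiss m) (hcomm n m) ht p.1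
    have h2 := hN n hn m hm
    rw [dist_eq_norm, lt_div_iff₀ (by positivity)] at h2
    have h3 : t * ‖A n p.1 - A m p.1‖ < r / 3 := by
      nlinarith [norm_nonneg (A n p.1 - A m p.1)]
    rw [dist_eq_norm]
    calc ‖e n t x - e m t x‖
        = ‖e n t (x - p.1) - e m t (x - p.1) + (e n t p.1 - e m t p.1)‖ := by
          congr 1; simp only [map_sub]; abel
      _ ≤ ‖e n t (x - p.1)‖ + ‖e m t (x - p.1)‖ + ‖e n t p.1 - e m t p.1‖ :=
          (norm_add_le _ _).trans (add_le_add_left (norm_sub_le _ _) _)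
      _ < r := by
          have := he n t ht (x - p.1)
          have := he m t ht (x - p.1)
          have : ‖e n t p.1 - e m t p.1‖ < r / 3 := h1.trans_lt h3
          linarith
  choose! Tf hTf using hconv
  have hTf' : ∀ t, 0 ≤ t → Tendsto (fun n x => e n t x) atTop (𝓝 (Tf t)) := fun t ht =>
    tendsto_pi_nhds.2 (hTf t ht)
  let T : ℝ → X →L[ℂ] X := fun t =>
    if ht : 0 ≤ t then continuousLinearMapOfTendsto (fun n => e n t) (hTf' t ht) else 0
  have hT : ∀ t, 0 ≤ t → ∀ x, Tendsto (fun n => e n t x) atTop (𝓝 (T t x)) := by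
    intro t ht x
    have : T t = continuousLinearMapOfTendsto (fun n => e n t) (hTf' t ht) := dif_pos ht
    rw [this]
    exact hTf t ht x
  have hcontr : ∀ t, 0 ≤ t → ∀ x, ‖T t x‖ ≤ ‖x‖ := fun t ht x =>
    le_of_tendsto (hT t ht x).norm (Eventually.of_forall fun n => he n t ht x)
  -- Strong continuity at `0`, uniformly in `n`.
  have hest1 : ∀ n, ∀ p ∈ G, ∀ t, 0 ≤ t → ∀ x,
      ‖e n t x - x‖ ≤ 2 * ‖x - p.1‖ + t * ‖p.2‖ := by
    intro n p hp t ht x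
    have h1 : ‖e n t p.1 - p.1‖ ≤ t * ‖p.2‖ := by
      have h := norm_exp_smul_apply_sub_le (A n) 0 (hdiss n) (fun x => by simp)
        (Commute.zero_right _) ht p.1
      simp only [smul_zero, NormedSpace.exp_zero, one_apply_eq_self,
        zero_apply, sub_zero] at h
      exact h.trans (mul_le_mul_of_nonneg_left (hbd n p hp) ht)
    have h2 := he n t ht (x - p.1)
    calc ‖e n t x - x‖ = ‖e n t (x - p.1) - (x - p.1) + (e n t p.1 - p.1)‖ := by
          congr 1; simp only [map_sub]; abel
      _ ≤ ‖e n t (x - p.1)‖ + ‖x - p.1‖ + ‖e n t p.1 - p.1‖ :=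
          (norm_add_le _ _).trans (add_le_add_left (norm_sub_le _ _) _)
      _ ≤ _ := by linarith
  -- A quantitative form of `T t p = p + t A p + o(t)`; here `q` in the domain approximates `A p`.
  have hest2 : ∀ p ∈ G, ∀ q ∈ G, ∀ t, 0 ≤ t →
      ‖T t p.1 - p.1 - t • p.2‖ ≤ t * (2 * ‖p.2 - q.1‖ + t * ‖q.2‖) := by
    intro p hp q hq t ht
    have hn : ∀ n, ‖e n t p.1 - p.1 - t • p.2‖ ≤
        (‖A n p.1 - p.2‖ + (2 * ‖p.2 - q.1‖ + t * ‖q.2‖)) * t := by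
      intro n
      have hd : ∀ s ∈ Icc (0 : ℝ) t, HasDerivWithinAt (fun s : ℝ => e n s p.1 - s • p.2)
          (e n s (A n p.1) - (1 : ℝ) • p.2) (Icc 0 t) s := fun s _ =>
        ((hasDerivAt_exp_smul_apply (A n) p.1 s).sub
          ((hasDerivAt_id s).smul_const p.2)).hasDerivWithinAt
      have h := norm_image_sub_le_of_norm_deriv_le_segment' hd
        (C := ‖A n p.1 - p.2‖ + (2 * ‖p.2 - q.1‖ + t * ‖q.2‖)) (fun s hs => by
          have h1 := hest1 n q hq s hs.1 p.2
          have h2 := he n s hs.1 (A n p.1 - p.2)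
          calc ‖e n s (A n p.1) - (1 : ℝ) • p.2‖
              = ‖e n s (A n p.1 - p.2) + (e n s p.2 - p.2)‖ := by
                congr 1; rw [map_sub, one_smul]; abel
            _ ≤ ‖e n s (A n p.1 - p.2)‖ + ‖e n s p.2 - p.2‖ := norm_add_le _ _
            _ ≤ _ := by
                have : s * ‖q.2‖ ≤ t * ‖q.2‖ :=
                  mul_le_mul_of_nonneg_right hs.2.le (norm_nonneg _)
                linarith) t (right_mem_Icc.2 ht)
      have h0 : e n 0 p.1 = p.1 := by simp [e]
      rw [h0, zero_smul, sub_zero, sub_zero] at h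
      rwa [show e n t p.1 - p.1 - t • p.2 = e n t p.1 - t • p.2 - p.1 by abel]
    have hl : Tendsto (fun n => (‖A n p.1 - p.2‖ + (2 * ‖p.2 - q.1‖ + t * ‖q.2‖)) * t) atTop
        (𝓝 ((‖p.2 - p.2‖ + (2 * ‖p.2 - q.1‖ + t * ‖q.2‖)) * t)) :=
      ((((hlim p hp).sub_const _).norm).add_const _).mul_const _
    have := le_of_tendsto_of_tendsto' (((hT t ht p.1).sub_const p.1).sub_const (t • p.2)).norm hl hn
    rw [sub_self, norm_zero, zero_add] at this
    linarith
  have hgen : ∀ p ∈ G, Tendsto (fun h : ℝ => ((h⁻¹ : ℝ) : ℂ) • (T h p.1 - p.1)) (𝓝[>] 0)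
      (𝓝 p.2) := by
    intro p hp
    rw [Metric.tendsto_nhdsWithin_nhds]
    intro r hr
    obtain ⟨_, hqp, ⟨q, hq, rfl⟩⟩ := Metric.dense_iff.1 hG.dense p.2 (r / 4) (by positivity)
    rw [Metric.mem_ball, dist_comm, dist_eq_norm] at hqp
    refine ⟨r / 2 / (‖q.2‖ + 1), by positivity, fun {h} (hh : 0 < h) hd => ?_⟩
    rw [dist_zero_right, Real.norm_of_nonneg hh.le, lt_div_iff₀ (by positivity)] at hd
    have h1 := hest2 p hp q hq h hh.le
    have h2 : ((h⁻¹ : ℝ) : ℂ) • (T h p.1 - p.1) - p.2 =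
        ((h⁻¹ : ℝ) : ℂ) • (T h p.1 - p.1 - h • p.2) := by
      rw [smul_sub _ _ (h • p.2)]
      congr 1
      rw [Complex.coe_smul, smul_smul, inv_mul_cancel₀ hh.ne', one_smul]
    rw [dist_eq_norm, h2, norm_smul, Complex.norm_real, norm_inv, Real.norm_of_nonneg hh.le,
      inv_mul_lt_iff₀ hh]
    refine h1.trans_lt (mul_lt_mul_of_pos_left ?_ hh)
    nlinarith [norm_nonneg q.2]
  refine ⟨T, ⟨?_, ?_, ?_, ?_⟩, hcontr⟩
  · ext x
    refine tendsto_nhds_unique (hT 0 le_rfl x) ?_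
    simp [e]
  · intro s t hs ht
    ext x
    refine tendsto_nhds_unique (hT (s + t) (add_nonneg hs ht) x) ?_
    have hsplit : ∀ n, e n (s + t) x = e n s (e n t x) := by
      intro n
      have hc : Commute (s • A n) (t • A n) := ((Commute.refl (A n)).smul_left s).smul_right t
      change NormedSpace.exp ((s + t) • A n) x = _
      rw [add_smul, exp_add_of_commute_clm hc]
      rfl
    simp only [hsplit]
    have h1 : Tendsto (fun n => e n s (e n t x) - e n s (T t x)) atTop (𝓝 0) := by
      refine squeeze_zero_norm (fun n => ?_) (((hT t ht x).sub_const (T t x)).norm.trans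
        (by rw [sub_self, norm_zero]))
      rw [← map_sub]
      exact he n s hs _
    have h2 := h1.add (hT s hs (T t x))
    simpa using h2
  · intro x
    rw [Metric.tendsto_nhdsWithin_nhds]
    intro r hr
    obtain ⟨_, hqx, ⟨q, hq, rfl⟩⟩ := Metric.dense_iff.1 hG.dense x (r / 4) (by positivity)
    rw [Metric.mem_ball, dist_comm, dist_eq_norm] at hqx
    refine ⟨r / 2 / (‖q.2‖ + 1), by positivity, fun {h} (hh : 0 < h) hd => ?_⟩
    rw [dist_zero_right, Real.norm_of_nonneg hh.le, lt_div_iff₀ (by positivity)] at hd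
    have h1 : ‖T h x - x‖ ≤ 2 * ‖x - q.1‖ + h * ‖q.2‖ :=
      le_of_tendsto ((hT h hh.le x).sub_const x).norm
        (Eventually.of_forall fun n => hest1 n q hq h hh.le x)
    rw [dist_eq_norm]
    nlinarith [norm_nonneg q.2]
  · intro x y
    refine ⟨fun h => hgen (x, y) h, fun h => ?_⟩
    -- The generator is a dissipative extension of `G`, hence equal to it as `1 - G` is onto.
    obtain ⟨p, hp, hpxy⟩ := hG.exists_sub_eq 1 one_pos (x - y)
    have hd := h.sub (hgen p hp)
    have hz : y - p.2 = x - p.1 := by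
      rw [Complex.ofReal_one, one_smul, sub_eq_sub_iff_add_eq_add] at hpxy
      rw [sub_eq_sub_iff_add_eq_add, add_comm y, hpxy]
    have h1 : ∀ᶠ s : ℝ in 𝓝[>] 0, (inner ℂ (x - p.1) (((s⁻¹ : ℝ) : ℂ) • (T s x - x) -
        ((s⁻¹ : ℝ) : ℂ) • (T s p.1 - p.1))).re ≤ 0 := by
      filter_upwards [self_mem_nhdsWithin] with s hs
      have hs : 0 < s := hs
      rw [← smul_sub, inner_smul_right, Complex.re_ofReal_mul]
      refine mul_nonpos_of_nonneg_of_nonpos (inv_nonneg.2 hs.le) ?_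
      rw [sub_sub_sub_comm, ← map_sub, inner_sub_right, Complex.sub_re]
      have h2 := re_inner_le_norm_mul (x - p.1) (T s (x - p.1))
      have h3 := hcontr s hs.le (x - p.1)
      have h4 : (inner ℂ (x - p.1) (x - p.1)).re = ‖x - p.1‖ ^ 2 := inner_self_eq_norm_sq (𝕜 := ℂ) _
      nlinarith [norm_nonneg (x - p.1)]
    have h2 := le_of_tendsto (Complex.continuous_re.continuousAt.tendsto.comp
      (Tendsto.inner (𝕜 := ℂ) (tendsto_const_nhds (x := x - p.1)) hd)) h1
    rw [hz, show (inner ℂ (x - p.1) (x - p.1)).re = ‖x - p.1‖ ^ 2 from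
      inner_self_eq_norm_sq (𝕜 := ℂ) _] at h2
    have h3 : x - p.1 = 0 := by
      have := pow_eq_zero_iff (two_ne_zero) |>.1 (le_antisymm h2 (by positivity))
      simpa using this
    rw [h3] at hz
    rw [sub_eq_zero.1 h3, sub_eq_zero.1 hz]
    exact hp

/-- The Lumer-Phillips theorem for quasi-dissipative operators. -/
theorem IsMaxDissipative.exists_semigroup (hG : IsMaxDissipative ω G) :
    ∃ T : ℝ → X →L[ℂ] X, IsSemigroupGeneratedBy T (fun x y => (x, y) ∈ G) ∧
      ∀ t, 0 ≤ t → ∀ x, ‖T t x‖ ≤ Real.exp (ω * t) * ‖x‖ := by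
  -- The semigroup is `exp (ω t)` times the contraction semigroup generated by `A - ω`.
  let Φ : X × X →ₗ[ℂ] X × X :=
    (LinearMap.fst ℂ X X).prod (LinearMap.snd ℂ X X + (ω : ℂ) • LinearMap.fst ℂ X X)
  have hmem : ∀ p : X × X, p ∈ G.comap Φ ↔ (p.1, p.2 + (ω : ℂ) • p.1) ∈ G := fun p => Iff.rfl
  have hG' : IsMaxDissipative 0 (G.comap Φ) := by
    refine ⟨fun p hp => ?_, fun lam hl f => ?_, fun y hy => ?_⟩
    · have h := hG.re_inner_le _ ((hmem p).1 hp)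
      rw [inner_add_right, Complex.add_re, re_inner_ofReal_smul_self] at h
      simp only at h
      linarith
    · obtain ⟨p, hp, h⟩ := hG.exists_sub_eq (ω + lam) (by linarith) f
      refine ⟨(p.1, p.2 - (ω : ℂ) • p.1), (hmem _).2 (by simpa using hp), ?_⟩
      rw [← h, Complex.ofReal_add, add_smul]
      simp only
      generalize (ω : ℂ) • p.1 = a
      abel
    · have := (hmem _).1 hy
      simp only [smul_zero, add_zero] at this
      exact hG.eq_zero y this
  obtain ⟨T, hT, hTn⟩ := hG'.exists_contraction_semigroup
  have hcoe : ∀ t x, ((Real.exp (ω * t) : ℂ) • T t) x = (Real.exp (ω * t) : ℂ) • T t x :=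
    fun t x => rfl
  refine ⟨fun t => (Real.exp (ω * t) : ℂ) • T t, ⟨?_, ?_, ?_, ?_⟩, ?_⟩
  · simp [hT.zero]
  · intro s t hs ht
    ext x
    simp only [hT.add s t hs ht, mul_add, Real.exp_add, Complex.ofReal_mul,
      smul_apply, ContinuousLinearMap.comp_apply, map_smul, smul_smul]
    rw [mul_comm]
  · intro x
    have h1 : Tendsto (fun t : ℝ => (Real.exp (ω * t) : ℂ)) (𝓝[>] 0) (𝓝 1) := by
      have : Continuous fun t : ℝ => (Real.exp (ω * t) : ℂ) := by fun_prop
      simpa using (this.tendsto 0).mono_left nhdsWithin_le_nhds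
    simpa using h1.smul (hT.tendsto x)
  · intro x y
    have hder : Tendsto (fun h : ℝ => ((h⁻¹ : ℝ) : ℂ) * ((Real.exp (ω * h) : ℂ) - 1)) (𝓝[>] 0)
        (𝓝 (ω : ℂ)) := by
      have h1 : HasDerivAt (fun h : ℝ => Real.exp (ω * h)) ω 0 := by
        simpa using (((hasDerivAt_id (0 : ℝ)).const_mul ω).exp)
      have h2 := (hasDerivAt_iff_tendsto_slope_zero.1 h1).mono_left
        (nhdsWithin_mono 0 (fun h (hh : 0 < h) => hh.ne'))
      have h3 := (Complex.continuous_ofReal.tendsto ω).comp h2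
      refine h3.congr fun h => ?_
      simp
    have hone : Tendsto (fun h : ℝ => (Real.exp (ω * h) : ℂ)) (𝓝[>] 0) (𝓝 1) := by
      have : Continuous fun t : ℝ => (Real.exp (ω * t) : ℂ) := by fun_prop
      simpa using (this.tendsto 0).mono_left nhdsWithin_le_nhds
    have hinv : Tendsto (fun h : ℝ => (Real.exp (-(ω * h)) : ℂ)) (𝓝[>] 0) (𝓝 1) := by
      have : Continuous fun t : ℝ => (Real.exp (-(ω * t)) : ℂ) := by fun_prop
      simpa using (this.tendsto 0).mono_left nhdsWithin_le_nhds
    have h := hT.generator x (y - (ω : ℂ) • x)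
    rw [hmem] at h
    simp only [sub_add_cancel] at h
    rw [h]
    have hx := hder.smul_const x
    constructor
    · intro h1
      have h2 := (hone.smul h1).add hx
      rw [one_smul, sub_add_cancel] at h2
      refine h2.congr fun s => ?_
      simp only [hcoe, smul_smul, smul_sub, mul_sub, sub_smul, mul_one]
      rw [mul_comm (((Real.exp (ω * s)) : ℂ))]
      abel
    · intro h1
      have h2 := hinv.smul (h1.sub hx)
      rw [one_smul] at h2
      refine h2.congr fun s => ?_
      have hs : ((s⁻¹ : ℝ) : ℂ) • (((Real.exp (ω * s) : ℂ) • T s) x - x) -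
          (((s⁻¹ : ℝ) : ℂ) * ((Real.exp (ω * s) : ℂ) - 1)) • x =
          (Real.exp (ω * s) : ℂ) • ((s⁻¹ : ℝ) : ℂ) • (T s x - x) := by
        simp only [hcoe, smul_smul, smul_sub, mul_sub, sub_smul, mul_one]
        rw [mul_comm (((Real.exp (ω * s)) : ℂ))]
        abel
      rw [hs, smul_smul, ← Complex.ofReal_mul, ← Real.exp_add, neg_add_cancel, Real.exp_zero,
        Complex.ofReal_one, one_smul]
  · intro t ht x
    rw [hcoe, norm_smul, Complex.norm_real, Real.norm_of_nonneg (Real.exp_pos _).le]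
    exact mul_le_mul_of_nonneg_left (hTn t ht x) (Real.exp_pos _).le

/-- Bounded perturbations of maximal dissipative operators are maximal dissipative up to a
shift. -/
theorem IsMaxDissipative.add_bounded (hG : IsMaxDissipative 0 G) (B : X →L[ℂ] X) :
    IsMaxDissipative ‖B‖ (G.comap ((LinearMap.fst ℂ X X).prod
      (LinearMap.snd ℂ X X - (B : X →ₗ[ℂ] X) ∘ₗ LinearMap.fst ℂ X X))) := by
  have hmem : ∀ p : X × X, p ∈ G.comap ((LinearMap.fst ℂ X X).prod
      (LinearMap.snd ℂ X X - (B : X →ₗ[ℂ] X) ∘ₗ LinearMap.fst ℂ X X)) ↔ (p.1, p.2 - B p.1) ∈ G :=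
    fun p => Iff.rfl
  refine ⟨fun p hp => ?_, fun lam hl f => ?_, fun y hy => ?_⟩
  · have h := hG.re_inner_le _ ((hmem p).1 hp)
    have h2 := re_inner_clm_le B p.1
    rw [inner_sub_right, Complex.sub_re] at h
    simp only at h
    linarith
  · have hl0 : 0 < lam := (norm_nonneg B).trans_lt hl
    obtain ⟨R, hR, hRG, -⟩ := hG.exists_resolvent hl0
    -- Solve `g - B R g = f` by a Neumann series; then `R g` solves the perturbed equation.
    have hBR : ‖B * R‖ < 1 := by
      have hRn : ‖R‖ ≤ lam⁻¹ := R.opNorm_le_bound (inv_nonneg.2 hl0.le) (by simpa using hR)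
      calc ‖B * R‖ ≤ ‖B‖ * ‖R‖ := norm_mul_le _ _
        _ ≤ ‖B‖ * lam⁻¹ := mul_le_mul_of_nonneg_left hRn (norm_nonneg _)
        _ < 1 := by rw [← div_eq_mul_inv, div_lt_one hl0]; exact hl
    let u := Units.oneSub (B * R) hBR
    let g : X := (↑(u⁻¹) : X →L[ℂ] X) f
    have hg : g - B (R g) = f := by
      have h1 : (u : X →L[ℂ] X) * (↑(u⁻¹) : X →L[ℂ] X) = 1 := u.mul_inv
      have h2 := congrArg (fun L : X →L[ℂ] X => L f) h1
      exact h2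
    refine ⟨(R g, (lam : ℂ) • R g - g + B (R g)), (hmem _).2 ?_, ?_⟩
    · simpa using hRG g
    · change (lam : ℂ) • R g - ((lam : ℂ) • R g - g + B (R g)) = f
      rw [← hg]; abel
  · have := (hmem _).1 hy
    simp only [map_zero, sub_zero] at this
    exact hG.eq_zero y this

end Generation

/-! ### Orbits of semigroups and Duhamel's formula -/

section RightDerivative

variable {F : Type*} [NormedAddCommGroup F] [NormedSpace ℝ F]

lemma hasDerivWithinAt_Ici_iff_tendsto {f : ℝ → F} {f' : F} {t : ℝ} :
    HasDerivWithinAt f f' (Ici t) t ↔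
      Tendsto (fun h : ℝ => h⁻¹ • (f (t + h) - f t)) (𝓝[>] 0) (𝓝 f') := by
  rw [← hasDerivWithinAt_Ioi_iff_Ici, hasDerivWithinAt_iff_tendsto_slope' self_notMem_Ioi]
  have : 𝓝[>] t = map (fun h => t + h) (𝓝[>] 0) := by
    have := (Homeomorph.addLeft t).isEmbedding.map_nhdsWithin_eq (Ioi 0) 0
    simpa only [Homeomorph.coe_addLeft, image_const_add_Ioi, add_zero] using this.symm
  rw [this, tendsto_map'_iff]
  refine tendsto_congr fun h => ?_
  simp [slope]

lemma continuousOn_hasDerivWithinAt_integral [CompleteSpace F] {f : ℝ → F} {t : ℝ} (ht : 0 ≤ t)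
    (hf : ContinuousOn f (Icc 0 t)) :
    ContinuousOn (fun r => ∫ q in (0 : ℝ)..r, f q) (Icc 0 t) ∧
      ∀ r ∈ Ico 0 t, HasDerivWithinAt (fun r => ∫ q in (0 : ℝ)..r, f q) (f r) (Ici r) r := by
  set g : ℝ → F := IccExtend ht ((Icc 0 t).domRestrict f) with hg
  have hgc : Continuous g := (continuousOn_iff_continuous_domRestrict.1 hf).Icc_extend'
  have hgf : ∀ q ∈ Icc 0 t, g q = f q := fun q hq => IccExtend_of_mem ht _ hq
  have hint : ∀ r ∈ Icc 0 t, ∫ q in (0 : ℝ)..r, f q = ∫ q in (0 : ℝ)..r, g q := by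
    intro r hr
    refine intervalIntegral.integral_congr fun q hq => ?_
    rw [uIcc_of_le hr.1] at hq
    exact (hgf q ⟨hq.1, hq.2.trans hr.2⟩).symm
  have hd : ∀ r, HasDerivAt (fun r => ∫ q in (0 : ℝ)..r, g q) (g r) r := fun r =>
    intervalIntegral.integral_hasDerivAt_right (hgc.intervalIntegrable _ _)
      hgc.stronglyMeasurable.stronglyMeasurableAtFilter hgc.continuousAt
  refine ⟨ContinuousOn.congr (fun r _ => (hd r).continuousAt.continuousWithinAt) hint, ?_⟩
  intro r hr
  have h := (hd r).hasDerivWithinAt (s := Ici r)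
  rw [hgf r ⟨hr.1, hr.2.le⟩] at h
  refine h.congr_of_eventuallyEq ?_ (hint r ⟨hr.1, hr.2.le⟩)
  filter_upwards [Icc_mem_nhdsGE hr.2] with q hq
  exact hint q ⟨hr.1.trans hq.1, hq.2⟩

/-- The fundamental theorem of calculus for right derivatives. -/
lemma eq_add_integral_of_right_deriv [CompleteSpace F] {f f' : ℝ → F} {t : ℝ} (ht : 0 ≤ t)
    (hf : ContinuousOn f (Icc 0 t)) (hf' : ContinuousOn f' (Icc 0 t))
    (hd : ∀ r ∈ Ico 0 t, HasDerivWithinAt f (f' r) (Ici r) r) :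
    f t = f 0 + ∫ r in (0 : ℝ)..t, f' r := by
  obtain ⟨h1, h2⟩ := continuousOn_hasDerivWithinAt_integral ht hf'
  refine eq_of_has_deriv_right_eq (g := fun t => f 0 + ∫ r in (0 : ℝ)..t, f' r) hd
    (fun r hr => (h2 r hr).const_add _) hf (h1.const_add _) ?_ t (right_mem_Icc.2 ht)
  simp

end RightDerivative

namespace IsSemigroupGeneratedBy

variable {X : Type*} [NormedAddCommGroup X] [NormedSpace ℂ X]
  {T : ℝ → X →L[ℂ] X} {A : X → X → Prop}

lemma add_apply (hT : IsSemigroupGeneratedBy T A) {s t : ℝ} (hs : 0 ≤ s) (ht : 0 ≤ t) (x : X) :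
    T (s + t) x = T s (T t x) := by rw [hT.add s t hs ht]; rfl

lemma graph_apply (hT : IsSemigroupGeneratedBy T A) {x y : X} (hxy : A x y) {t : ℝ}
    (ht : 0 ≤ t) : A (T t x) (T t y) := by
  have h := ((T t).continuous.tendsto y).comp ((hT.generator x y).1 hxy)
  refine (hT.generator _ _).2 (h.congr' ?_)
  filter_upwards [self_mem_nhdsWithin] with h hh
  rw [← hT.add_apply (le_of_lt hh) ht, add_comm, hT.add_apply ht (le_of_lt hh)]
  simp [map_sub]

lemma hasDerivWithinAt (hT : IsSemigroupGeneratedBy T A) {x y : X} (hxy : A x y) {t : ℝ}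
    (ht : 0 ≤ t) : HasDerivWithinAt (fun t => T t x) (T t y) (Ici t) t := by
  rw [hasDerivWithinAt_Ici_iff_tendsto]
  refine ((hT.generator _ _).1 (hT.graph_apply hxy ht)).congr' ?_
  filter_upwards [self_mem_nhdsWithin] with h hh
  rw [← hT.add_apply (le_of_lt hh) ht, add_comm t, Complex.coe_smul]

variable [CompleteSpace X]

/-- A semigroup is bounded on bounded intervals, by the uniform boundedness principle. -/
lemma exists_bound (hT : IsSemigroupGeneratedBy T A) (b : ℝ) :
    ∃ M : ℝ, 0 ≤ M ∧ ∀ t, 0 ≤ t → t ≤ b → ‖T t‖ ≤ M := by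
  -- Near `0` an unbounded sequence would contradict the strong continuity.
  have h1 : ∃ d : ℝ, 0 < d ∧ ∃ M : ℝ, ∀ t, 0 ≤ t → t ≤ d → ‖T t‖ ≤ M := by
    by_contra! hcon
    choose u hu0 hu1 hu2 using fun n : ℕ => hcon (1 / ((n : ℝ) + 1)) (by positivity) n
    have hu_lim : Tendsto u atTop (𝓝 0) :=
      squeeze_zero hu0 hu1 tendsto_one_div_add_atTop_nhds_zero_nat
    have hpt : ∀ x, ∃ M, ∀ n, ‖T (u n) x‖ ≤ M := by
      intro x
      have h0 : Tendsto (fun t => T t x) (𝓝[≥] 0) (𝓝 x) := by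
        rw [← Ioi_insert, nhdsWithin_insert, tendsto_sup]
        refine ⟨?_, hT.tendsto x⟩
        have : T 0 x = x := by rw [hT.zero]; rfl
        conv_rhs => rw [← this]
        exact tendsto_pure_nhds _ _
      have h1 : Tendsto (fun n => T (u n) x) atTop (𝓝 x) :=
        h0.comp (tendsto_nhdsWithin_iff.2 ⟨hu_lim, Eventually.of_forall hu0⟩)
      obtain ⟨M, hM⟩ := h1.norm.bddAbove_range
      exact ⟨M, fun n => hM ⟨n, rfl⟩⟩
    obtain ⟨M, hM⟩ := banach_steinhaus hpt
    obtain ⟨n, hn⟩ := exists_nat_gt M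
    exact absurd (hM n) (not_le.2 (hn.trans (hu2 n)))
  obtain ⟨d, hd, M, hM⟩ := h1
  have hM0 : 0 ≤ M := (norm_nonneg _).trans (hM 0 le_rfl hd.le)
  -- The semigroup law propagates the bound.
  have h2 : ∀ n : ℕ, ∀ t, 0 ≤ t → t ≤ n * d → ‖T t‖ ≤ (max M 1) ^ n := by
    intro n
    induction n with
    | zero =>
      intro t ht ht'
      have : t = 0 := le_antisymm (by simpa using ht') ht
      rw [this, hT.zero, pow_zero]
      exact ContinuousLinearMap.norm_id_le
    | succ n ih =>
      intro t ht ht'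
      push_cast at ht'
      have hm : (1 : ℝ) ≤ max M 1 := le_max_right _ _
      rcases le_total t d with htd | htd
      · refine (hM t ht htd).trans ((le_max_left M 1).trans ?_)
        exact le_self_pow₀ hm (Nat.succ_ne_zero n)
      · have h3 : T t = (T d).comp (T (t - d)) := by
          rw [← hT.add d (t - d) hd.le (by linarith)]; congr 1; ring
        rw [h3, pow_succ']
        refine (ContinuousLinearMap.opNorm_comp_le _ _).trans
          (mul_le_mul ((hM d hd.le le_rfl).trans (le_max_left _ _))
            (ih _ (by linarith) (by linarith)) (norm_nonneg _) (by positivity))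
  obtain ⟨n, hn⟩ := exists_nat_gt (b / d)
  refine ⟨(max M 1) ^ n, by positivity, fun t ht htb => h2 n t ht ?_⟩
  rw [div_lt_iff₀ hd] at hn
  linarith

/-- A semigroup is jointly continuous in time and in the initial value. -/
lemma tendsto_apply (hT : IsSemigroupGeneratedBy T A) {ι : Type*} {l : Filter ι} {τ : ι → ℝ}
    {t : ℝ} (ht : 0 ≤ t) (hτ0 : ∀ᶠ i in l, 0 ≤ τ i) (hτ : Tendsto τ l (𝓝 t)) {y : ι → X} {x : X}
    (hy : Tendsto y l (𝓝 x)) : Tendsto (fun i => T (τ i) (y i)) l (𝓝 (T t x)) := by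
  obtain ⟨M, hM0, hM⟩ := hT.exists_bound (t + 1)
  have h0 : Tendsto (fun t => T t x) (𝓝[≥] 0) (𝓝 x) := by
    rw [← Ioi_insert, nhdsWithin_insert, tendsto_sup]
    refine ⟨?_, hT.tendsto x⟩
    have : T 0 x = x := by rw [hT.zero]; rfl
    conv_rhs => rw [← this]
    exact tendsto_pure_nhds _ _
  have h1 : Tendsto (fun i => |τ i - t|) l (𝓝[≥] 0) := by
    refine tendsto_nhdsWithin_iff.2 ⟨?_, Eventually.of_forall fun i => mem_Ici.2 (abs_nonneg _)⟩
    simpa using (hτ.sub_const t).abs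
  have h2 : Tendsto (fun i => M * ‖T |τ i - t| x - x‖ + M * ‖y i - x‖) l (𝓝 0) := by
    have h3 := (((h0.comp h1).sub_const x).norm.const_mul M).add
      ((hy.sub_const x).norm.const_mul M)
    simpa using h3
  rw [tendsto_iff_norm_sub_tendsto_zero]
  refine squeeze_zero' (Eventually.of_forall fun i => norm_nonneg _) ?_ h2
  filter_upwards [hτ0, hτ.eventually (gt_mem_nhds (lt_add_one t))] with i hi hi'
  have hbd : ∀ s, 0 ≤ s → s ≤ t + 1 → ∀ z, ‖T s z‖ ≤ M * ‖z‖ := fun s hs hs' z =>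
    (T s).le_of_opNorm_le (hM s hs hs') z
  have h4 : ‖T (τ i) x - T t x‖ ≤ M * ‖T |τ i - t| x - x‖ := by
    rcases le_total t (τ i) with h | h
    · have : T (τ i) x = T t (T |τ i - t| x) := by
        rw [← hT.add_apply ht (abs_nonneg _), abs_of_nonneg (by linarith)]; congr 2; ring
      rw [this, ← map_sub]
      exact hbd t ht (by linarith) _
    · have : T t x = T (τ i) (T |τ i - t| x) := by
        rw [← hT.add_apply hi (abs_nonneg _), abs_of_nonpos (by linarith)]; congr 2; ring
      rw [this, ← map_sub, norm_sub_rev (T |τ i - t| x) x]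
      exact hbd _ hi hi'.le _
  calc ‖T (τ i) (y i) - T t x‖ = ‖T (τ i) x - T t x + T (τ i) (y i - x)‖ := by
        congr 1; rw [map_sub]; abel
    _ ≤ _ := (norm_add_le _ _).trans (add_le_add h4 (hbd _ hi hi'.le _))

lemma continuousOn (hT : IsSemigroupGeneratedBy T A) (x : X) :
    ContinuousOn (fun t => T t x) (Ici 0) := fun _ ht =>
  hT.tendsto_apply ht self_mem_nhdsWithin (tendsto_id.mono_left nhdsWithin_le_nhds)
    tendsto_const_nhds

/-- Continuity of the integrand in Duhamel's formula. -/
lemma continuousOn_sub (hT : IsSemigroupGeneratedBy T A) {f : ℝ → X} {t : ℝ}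
    (hf : ContinuousOn f (Icc 0 t)) : ContinuousOn (fun r => T (t - r) (f r)) (Icc 0 t) := by
  intro r hr
  refine hT.tendsto_apply (sub_nonneg.2 hr.2) ?_ ?_ (hf r hr)
  · filter_upwards [self_mem_nhdsWithin] with q hq using sub_nonneg.2 hq.2
  · exact ((continuous_const.sub continuous_id).tendsto r).mono_left nhdsWithin_le_nhds

/-- Duhamel's formula for strong solutions of `η' = A η + f`; only derivatives from the right are
needed, as `r ↦ T (t - r) (η r)` has the right derivative `T (t - r) (f r)`. -/
theorem duhamel (hT : IsSemigroupGeneratedBy T A) {η η' f : ℝ → X} {t : ℝ} (ht : 0 ≤ t)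
    (hη : ContinuousOn η (Icc 0 t)) (hf : ContinuousOn f (Icc 0 t))
    (hd : ∀ r ∈ Ico 0 t, HasDerivWithinAt η (η' r) (Ici r) r)
    (hA : ∀ r ∈ Ico 0 t, A (η r) (η' r - f r)) :
    η t = T t (η 0) + ∫ r in (0 : ℝ)..t, T (t - r) (f r) := by
  have h := eq_add_integral_of_right_deriv (f := fun r => T (t - r) (η r)) ht
    (hT.continuousOn_sub hη) (hT.continuousOn_sub hf) ?_
  · simpa [hT.zero] using h
  intro r hr
  rw [hasDerivWithinAt_Ici_iff_tendsto]
  have h1 := (hasDerivWithinAt_Ici_iff_tendsto.1 (hd r hr)).sub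
    ((hT.generator _ _).1 (hA r hr))
  rw [sub_sub_cancel] at h1
  have hlt : ∀ᶠ h : ℝ in 𝓝[>] 0, h < t - r :=
    (gt_mem_nhds (sub_pos.2 hr.2)).filter_mono nhdsWithin_le_nhds
  have h2 := hT.tendsto_apply (l := 𝓝[>] (0 : ℝ)) (τ := fun h => t - r - h)
    (sub_nonneg.2 hr.2.le) (by filter_upwards [hlt] with h hh using (sub_pos.2 hh).le)
    (by
      have : Continuous fun h : ℝ => t - r - h := by fun_prop
      simpa using (this.tendsto 0).mono_left nhdsWithin_le_nhds) h1
  refine h2.congr' ?_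
  filter_upwards [hlt, self_mem_nhdsWithin] with h hh (hh0 : 0 < h)
  have h3 : T (t - r) (η r) = T (t - r - h) (T h (η r)) := by
    rw [← hT.add_apply (sub_pos.2 hh).le hh0.le]; congr 2; ring
  rw [h3, sub_add_eq_sub_sub, ← map_sub, Complex.coe_smul, ← smul_sub,
    sub_sub_sub_cancel_right, ← Complex.coe_smul, ← Complex.coe_smul, map_smul]

end IsSemigroupGeneratedBy

/-! ### The weighted history space and the Volterra operator -/

section History

variable {C δ : ℝ} [hC : Fact (0 < C)] [hδ : Fact (0 < δ)]

/-- The weight `w(s) = C e^{-δ s}`. -/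
def weight (C δ s : ℝ) : ℝ := C * Real.exp (-δ * s)

lemma weight_pos (s : ℝ) : 0 < weight C δ s := mul_pos hC.out (Real.exp_pos _)

lemma continuous_weight : Continuous (weight C δ) := by unfold weight; fun_prop

lemma histMeasure_eq : histMeasure C δ =
    (volume.restrict (Ioi 0)).withDensity fun s => ENNReal.ofReal (weight C δ s) := rfl

lemma ae_histMeasure_iff {p : ℝ → Prop} :
    (∀ᵐ s ∂histMeasure C δ, p s) ↔ ∀ᵐ s ∂volume.restrict (Ioi 0), p s := by
  rw [histMeasure_eq, ae_withDensity_iff continuous_weight.measurable.ennreal_ofReal]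
  simp [weight_pos]

lemma integral_histMeasure {F : Type*} [NormedAddCommGroup F] [NormedSpace ℝ F] (f : ℝ → F) :
    ∫ s, f s ∂histMeasure C δ = ∫ s in Ioi 0, weight C δ s • f s := by
  rw [histMeasure_eq, integral_withDensity_eq_integral_toReal_smul
    continuous_weight.measurable.ennreal_ofReal (by simp)]
  simp [ENNReal.toReal_ofReal (weight_pos _).le]

lemma integrable_histMeasure_iff {F : Type*} [NormedAddCommGroup F] [NormedSpace ℝ F] {f : ℝ → F} :
    Integrable f (histMeasure C δ) ↔ IntegrableOn (fun s => weight C δ s • f s) (Ioi 0) := by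
  rw [histMeasure_eq, integrable_withDensity_iff_integrable_smul'
    continuous_weight.measurable.ennreal_ofReal (by simp)]
  simp [ENNReal.toReal_ofReal (weight_pos _).le, IntegrableOn]

lemma integrableOn_sq_mul_weight : IntegrableOn (fun s => weight C δ s * s ^ 2) (Ioi 0) := by
  have h := (exp_neg_integrableOn_Ioi 0 (half_pos hδ.out)).const_mul (|C| * (2 * (2 / δ) ^ 2))
  refine h.mono' (by unfold weight; exact Continuous.aestronglyMeasurable (by fun_prop)) ?_
  filter_upwards [ae_restrict_mem measurableSet_Ioi] with s (hs : 0 < s)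
  have h1 := Real.quadratic_le_exp_of_nonneg (x := δ * s / 2) (by have := hδ.out; positivity)
  have h2 : s ^ 2 ≤ 2 * (2 / δ) ^ 2 * Real.exp (δ * s / 2) := by
    have h3 : (δ * s / 2) ^ 2 / 2 ≤ Real.exp (δ * s / 2) := by
      have := hδ.out
      have : 0 ≤ δ * s / 2 := by positivity
      linarith
    have h4 : s ^ 2 = 2 * (2 / δ) ^ 2 * ((δ * s / 2) ^ 2 / 2) := by
      have := hδ.out.ne'
      field_simp
    rw [h4]
    exact mul_le_mul_of_nonneg_left h3 (by positivity)
  rw [norm_mul, norm_pow, weight, norm_mul, Real.norm_eq_abs C, Real.norm_of_nonneg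
    (Real.exp_pos _).le, Real.norm_of_nonneg hs.le, mul_assoc, mul_assoc]
  refine mul_le_mul_of_nonneg_left ?_ (abs_nonneg C)
  calc Real.exp (-δ * s) * s ^ 2
      ≤ Real.exp (-δ * s) * (2 * (2 / δ) ^ 2 * Real.exp (δ * s / 2)) :=
        mul_le_mul_of_nonneg_left h2 (Real.exp_pos _).le
    _ = 2 * (2 / δ) ^ 2 * (Real.exp (-δ * s) * Real.exp (δ * s / 2)) := by ring
    _ = _ := by rw [← Real.exp_add]; congr 2; ring

lemma integrableOn_weight : IntegrableOn (weight C δ) (Ioi 0) :=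
  (exp_neg_integrableOn_Ioi 0 hδ.out).const_mul C

instance : IsFiniteMeasure (histMeasure C δ) := by
  have h := (integrable_histMeasure_iff (C := C) (δ := δ) (f := fun _ => (1 : ℝ))).2
    (by simpa using integrableOn_weight)
  exact (integrable_const_iff_isFiniteMeasure one_ne_zero).1 h

variable {X : Type*} [NormedAddCommGroup X] [InnerProductSpace ℂ X] [CompleteSpace X]

/-- Integration against a real function dominated by the weight is a bounded operator on the
history space. -/
lemma exists_weightedIntegral (q : ℝ → ℝ) (hq : AEStronglyMeasurable q (volume.restrict (Ioi 0)))
    {c : ℝ} (hqc : ∀ s, 0 < s → |q s| ≤ c * weight C δ s) :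
    ∃ L : L2w C δ X →L[ℂ] X, ∀ ζ, L ζ = ∫ s in Ioi (0 : ℝ), q s • ζ s := by
  have hm : AEStronglyMeasurable (fun s => (((q s / weight C δ s : ℝ)) : ℂ)) (histMeasure C δ) := by
    have h1 : AEMeasurable (fun s => q s / weight C δ s) (volume.restrict (Ioi 0)) :=
      hq.aemeasurable.div continuous_weight.measurable.aemeasurable
    exact h1.complex_ofReal.aestronglyMeasurable.mono_ac (withDensity_absolutelyContinuous _ _)
  have hk : MemLp (fun s => (((q s / weight C δ s : ℝ)) : ℂ)) 2 (histMeasure C δ) := by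
    refine MemLp.of_bound hm c ?_
    rw [ae_histMeasure_iff]
    filter_upwards [ae_restrict_mem measurableSet_Ioi] with s hs
    rw [Complex.norm_real, norm_div, Real.norm_of_nonneg (weight_pos s).le,
      div_le_iff₀ (weight_pos s)]
    exact hqc s hs
  refine ⟨(ContinuousLinearMap.lsmul ℂ ℂ (E := X)).lpPairing (histMeasure C δ) 2 2 (hk.toLp _),
    fun ζ => ?_⟩
  rw [ContinuousLinearMap.lpPairing_eq_integral, integral_histMeasure]
  refine integral_congr_ae ?_
  filter_upwards [ae_histMeasure_iff.1 hk.coeFn_toLp] with s hs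
  rw [hs, ContinuousLinearMap.lsmul_apply, Complex.coe_smul, smul_smul,
    mul_div_cancel₀ _ (weight_pos s).ne']

lemma integrable_weightedIntegral {q : ℝ → ℝ}
    (hq : AEStronglyMeasurable q (volume.restrict (Ioi 0)))
    {c : ℝ} (hqc : ∀ s, 0 < s → |q s| ≤ c * weight C δ s) (ζ : L2w C δ X) :
    IntegrableOn (fun s => q s • ζ s) (Ioi 0) := by
  have h1 := integrable_histMeasure_iff.1 ((Lp.memLp ζ).integrable one_le_two)
  have hζm : AEStronglyMeasurable ζ (volume.restrict (Ioi 0)) :=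
    (Lp.aestronglyMeasurable ζ).mono_ac (withDensity_absolutelyContinuous'
      continuous_weight.measurable.ennreal_ofReal.aemeasurable (by simp [weight_pos]))
  refine (h1.norm.const_mul c).mono' (hq.smul hζm) ?_
  filter_upwards [ae_restrict_mem measurableSet_Ioi] with s hs
  rw [norm_smul, norm_smul, ← mul_assoc, Real.norm_of_nonneg (weight_pos s).le]
  exact mul_le_mul_of_nonneg_right (hqc s hs) (norm_nonneg _)

lemma abs_le_mul_weight {q : ℝ → ℝ} {B b : ℝ} (hB : ∀ s, |q s| ≤ B)
    (hb : ∀ s, b < s → q s = 0) (s : ℝ) :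
    |q s| ≤ B * (weight C δ b)⁻¹ * weight C δ s := by
  have hB0 : 0 ≤ B := (abs_nonneg _).trans (hB 0)
  rcases le_or_gt s b with h | h
  · have hw : weight C δ b ≤ weight C δ s := by
      unfold weight
      have : -δ * b ≤ -δ * s := by have := (Fact.out : 0 < δ); nlinarith
      exact mul_le_mul_of_nonneg_left (Real.exp_le_exp.2 this) hC.out.le
    rw [mul_assoc]
    refine (hB s).trans (le_mul_of_one_le_right hB0 ?_)
    rwa [← div_eq_inv_mul, one_le_div (weight_pos b)]
  · rw [hb s h, abs_zero]
    have := weight_pos (C := C) (δ := δ) b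
    have := weight_pos (C := C) (δ := δ) s
    positivity

lemma intervalIntegrable_history (ζ : L2w C δ X) {s : ℝ} (hs : 0 ≤ s) :
    IntervalIntegrable ζ volume 0 s := by
  rw [intervalIntegrable_iff_integrableOn_Ioc_of_le hs]
  have h := integrable_weightedIntegral (q := (Iic s).indicator fun _ => 1)
    ((stronglyMeasurable_const.indicator measurableSet_Iic).aestronglyMeasurable)
    (fun r _ => abs_le_mul_weight (C := C) (δ := δ) (B := 1) (b := s)
      (fun r => by by_cases h : r ∈ Iic s <;> simp [h])
      (fun r hr => by simp [hr]) r) ζ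
  refine IntegrableOn.congr_fun (h.mono_set (Ioc_subset_Ioi_self : Ioc 0 s ⊆ Ioi 0))
    (fun r hr => ?_) measurableSet_Ioc
  simp [hr.2]

/-- The primitive of a history, evaluated at time `s`, is a bounded operator. -/
lemma exists_primitive_apply {s : ℝ} (hs : 0 ≤ s) :
    ∃ L : L2w C δ X →L[ℂ] X, ∀ ζ, L ζ = ∫ r in (0 : ℝ)..s, ζ r := by
  obtain ⟨L, hL⟩ := exists_weightedIntegral (C := C) (δ := δ) (X := X)
    ((Iic s).indicator fun _ => 1)
    ((stronglyMeasurable_const.indicator measurableSet_Iic).aestronglyMeasurable)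
    (fun r _ => abs_le_mul_weight (C := C) (δ := δ) (B := 1) (b := s)
      (fun r => by by_cases h : r ∈ Iic s <;> simp [h])
      (fun r hr => by simp [hr]) r)
  refine ⟨L, fun ζ => ?_⟩
  rw [hL, intervalIntegral.integral_of_le hs, ← integral_indicator measurableSet_Ioi,
    ← integral_indicator measurableSet_Ioc]
  congr 1
  ext r
  by_cases h1 : 0 < r <;> by_cases h2 : r ≤ s <;> simp [h1, h2]

/-- Functions of at most linear growth belong to the history space. -/
lemma memLp_of_norm_le_mul {f : ℝ → X} (hf : ContinuousOn f (Ici 0)) {M : ℝ}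
    (hM : ∀ s, 0 < s → ‖f s‖ ≤ M * s) : MemLp f 2 (histMeasure C δ) := by
  have hfm : AEStronglyMeasurable f (histMeasure C δ) :=
    ((hf.mono Ioi_subset_Ici_self).aestronglyMeasurable measurableSet_Ioi).mono_ac
      (withDensity_absolutelyContinuous _ _)
  rw [memLp_two_iff_integrable_sq_norm hfm]
  have h1 : Integrable (fun s => M ^ 2 * s ^ 2) (histMeasure C δ) := by
    refine Integrable.const_mul ?_ _
    rw [integrable_histMeasure_iff]
    exact integrableOn_sq_mul_weight
  refine h1.mono' (hfm.norm.pow 2) ?_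
  rw [ae_histMeasure_iff]
  filter_upwards [ae_restrict_mem measurableSet_Ioi] with s hs
  rw [Real.norm_of_nonneg (by positivity), ← mul_pow]
  exact pow_le_pow_left₀ (norm_nonneg _) (hM s hs) 2

lemma norm_integral_bcf_le (g : BoundedContinuousFunction ℝ X) {s : ℝ} (hs : 0 ≤ s) :
    ‖∫ r in (0 : ℝ)..s, g r‖ ≤ ‖g‖ * s := by
  have h := intervalIntegral.norm_integral_le_of_norm_le_const (a := 0) (b := s)
    (fun r _ => g.norm_coe_le_norm r)
  rwa [sub_zero, abs_of_nonneg hs] at h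

lemma hasDerivAt_integral_bcf (g : BoundedContinuousFunction ℝ X) (s : ℝ) :
    HasDerivAt (fun s => ∫ r in (0 : ℝ)..s, g r) (g s) s :=
  intervalIntegral.integral_hasDerivAt_right (g.continuous.intervalIntegrable _ _)
    g.continuous.stronglyMeasurable.stronglyMeasurableAtFilter g.continuous.continuousAt

lemma continuous_integral_bcf (g : BoundedContinuousFunction ℝ X) :
    Continuous (fun s => ∫ r in (0 : ℝ)..s, g r) :=
  continuous_iff_continuousAt.2 fun s => (hasDerivAt_integral_bcf g s).continuousAt

lemma memLp_integral_bcf (g : BoundedContinuousFunction ℝ X) :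
    MemLp (fun s => ∫ r in (0 : ℝ)..s, g r) 2 (histMeasure C δ) :=
  memLp_of_norm_le_mul (continuous_integral_bcf g).continuousOn
    fun _ hs => norm_integral_bcf_le g hs.le

variable (C δ X) in
/-- The Volterra operator on bounded continuous functions. -/
def volterraBCF : BoundedContinuousFunction ℝ X →ₗ[ℂ] L2w C δ X where
  toFun g := (memLp_integral_bcf g).toLp _
  map_add' f g := by
    rw [← MemLp.toLp_add]
    congr 1
    ext s
    exact intervalIntegral.integral_add (f.continuous.intervalIntegrable _ _)
      (g.continuous.intervalIntegrable _ _)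
  map_smul' c g := by
    rw [RingHom.id_apply, ← MemLp.toLp_const_smul]
    congr 1
    ext s
    exact intervalIntegral.integral_smul c _

variable (C δ X) in
/-- The embedding of the bounded continuous functions into the history space. -/
def embedBCF : BoundedContinuousFunction ℝ X →L[ℂ] L2w C δ X :=
  BoundedContinuousFunction.toLp 2 (histMeasure C δ) ℂ

lemma coeFn_embedBCF (g : BoundedContinuousFunction ℝ X) :
    embedBCF C δ X g =ᵐ[volume.restrict (Ioi 0)] g :=
  ae_histMeasure_iff.1 (BoundedContinuousFunction.coeFn_toLp 2 (histMeasure C δ) ℂ g)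

lemma denseRange_embedBCF : DenseRange (embedBCF C δ X) :=
  BoundedContinuousFunction.toLp_denseRange X (histMeasure C δ) ℂ ENNReal.ofNat_ne_top

/-- Integration by parts with the exponential weight, `w' = -δ w`; the boundary term at infinity
vanishes since a primitive of a bounded function grows at most linearly. -/
lemma re_inner_volterraBCF (g : BoundedContinuousFunction ℝ X) :
    (inner ℂ (volterraBCF C δ X g) (embedBCF C δ X g)).re =
      δ / 2 * ‖volterraBCF C δ X g‖ ^ 2 := by
  set Z : ℝ → X := fun s => ∫ r in (0 : ℝ)..s, g r with hZ
  have hZc : Continuous Z := continuous_integral_bcf g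
  have hVZ : volterraBCF C δ X g =ᵐ[volume.restrict (Ioi 0)] Z :=
    ae_histMeasure_iff.1 (memLp_integral_bcf g).coeFn_toLp
  have hgg := coeFn_embedBCF (C := C) (δ := δ) g
  have h1 : (inner ℂ (volterraBCF C δ X g) (embedBCF C δ X g)).re =
      ∫ s in Ioi 0, weight C δ s * (inner ℂ (Z s) (g s)).re := by
    rw [L2.inner_def]
    rw [← RCLike.re_to_complex]
    rw [← integral_re (L2.integrable_inner (𝕜 := ℂ) _ _), integral_histMeasure]
    refine integral_congr_ae ?_
    filter_upwards [hVZ, hgg] with s hs hs'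
    rw [hs, hs']; rfl
  have h2 : ‖volterraBCF C δ X g‖ ^ 2 = ∫ s in Ioi 0, weight C δ s * ‖Z s‖ ^ 2 := by
    rw [← inner_self_eq_norm_sq (𝕜 := ℂ), L2.inner_def, ← integral_re (L2.integrable_inner _ _),
      integral_histMeasure]
    refine integral_congr_ae ?_
    filter_upwards [hVZ] with s hs
    rw [hs, inner_self_eq_norm_sq]; rfl
  have i1 : IntegrableOn (fun s => weight C δ s * (inner ℂ (Z s) (g s)).re) (Ioi 0) := by
    have := integrable_histMeasure_iff.1
      (L2.integrable_inner (𝕜 := ℂ) (volterraBCF C δ X g) (embedBCF C δ X g)).re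
    refine this.congr ?_
    filter_upwards [hVZ, hgg] with s hs hs'
    rw [hs, hs']; rfl
  have i2 : IntegrableOn (fun s => weight C δ s * ‖Z s‖ ^ 2) (Ioi 0) :=
    integrable_histMeasure_iff.1
      ((memLp_two_iff_integrable_sq_norm (memLp_integral_bcf g).1).1 (memLp_integral_bcf g))
  have hd : ∀ s, HasDerivAt (fun s => weight C δ s * ‖Z s‖ ^ 2)
      (2 * (weight C δ s * (inner ℂ (Z s) (g s)).re) - δ * (weight C δ s * ‖Z s‖ ^ 2)) s := by
    intro s
    have hw : HasDerivAt (weight C δ) (-δ * weight C δ s) s := by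
      have := (((hasDerivAt_id s).const_mul (-δ)).exp).const_mul C
      simp only [id_eq, mul_one] at this
      refine this.congr_deriv ?_
      unfold weight
      ring
    let _ := InnerProductSpace.rclikeToReal ℂ X
    have h := hw.mul (hasDerivAt_integral_bcf g s).norm_sq
    rw [real_inner_eq_re_inner ℂ] at h
    refine h.congr_deriv ?_
    change _ + weight C δ s * (2 * (inner ℂ (Z s) (g s)).re) = _
    ring
  have hlim : Tendsto (fun s => weight C δ s * ‖Z s‖ ^ 2) atTop (𝓝 0) := by
    have h3 : Tendsto (fun s : ℝ => C * ‖g‖ ^ 2 * (s ^ 2 * Real.exp (-δ * s))) atTop (𝓝 0) := by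
      have := (tendsto_rpow_mul_exp_neg_mul_atTop_nhds_zero 2 δ hδ.out).const_mul (C * ‖g‖ ^ 2)
      simpa using this
    refine squeeze_zero' (Eventually.of_forall fun s => ?_) ?_ h3
    · have := weight_pos (C := C) (δ := δ) s
      positivity
    · filter_upwards [eventually_ge_atTop 0] with s hs
      have h4 : ‖Z s‖ ^ 2 ≤ (‖g‖ * s) ^ 2 :=
        pow_le_pow_left₀ (norm_nonneg _) (norm_integral_bcf_le g hs) 2
      calc weight C δ s * ‖Z s‖ ^ 2 ≤ weight C δ s * (‖g‖ * s) ^ 2 :=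
            mul_le_mul_of_nonneg_left h4 (weight_pos s).le
        _ = _ := by unfold weight; ring
  have key := integral_Ioi_of_hasDerivAt_of_tendsto' (fun s _ => hd s)
    ((i1.const_mul 2).sub (i2.const_mul δ)) hlim
  rw [integral_sub (i1.const_mul 2) (i2.const_mul δ), integral_const_mul, integral_const_mul,
    ← h1, ← h2] at key
  have h0 : Z 0 = 0 := by simp [hZ]
  rw [h0, norm_zero] at key
  norm_num at key
  linarith

lemma norm_volterraBCF_le (g : BoundedContinuousFunction ℝ X) :
    ‖volterraBCF C δ X g‖ ≤ 2 / δ * ‖embedBCF C δ X g‖ := by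
  have h1 := re_inner_volterraBCF (C := C) (δ := δ) g
  have h2 := re_inner_le_norm_mul (volterraBCF C δ X g) (embedBCF C δ X g)
  have hd := hδ.out
  rw [h1] at h2
  rcases (norm_nonneg (volterraBCF C δ X g)).eq_or_lt with h | h
  · rw [← h]; positivity
  · have h3 : δ / 2 * ‖volterraBCF C δ X g‖ ≤ ‖embedBCF C δ X g‖ := by
      refine le_of_mul_le_mul_left ?_ h
      linarith
    rw [div_mul_eq_mul_div, le_div_iff₀ hd]
    linarith

variable (C δ X) in
/-- The Volterra operator `(V ζ)(s) = ∫_0^s ζ(r) dr` on the history space, extended by continuity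
from the bounded continuous functions; it is the inverse of `∂_s` with zero initial value. -/
def volterra : L2w C δ X →L[ℂ] L2w C δ X :=
  (volterraBCF C δ X).extendOfNorm (embedBCF C δ X : BoundedContinuousFunction ℝ X →ₗ[ℂ] _)

lemma volterra_embedBCF (g : BoundedContinuousFunction ℝ X) :
    volterra C δ X (embedBCF C δ X g) = volterraBCF C δ X g :=
  LinearMap.extendOfNorm_eq (f := volterraBCF C δ X)
    (e := (embedBCF C δ X : BoundedContinuousFunction ℝ X →ₗ[ℂ] L2w C δ X))
    denseRange_embedBCF ⟨2 / δ, norm_volterraBCF_le⟩ g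

/-- The source of the exponential decay of the histories: as `V` inverts `∂_s`, this is
`Re ⟨η, -∂_s η⟩ = -δ/2 ‖η‖²`. -/
lemma re_inner_volterra (ζ : L2w C δ X) :
    (inner ℂ (volterra C δ X ζ) ζ).re = δ / 2 * ‖volterra C δ X ζ‖ ^ 2 := by
  refine congrFun (denseRange_embedBCF.equalizer
    (g := fun ζ : L2w C δ X => (inner ℂ (volterra C δ X ζ) ζ).re)
    (h := fun ζ => δ / 2 * ‖volterra C δ X ζ‖ ^ 2) ?_ ?_ ?_) ζ
  · exact Complex.continuous_re.comp ((volterra C δ X).continuous.inner continuous_id)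
  · exact continuous_const.mul ((volterra C δ X).continuous.norm.pow 2)
  · ext g
    simp only [Function.comp, volterra_embedBCF]
    exact re_inner_volterraBCF g

lemma norm_volterra_le (ζ : L2w C δ X) : ‖volterra C δ X ζ‖ ≤ 2 / δ * ‖ζ‖ :=
  LinearMap.norm_extendOfNorm_apply_le (f := volterraBCF C δ X)
    (e := (embedBCF C δ X : BoundedContinuousFunction ℝ X →ₗ[ℂ] L2w C δ X))
    denseRange_embedBCF _ norm_volterraBCF_le ζ

/-- The operator `V`, which is defined by extension from a dense subspace, is given by the integral
on the whole history space: evaluation of the primitive at a fixed time is continuous. -/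
lemma coeFn_volterra (ζ : L2w C δ X) :
    volterra C δ X ζ =ᵐ[volume.restrict (Ioi 0)] fun s => ∫ r in (0 : ℝ)..s, ζ r := by
  obtain ⟨u, hu⟩ := mem_closure_iff_seq_limit.1 (denseRange_embedBCF (C := C) (δ := δ) ζ)
  choose g hg using hu.1
  have hlim : Tendsto (fun n => embedBCF C δ X (g n)) atTop (𝓝 ζ) := by simpa only [hg] using hu.2
  have h1 : Tendsto (fun n => volterraBCF C δ X (g n)) atTop (𝓝 (volterra C δ X ζ)) := by
    simp only [← volterra_embedBCF]
    exact ((volterra C δ X).continuous.tendsto ζ).comp hlim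
  obtain ⟨ns, hns, hae⟩ := (tendstoInMeasure_of_tendsto_Lp h1).exists_seq_tendsto_ae
  have h2 : ∀ᵐ s ∂volume.restrict (Ioi (0 : ℝ)), ∀ n,
      volterraBCF C δ X (g n) s = ∫ r in (0 : ℝ)..s, g n r :=
    ae_all_iff.2 fun n => ae_histMeasure_iff.1 (memLp_integral_bcf (g n)).coeFn_toLp
  filter_upwards [ae_histMeasure_iff.1 hae, h2, ae_restrict_mem measurableSet_Ioi] with s hs hs2 hs0
  obtain ⟨L, hL⟩ := exists_primitive_apply (C := C) (δ := δ) (X := X) (le_of_lt hs0)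
  have h3 := ((L.continuous.tendsto ζ).comp hlim).comp hns.tendsto_atTop
  refine tendsto_nhds_unique hs ?_
  rw [hL] at h3
  refine h3.congr fun i => ?_
  simp only [Function.comp, hL]
  rw [hs2, intervalIntegral.integral_of_le (le_of_lt hs0),
    intervalIntegral.integral_of_le (le_of_lt hs0)]
  exact integral_congr_ae (ae_restrict_of_ae_restrict_of_subset Ioc_subset_Ioi_self
    (coeFn_embedBCF (g (ns i))))

end History

/-! ### Weak derivatives of histories -/

section DuBoisReymond

variable {Y : Type*} [NormedAddCommGroup Y] [NormedSpace ℝ Y] [CompleteSpace Y]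

lemma exists_abs_le_and_eq_zero {f : ℝ → ℝ} (hf : Continuous f) (hc : HasCompactSupport f) :
    ∃ B b : ℝ, (∀ s, |f s| ≤ B) ∧ ∀ s, b < s → f s = 0 := by
  obtain ⟨B, hB⟩ := hf.bounded_above_of_compact_support hc
  obtain ⟨b, hb⟩ := hc.isCompact.bddAbove
  refine ⟨B, b, hB, fun s hs => ?_⟩
  by_contra hne
  exact absurd (hb (subset_tsupport _ hne)) (not_le.2 hs)

lemma IsTest.deriv {U : Set ℝ} {φ : ℝ → ℝ} (hφ : IsTest U φ) : IsTest U (deriv φ) :=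
  ⟨(contDiff_infty_iff_deriv.1 hφ.1).2, hφ.2.1.deriv, (tsupport_deriv_subset).trans hφ.2.2⟩

lemma IsTest.eq_zero {U : Set ℝ} {φ : ℝ → ℝ} (hφ : IsTest U φ) {s : ℝ} (hs : s ∉ U) : φ s = 0 :=
  image_eq_zero_of_notMem_tsupport fun h => hs (hφ.2.2 h)

lemma IsTest.integrable_smul {φ : ℝ → ℝ} (hφ : IsTest (Ioi 0) φ) {U : ℝ → Y}
    (hU : LocallyIntegrableOn U (Ioi 0)) : Integrable (fun s => φ s • U s) := by
  have h1 : IntegrableOn U (tsupport φ) :=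
    hU.integrableOn_compact_subset hφ.2.2 hφ.2.1
  have h2 : IntegrableOn (fun s => φ s • U s) (tsupport φ) :=
    h1.continuousOn_smul hφ.1.continuous.continuousOn hφ.2.1
  refine (integrableOn_iff_integrable_of_support_subset fun s hs => ?_).1 h2
  refine subset_tsupport _ fun h0 => hs ?_
  simp [h0]

lemma IsTest.setIntegral_smul {φ : ℝ → ℝ} (hφ : IsTest (Ioi 0) φ) (U : ℝ → Y) :
    ∫ s in Ioi (0 : ℝ), φ s • U s = ∫ s, φ s • U s :=
  setIntegral_eq_integral_of_forall_compl_eq_zero fun s hs => by rw [hφ.eq_zero hs, zero_smul]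

/-- A test function on `(0, ∞)` with vanishing integral has a primitive which is a test function. -/
lemma IsTest.exists_primitive {f : ℝ → ℝ} (hf : IsTest (Ioi 0) f) (h0 : ∫ s, f s = 0) :
    ∃ φ, IsTest (Ioi 0) φ ∧ _root_.deriv φ = f := by
  have hfc := hf.1.continuous
  set φ : ℝ → ℝ := fun s => ∫ r in (0 : ℝ)..s, f r with hφ
  have hd : ∀ s, HasDerivAt φ (f s) s := fun s =>
    intervalIntegral.integral_hasDerivAt_right (hfc.intervalIntegrable _ _)
      hfc.stronglyMeasurable.stronglyMeasurableAtFilter hfc.continuousAt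
  have hderiv : _root_.deriv φ = f := funext fun s => (hd s).deriv
  have hsm : ContDiff ℝ (⊤ : ℕ∞) φ := contDiff_infty_iff_deriv.2
    ⟨fun s => (hd s).differentiableAt, by rw [hderiv]; exact hf.1⟩
  obtain ⟨a, ha0, ha⟩ : ∃ a, 0 < a ∧ ∀ s ∈ tsupport f, a ≤ s := by
    rcases (tsupport f).eq_empty_or_nonempty with he | hne
    · exact ⟨1, one_pos, by simp [he]⟩
    · obtain ⟨a, ha, hmin⟩ := hf.2.1.isCompact.exists_isLeast hne
      exact ⟨a, hf.2.2 ha, hmin⟩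
  obtain ⟨b, hb⟩ := hf.2.1.isCompact.bddAbove
  have hfa : ∀ s, s < a → f s = 0 := fun s hs =>
    image_eq_zero_of_notMem_tsupport fun h => absurd (ha s h) (not_le.2 hs)
  have hfb : ∀ s, b < s → f s = 0 := fun s hs =>
    image_eq_zero_of_notMem_tsupport fun h => absurd (hb h) (not_le.2 hs)
  have hφa : ∀ s, s < a → φ s = 0 := fun s hs => by
    refine (intervalIntegral.integral_congr (g := fun _ => (0 : ℝ)) fun r hr => hfa r ?_).trans
      (by simp)
    exact lt_of_le_of_lt hr.2 (max_lt ha0 hs)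
  have hφb : ∀ s, max a b < s → φ s = 0 := fun s hs => by
    have hs0 : 0 < s := ha0.trans ((le_max_left a b).trans_lt hs)
    refine (intervalIntegral.integral_of_le hs0.le).trans (Eq.trans ?_ h0)
    refine setIntegral_eq_integral_of_forall_compl_eq_zero fun r hr => ?_
    rw [mem_Ioc, not_and_or, not_lt, not_le] at hr
    rcases hr with hr | hr
    · exact hfa r (hr.trans_lt ha0)
    · exact hfb r (((le_max_right a b).trans_lt hs).trans hr)
  have hsupp : Function.support φ ⊆ Icc a (max a b) := by
    intro s hs
    by_contra hn
    rw [mem_Icc, not_and_or, not_le, not_le] at hn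
    exact hs (hn.elim (hφa s) (hφb s))
  have ht : IsTest (Ioi 0) φ :=
    ⟨hsm, HasCompactSupport.of_support_subset_isCompact isCompact_Icc hsupp,
      (closure_minimal hsupp isClosed_Icc).trans fun s hs => ha0.trans_le hs.1⟩
  exact ⟨φ, ht, hderiv⟩

/-- The du Bois-Reymond lemma on `(0, ∞)`: subtracting from a test function `ψ` the multiple
`(∫ ψ) ρ` of a fixed bump `ρ` of integral `1` leaves the derivative of a test function. -/
lemma exists_ae_eq_const_of_integral_deriv_smul_eq_zero {U : ℝ → Y}
    (hU : LocallyIntegrableOn U (Ioi 0))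
    (h : ∀ φ : ℝ → ℝ, IsTest (Ioi 0) φ → ∫ s in Ioi (0 : ℝ), deriv φ s • U s = 0) :
    ∃ c : Y, ∀ᵐ s ∂volume.restrict (Ioi (0 : ℝ)), U s = c := by
  obtain ⟨ρ, hρ, hρ1⟩ : ∃ ρ : ℝ → ℝ, IsTest (Ioi 0) ρ ∧ ∫ s, ρ s = 1 := by
    let b : ContDiffBump (1 : ℝ) := ⟨1 / 4, 1 / 2, by norm_num, by norm_num⟩
    refine ⟨b.normed volume, ⟨b.contDiff_normed, b.hasCompactSupport_normed, ?_⟩,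
      b.integral_normed⟩
    rw [b.tsupport_normed_eq, Real.closedBall_eq_Icc]
    intro s hs
    have : (1 : ℝ) - 1 / 2 ≤ s := hs.1
    change 0 < s
    linarith
  refine ⟨∫ s, ρ s • U s, ?_⟩
  set c := ∫ s, ρ s • U s
  rw [ae_restrict_iff' measurableSet_Ioi]
  have hUc : LocallyIntegrableOn (fun s => U s - c) (Ioi 0) :=
    hU.sub (continuous_const.locallyIntegrable.locallyIntegrableOn _)
  have key := isOpen_Ioi.ae_eq_zero_of_integral_contDiff_smul_eq_zero hUc (fun ψ h1 h2 h3 => ?_)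
  · filter_upwards [key] with s hs hs0 using sub_eq_zero.1 (hs hs0)
  have hψ : IsTest (Ioi 0) ψ := ⟨h1, h2, h3⟩
  have hψi : Integrable ψ := h1.continuous.integrable_of_hasCompactSupport h2
  have hρi : Integrable ρ := hρ.1.continuous.integrable_of_hasCompactSupport hρ.2.1
  have hf : IsTest (Ioi 0) (fun s => ψ s - (∫ r, ψ r) * ρ s) := by
    refine ⟨h1.sub (contDiff_const.mul hρ.1), h2.sub (hρ.2.1.mul_left), ?_⟩
    refine (tsupport_sub _ _).trans (union_subset h3 ?_)
    exact (tsupport_mul_subset_right).trans hρ.2.2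
  obtain ⟨φ, hφ, hφd⟩ := hf.exists_primitive (by
    rw [integral_sub hψi (hρi.const_mul _), integral_const_mul, hρ1, mul_one, sub_self])
  have h4 := h φ hφ
  rw [hφd, hf.setIntegral_smul] at h4
  have h5 : (fun s => (ψ s - (∫ r, ψ r) * ρ s) • U s) =
      fun s => ψ s • U s - (∫ r, ψ r) • ρ s • U s := by
    ext s; rw [sub_smul, mul_smul]
  have h6 := integral_sub (hψ.integrable_smul hU) ((hρ.integrable_smul hU).smul (∫ r, ψ r))
  simp only [Pi.smul_apply] at h6
  rw [h5, h6, integral_smul] at h4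
  simp only [smul_sub]
  rw [integral_sub (hψ.integrable_smul hU) (hψi.smul_const c), integral_smul_const]
  exact h4

end DuBoisReymond

section History

variable {C δ : ℝ} [hC : Fact (0 < C)] [hδ : Fact (0 < δ)]
  {X : Type*} [NormedAddCommGroup X] [InnerProductSpace ℂ X] [CompleteSpace X]

/-- `V ζ` is the weak primitive of `ζ`. -/
lemma integral_deriv_smul_volterra {φ : ℝ → ℝ} (hφ : IsTest (Ioi 0) φ) (ζ : L2w C δ X) :
    ∫ s in Ioi (0 : ℝ), deriv φ s • volterra C δ X ζ s = -∫ s in Ioi (0 : ℝ), φ s • ζ s := by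
  obtain ⟨B, b, hB, hb⟩ := exists_abs_le_and_eq_zero hφ.1.continuous hφ.2.1
  obtain ⟨B', b', hB', hb'⟩ := exists_abs_le_and_eq_zero hφ.deriv.1.continuous hφ.deriv.2.1
  obtain ⟨L, hL⟩ := exists_weightedIntegral (C := C) (δ := δ) (X := X) φ
    hφ.1.continuous.aestronglyMeasurable (fun s _ => abs_le_mul_weight hB hb s)
  obtain ⟨L', hL'⟩ := exists_weightedIntegral (C := C) (δ := δ) (X := X) (deriv φ)
    hφ.deriv.1.continuous.aestronglyMeasurable (fun s _ => abs_le_mul_weight hB' hb' s)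
  rw [← hL, ← hL']
  refine congrFun (denseRange_embedBCF.equalizer (g := fun ζ => L' (volterra C δ X ζ))
    (h := fun ζ => -L ζ) (L'.continuous.comp (volterra C δ X).continuous) L.continuous.neg ?_) ζ
  ext g
  simp only [Function.comp, volterra_embedBCF, hL, hL']
  have e1 : ∫ s in Ioi (0 : ℝ), deriv φ s • volterraBCF C δ X g s =
      ∫ s, deriv φ s • ∫ r in (0 : ℝ)..s, g r := by
    rw [← hφ.deriv.setIntegral_smul]
    refine integral_congr_ae ?_
    filter_upwards [ae_histMeasure_iff.1 (memLp_integral_bcf (C := C) (δ := δ) g).coeFn_toLp]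
      with s hs
    exact congrArg _ hs
  have e2 : ∫ s in Ioi (0 : ℝ), φ s • embedBCF C δ X g s = ∫ s, φ s • g s := by
    rw [← hφ.setIntegral_smul]
    refine integral_congr_ae ?_
    filter_upwards [coeFn_embedBCF (C := C) (δ := δ) g] with s hs
    rw [hs]
  rw [e1, e2]
  have hZ : LocallyIntegrableOn (fun s => ∫ r in (0 : ℝ)..s, g r) (Ioi 0) :=
    (continuous_integral_bcf g).locallyIntegrable.locallyIntegrableOn _
  have i1 := hφ.deriv.integrable_smul hZ
  have i2 := hφ.integrable_smul (g.continuous.locallyIntegrable.locallyIntegrableOn (Ioi 0))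
  have hd : ∀ s, HasDerivAt (fun s => φ s • ∫ r in (0 : ℝ)..s, g r)
      (φ s • g s + deriv φ s • ∫ r in (0 : ℝ)..s, g r) s := fun s =>
    ((hφ.1.differentiable (by simp)).differentiableAt.hasDerivAt).smul (hasDerivAt_integral_bcf g s)
  have h := integral_eq_zero_of_hasDerivAt_of_integrable hd (i2.add i1) (hφ.integrable_smul hZ)
  rw [integral_add i2 i1] at h
  exact eq_neg_of_add_eq_zero_right h

lemma locallyIntegrableOn_history (ζ : L2w C δ X) : LocallyIntegrableOn ζ (Ioi 0) := by
  rw [locallyIntegrableOn_iff isOpen_Ioi.isLocallyClosed]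
  intro k hk hkc
  obtain ⟨b, hb⟩ := hkc.bddAbove
  have h := intervalIntegrable_history ζ (le_max_left 0 b)
  rw [intervalIntegrable_iff_integrableOn_Ioc_of_le (le_max_left 0 b)] at h
  exact h.mono_set fun s hs => ⟨hk hs, (hb hs).trans (le_max_right _ _)⟩

lemma eq_zero_of_volterra_eq_zero {ζ : L2w C δ X} (h : volterra C δ X ζ = 0) : ζ = 0 := by
  have key := isOpen_Ioi.ae_eq_zero_of_integral_contDiff_smul_eq_zero
    (locallyIntegrableOn_history ζ) (fun φ h1 h2 h3 => by
      have hφ : IsTest (Ioi 0) φ := ⟨h1, h2, h3⟩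
      rw [← hφ.setIntegral_smul, ← neg_eq_zero, ← integral_deriv_smul_volterra hφ, h]
      have : ∀ᵐ s ∂volume.restrict (Ioi (0 : ℝ)), (0 : L2w C δ X) s = 0 :=
        ae_histMeasure_iff.1 (Lp.coeFn_zero _ _ _)
      rw [← integral_zero ℝ X (μ := volume.restrict (Ioi 0))]
      refine integral_congr_ae ?_
      filter_upwards [this] with s hs
      rw [hs, smul_zero])
  rw [← ae_restrict_iff' measurableSet_Ioi] at key
  exact (Lp.eq_zero_iff_ae_eq_zero).2 (ae_histMeasure_iff.2 key)

/-- The continuous representative of `V ζ`. -/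
lemma exists_continuous_volterra (ζ : L2w C δ X) :
    ∃ Z : ℝ → X, Continuous Z ∧ Z 0 = 0 ∧ volterra C δ X ζ =ᵐ[volume.restrict (Ioi 0)] Z := by
  have hint : ∀ a b, IntervalIntegrable ((Ioi (0 : ℝ)).indicator ζ) volume a b := by
    have h0 : ∀ s, IntervalIntegrable ((Ioi (0 : ℝ)).indicator ζ) volume 0 s := by
      intro s
      rcases le_total 0 s with hs | hs
      · refine (intervalIntegrable_history ζ hs).congr fun r hr => ?_
        rw [uIoc_of_le hs] at hr
        simp [hr.1]
      · refine (intervalIntegrable_const (c := (0 : X))).congr fun r hr => ?_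
        rw [uIoc_of_ge hs] at hr
        simp [hr.2]
    exact fun a b => (h0 a).symm.trans (h0 b)
  refine ⟨fun s => ∫ r in (0 : ℝ)..s, (Ioi (0 : ℝ)).indicator ζ r,
    intervalIntegral.continuous_primitive hint 0, by simp, ?_⟩
  filter_upwards [coeFn_volterra ζ, ae_restrict_mem measurableSet_Ioi] with s hs (hs0 : 0 < s)
  rw [hs, intervalIntegral.integral_of_le hs0.le, intervalIntegral.integral_of_le hs0.le]
  refine setIntegral_congr_fun measurableSet_Ioc fun r hr => ?_
  simp [hr.1]

/-- Weak differentiability with zero initial value means being in the range of the Volterra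
operator. The values may be read in a larger space `Y`. -/
lemma isHistoryDeriv_iff {Y : Type*} [NormedAddCommGroup Y] [NormedSpace ℝ Y] [CompleteSpace Y]
    (ι : X →ₗᵢ[ℝ] Y) (η ζ : L2w C δ X) :
    IsHistoryDeriv (fun s => ι (η s)) (fun s => ι (ζ s)) ↔ η = volterra C δ X ζ := by
  have hint : ∀ (φ : ℝ → ℝ) (u : ℝ → X),
      ∫ s in Ioi (0 : ℝ), φ s • ι (u s) = ι (∫ s in Ioi (0 : ℝ), φ s • u s) := fun φ u => by
    rw [← LinearIsometry.integral_comp_comm]; simp only [map_smul]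
  obtain ⟨Z, hZc, hZ0, hZ⟩ := exists_continuous_volterra ζ
  constructor
  · rintro ⟨hw, g, hgc, hg0, hg⟩
    have hdiff : ∀ φ : ℝ → ℝ, IsTest (Ioi 0) φ →
        ∫ s in Ioi (0 : ℝ), deriv φ s • (η s - volterra C δ X ζ s) = 0 := by
      intro φ hφ
      have h1 := hw φ hφ
      rw [hint, hint, ← map_neg] at h1
      have h2 := ι.injective h1
      simp only [smul_sub]
      rw [integral_sub (hφ.deriv.integrable_smul (locallyIntegrableOn_history η)).integrableOn
        (hφ.deriv.integrable_smul (locallyIntegrableOn_history (volterra C δ X ζ))).integrableOn,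
        h2, integral_deriv_smul_volterra hφ, sub_self]
    obtain ⟨c, hc⟩ := exists_ae_eq_const_of_integral_deriv_smul_eq_zero
      ((locallyIntegrableOn_history η).sub (locallyIntegrableOn_history (volterra C δ X ζ))) hdiff
    -- The continuous representatives agree on `(0, ∞)`, so the values at `0` force `c = 0`.
    have hae : g =ᵐ[volume.restrict (Ioi 0)] fun s => ι (Z s + c) := by
      filter_upwards [hg, hc, hZ] with s h1 h2 h3
      rw [← h1, ← h2, ← h3, Pi.sub_apply, add_sub_cancel]
    have hcont : Continuous fun s => ι (Z s + c) := ι.continuous.comp (hZc.add continuous_const)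
    have heq := Measure.eqOn_open_of_ae_eq hae isOpen_Ioi (hgc.mono Ioi_subset_Ici_self)
      hcont.continuousOn
    have hl1 : Tendsto g (𝓝[>] 0) (𝓝 0) := by
      have := (hgc 0 self_mem_Ici).mono Ioi_subset_Ici_self
      rwa [ContinuousWithinAt, hg0] at this
    have hl2 : Tendsto g (𝓝[>] 0) (𝓝 (ι (Z 0 + c))) :=
      ((hcont.tendsto 0).mono_left nhdsWithin_le_nhds).congr'
        (by filter_upwards [self_mem_nhdsWithin] with s hs using (heq hs).symm)
    have hc0 := tendsto_nhds_unique hl1 hl2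
    rw [hZ0, zero_add] at hc0
    have hc0' : c = 0 := ι.injective (by rw [← hc0, map_zero])
    refine Lp.ext (ae_histMeasure_iff.2 ?_)
    filter_upwards [hc] with s hs
    rwa [hc0', Pi.sub_apply, sub_eq_zero] at hs
  · rintro rfl
    refine ⟨fun φ hφ => ?_, fun s => ι (Z s), (ι.continuous.comp hZc).continuousOn,
      by simp [hZ0], ?_⟩
    · rw [hint, hint, ← map_neg, integral_deriv_smul_volterra hφ]
    · filter_upwards [hZ] with s hs
      rw [hs]

/-! ### The shift semigroup on the history space -/

/-- A coercive bounded operator is onto: its range is closed with trivial orthogonal complement. -/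
lemma surjective_of_coercive (A : X →L[ℂ] X) {c : ℝ} (hc : 0 < c)
    (hA : ∀ x, c * ‖x‖ ^ 2 ≤ (inner ℂ x (A x)).re) : Function.Surjective A := by
  have hbd : ∀ x, ‖x‖ ≤ c⁻¹ * ‖A x‖ := by
    intro x
    have h := (hA x).trans (re_inner_le_norm_mul x (A x))
    rw [← div_eq_inv_mul, le_div_iff₀ hc]
    rcases (norm_nonneg x).eq_or_lt with h0 | h0
    · rw [← h0, zero_mul]; exact norm_nonneg _
    · refine le_of_mul_le_mul_left ?_ h0
      linarith
  have hanti : AntilipschitzWith (⟨c⁻¹, by positivity⟩ : ℝ≥0) A :=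
    A.antilipschitz_of_bound hbd
  have hclosed : IsClosed ((LinearMap.range (A : X →ₗ[ℂ] X) : Submodule ℂ X) : Set X) :=
    hanti.isClosed_range A.uniformContinuous
  have : CompleteSpace (LinearMap.range (A : X →ₗ[ℂ] X)) := hclosed.completeSpace_coe
  refine LinearMap.range_eq_top.1 (Submodule.orthogonal_eq_bot_iff.1 ?_)
  rw [Submodule.eq_bot_iff]
  intro z hz
  have h0 : inner ℂ z (A z) = 0 := Submodule.inner_left_of_mem_orthogonal
    (LinearMap.mem_range_self (A : X →ₗ[ℂ] X) z) hz
  have h := hA z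
  rw [h0, Complex.zero_re] at h
  have h1 : ‖z‖ ^ 2 = 0 := le_antisymm (by nlinarith) (by positivity)
  simpa using h1

variable (C δ X) in
/-- The graph of `-∂_s` with zero initial value, i.e. of the negative inverse of the Volterra
operator. -/
def transportGraph : Submodule ℂ (L2w C δ X × L2w C δ X) :=
  LinearMap.ker (LinearMap.fst ℂ _ _ +
    (volterra C δ X : L2w C δ X →ₗ[ℂ] L2w C δ X) ∘ₗ LinearMap.snd ℂ _ _)

lemma mem_transportGraph {p : L2w C δ X × L2w C δ X} :
    p ∈ transportGraph C δ X ↔ p.1 + volterra C δ X p.2 = 0 := Iff.rfl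

/-- The transport operator `-∂_s` generates a semigroup which decays like `exp (-δ t / 2)`, a rate
given by the exponential weight. -/
lemma isMaxDissipative_transportGraph : IsMaxDissipative (-(δ / 2)) (transportGraph C δ X) := by
  have hd := hδ.out
  refine ⟨fun p hp => ?_, fun lam hl f => ?_, fun y hy => ?_⟩
  · have h := mem_transportGraph.1 hp
    rw [eq_neg_of_add_eq_zero_left h, inner_neg_left, Complex.neg_re, re_inner_volterra, norm_neg]
    linarith
  · -- `lam η + ∂_s η = f` reads `(1 + lam V) ∂_s η = f`.
    obtain ⟨y, hy⟩ := surjective_of_coercive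
      (1 + (lam : ℂ) • volterra C δ X) (c := min 1 (1 + lam * (2 / δ))) (lt_min one_pos (by
        have : -(δ / 2) * (2 / δ) < lam * (2 / δ) := mul_lt_mul_of_pos_right hl (by positivity)
        have h2 : -(δ / 2) * (2 / δ) = -1 := by field_simp
        linarith)) (fun y => by
        have e : (1 + (lam : ℂ) • volterra C δ X) y = y + (lam : ℂ) • volterra C δ X y := rfl
        have hsymm : (inner ℂ y (volterra C δ X y)).re = δ / 2 * ‖volterra C δ X y‖ ^ 2 := by
          rw [← re_inner_volterra]
          exact inner_re_symm (𝕜 := ℂ) _ _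
        rw [e, inner_add_right, inner_smul_right, Complex.add_re, Complex.re_ofReal_mul, hsymm,
          show (inner ℂ y y).re = ‖y‖ ^ 2 from inner_self_eq_norm_sq (𝕜 := ℂ) y]
        have h0 : 0 ≤ ‖y‖ ^ 2 := by positivity
        rcases le_total 0 lam with h | h
        · have h3 : min 1 (1 + lam * (2 / δ)) ≤ 1 := min_le_left _ _
          have h4 : 0 ≤ lam * (δ / 2 * ‖volterra C δ X y‖ ^ 2) := by positivity
          nlinarith
        · have h3 : min 1 (1 + lam * (2 / δ)) ≤ 1 + lam * (2 / δ) := min_le_right _ _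
          have h4 : ‖volterra C δ X y‖ ^ 2 ≤ (2 / δ * ‖y‖) ^ 2 :=
            pow_le_pow_left₀ (norm_nonneg _) (norm_volterra_le y) 2
          have h5 : lam * (δ / 2 * (2 / δ * ‖y‖) ^ 2) ≤
              lam * (δ / 2 * ‖volterra C δ X y‖ ^ 2) :=
            mul_le_mul_of_nonpos_left (mul_le_mul_of_nonneg_left h4 (by positivity)) h
          have h6 : lam * (δ / 2 * (2 / δ * ‖y‖) ^ 2) = lam * (2 / δ) * ‖y‖ ^ 2 := by
            field_simp
          nlinarith) (-f)
    have hy' : y + (lam : ℂ) • volterra C δ X y = -f := hy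
    refine ⟨(-volterra C δ X y, y), mem_transportGraph.2 (by simp), ?_⟩
    change (lam : ℂ) • -volterra C δ X y - y = f
    rw [smul_neg, ← neg_add', add_comm, hy', neg_neg]
  · have h := mem_transportGraph.1 hy
    simp only [zero_add] at h
    exact eq_zero_of_volterra_eq_zero h

end History

section Shift

variable {C δ : ℝ} [hC : Fact (0 < C)] [hδ : Fact (0 < δ)]
  {X : Type*} [NormedAddCommGroup X] [InnerProductSpace ℂ X] [CompleteSpace X]

variable (C δ) in
/-- The history equal to `e` on `s` and to `0` elsewhere. -/
def stepHistory {s : Set ℝ} (hs : MeasurableSet s) (e : X) : L2w C δ X :=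
  indicatorConstLp 2 hs (measure_ne_top _ _) e

lemma coeFn_stepHistory {s : Set ℝ} (hs : MeasurableSet s) (e : X) :
    stepHistory C δ hs e =ᵐ[volume.restrict (Ioi 0)] s.indicator fun _ => e :=
  ae_histMeasure_iff.1 indicatorConstLp_coeFn

lemma stepHistory_union {s t u : Set ℝ} (hs : MeasurableSet s) (ht : MeasurableSet t)
    (hu : MeasurableSet u) (hst : Disjoint s t) (h : s ∪ t = u) (e : X) :
    stepHistory C δ hu e = stepHistory C δ hs e + stepHistory C δ ht e := by
  subst h
  exact indicatorConstLp_disjoint_union hs ht _ _ hst e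

lemma norm_stepHistory_Ioc_le {a b : ℝ} (hab : a ≤ b) (e : X) :
    ‖stepHistory C δ (measurableSet_Ioc (a := a) (b := b)) e‖ ≤ ‖e‖ * √(C * (b - a)) := by
  rw [stepHistory, norm_indicatorConstLp two_ne_zero ENNReal.ofNat_ne_top]
  refine mul_le_mul_of_nonneg_left ?_ (norm_nonneg _)
  rw [ENNReal.toReal_ofNat, ← Real.sqrt_eq_rpow]
  refine Real.sqrt_le_sqrt ?_
  refine ENNReal.toReal_le_of_le_ofReal (mul_nonneg hC.out.le (sub_nonneg.2 hab)) ?_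
  rw [histMeasure_eq, withDensity_apply _ measurableSet_Ioc, Measure.restrict_restrict
    measurableSet_Ioc]
  calc ∫⁻ s in Ioc a b ∩ Ioi 0, ENNReal.ofReal (weight C δ s)
      ≤ ∫⁻ s in Ioc a b ∩ Ioi 0, ENNReal.ofReal C := by
        refine setLIntegral_mono measurable_const fun s hs => ENNReal.ofReal_le_ofReal ?_
        have : Real.exp (-δ * s) ≤ 1 := by
          rw [Real.exp_le_one_iff]
          have := mul_pos hδ.out hs.2
          linarith
        exact mul_le_of_le_one_right hC.out.le this
    _ ≤ ∫⁻ s in Ioc a b, ENNReal.ofReal C := lintegral_mono_set inter_subset_left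
    _ = ENNReal.ofReal (C * (b - a)) := by
        rw [setLIntegral_const, Real.volume_Ioc, ENNReal.ofReal_mul hC.out.le]

/-- The Volterra operator on a short pulse `1_{(a, b]}` is `(b - a) 1_{(a, ∞)}` up to an error of
higher order. -/
lemma norm_volterra_stepHistory_sub_le {a b : ℝ} (ha : 0 ≤ a) (hab : a ≤ b) (e : X) :
    ‖volterra C δ X (stepHistory C δ (measurableSet_Ioc (a := a) (b := b)) e) -
      (b - a) • stepHistory C δ (measurableSet_Ioi (a := a)) e‖ ≤
      (b - a) * (‖e‖ * √(C * (b - a))) := by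
  have h0 : 0 ≤ b - a := sub_nonneg.2 hab
  refine le_trans ?_ (mul_le_mul_of_nonneg_left (norm_stepHistory_Ioc_le (δ := δ) hab e) h0)
  rw [← Real.norm_of_nonneg h0, ← norm_smul, Real.norm_of_nonneg h0]
  refine Lp.norm_le_norm_of_ae_le (ae_histMeasure_iff.2 ?_)
  filter_upwards [coeFn_volterra (stepHistory C δ (measurableSet_Ioc (a := a) (b := b)) e),
    coeFn_stepHistory (C := C) (δ := δ) (measurableSet_Ioi (a := a)) e,
    coeFn_stepHistory (C := C) (δ := δ) (measurableSet_Ioc (a := a) (b := b)) e,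
    ae_histMeasure_iff.1 (Lp.coeFn_sub
      (volterra C δ X (stepHistory C δ (measurableSet_Ioc (a := a) (b := b)) e))
      ((b - a) • stepHistory C δ (measurableSet_Ioi (a := a)) e)),
    ae_histMeasure_iff.1 (Lp.coeFn_smul (b - a) (stepHistory C δ (measurableSet_Ioi (a := a)) e)),
    ae_histMeasure_iff.1 (Lp.coeFn_smul (b - a)
      (stepHistory C δ (measurableSet_Ioc (a := a) (b := b)) e)),
    ae_restrict_mem measurableSet_Ioi] with s h1 h2 h3 h4 h5 h6 (hs : 0 < s)
  rw [h4, h6, Pi.sub_apply, h5, h1, Pi.smul_apply, Pi.smul_apply, h2, h3]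
  have hV : ∫ r in (0 : ℝ)..s, stepHistory C δ (measurableSet_Ioc (a := a) (b := b)) e r =
      (max (min s b - a) 0) • e := by
    rw [intervalIntegral.integral_of_le hs.le]
    have h7 : ∫ r in Ioc 0 s, stepHistory C δ (measurableSet_Ioc (a := a) (b := b)) e r =
        ∫ r in Ioc 0 s, (Ioc a b).indicator (fun _ => e) r :=
      integral_congr_ae (ae_restrict_of_ae_restrict_of_subset Ioc_subset_Ioi_self
        (coeFn_stepHistory _ e))
    rw [h7, setIntegral_indicator measurableSet_Ioc, setIntegral_const, Ioc_inter_Ioc,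
      sup_of_le_right ha, Real.volume_real_Ioc]
  rw [hV]
  rcases le_or_gt s a with hsa | hsa
  · have e1 : min s b - a ≤ 0 := by linarith [min_le_left s b]
    rw [max_eq_right e1, indicator_of_notMem (by simpa using hsa)]
    simp
  · rw [indicator_of_mem (show s ∈ Ioi a from hsa)]
    rcases le_or_gt s b with hsb | hsb
    · rw [indicator_of_mem (show s ∈ Ioc a b from ⟨hsa, hsb⟩), min_eq_left hsb,
        max_eq_left (by linarith), ← sub_smul, norm_smul, norm_smul]
      refine mul_le_mul_of_nonneg_right ?_ (norm_nonneg _)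
      rw [Real.norm_eq_abs, Real.norm_of_nonneg h0, abs_le]
      constructor <;> linarith
    · rw [min_eq_right hsb.le, max_eq_left h0, sub_self, norm_zero]
      exact norm_nonneg _

lemma tendsto_sqrt_mul_zero : Tendsto (fun h : ℝ => √(C * h)) (𝓝 0) (𝓝 0) := by
  have : Continuous fun h : ℝ => √(C * h) := by fun_prop
  simpa using this.tendsto 0

/-- The shift semigroup moves the constant history `e` to `1_{(τ, ∞)} e`: the history
`m τ : s ↦ min s τ • e` solves the transport equation with the source `e`, hence equals
`∫_0^τ S(r) e dr` by Duhamel's formula, and differentiation in `τ` gives the claim. -/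
lemma shift_const {S : ℝ → L2w C δ X →L[ℂ] L2w C δ X}
    (hS : IsSemigroupGeneratedBy S fun x y => (x, y) ∈ transportGraph C δ X) {τ : ℝ} (hτ : 0 ≤ τ)
    (e : X) : S τ (stepHistory C δ MeasurableSet.univ e) =
      stepHistory C δ (measurableSet_Ioi (a := τ)) e := by
  set m : ℝ → L2w C δ X := fun t =>
    volterra C δ X (stepHistory C δ (measurableSet_Ioc (a := 0) (b := t)) e) with hm
  have hadd : ∀ a b : ℝ, 0 ≤ a → a ≤ b → m b - m a =
      volterra C δ X (stepHistory C δ (measurableSet_Ioc (a := a) (b := b)) e) := by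
    intro a b ha hab
    have h1 := stepHistory_union (C := C) (δ := δ) (measurableSet_Ioc (a := (0 : ℝ)) (b := a))
      (measurableSet_Ioc (a := a) (b := b)) (measurableSet_Ioc (a := (0 : ℝ)) (b := b))
      (Ioc_disjoint_Ioc_of_le le_rfl) (Ioc_union_Ioc_eq_Ioc ha hab) e
    rw [hm]
    simp only
    rw [h1, map_add, add_sub_cancel_left]
  have hcont : ContinuousOn m (Ici 0) := by
    have hlip : ∀ a b : ℝ, 0 ≤ a → 0 ≤ b →
        ‖m b - m a‖ ≤ ‖volterra C δ X‖ * (‖e‖ * √(C * |b - a|)) := by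
      have h1 : ∀ a b : ℝ, 0 ≤ a → a ≤ b →
          ‖m b - m a‖ ≤ ‖volterra C δ X‖ * (‖e‖ * √(C * |b - a|)) := by
        intro a b ha hab
        rw [hadd a b ha hab, abs_of_nonneg (sub_nonneg.2 hab)]
        exact (ContinuousLinearMap.le_opNorm _ _).trans
          (mul_le_mul_of_nonneg_left (norm_stepHistory_Ioc_le hab e) (norm_nonneg _))
      intro a b ha hb
      rcases le_total a b with h | h
      · exact h1 a b ha h
      · rw [norm_sub_rev, abs_sub_comm]; exact h1 b a hb h
    intro t ht
    rw [ContinuousWithinAt, tendsto_iff_norm_sub_tendsto_zero]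
    have h2 : Tendsto (fun b : ℝ => ‖volterra C δ X‖ * (‖e‖ * √(C * |b - t|))) (𝓝[Ici 0] t)
        (𝓝 0) := by
      have : Continuous fun b : ℝ => ‖volterra C δ X‖ * (‖e‖ * √(C * |b - t|)) := by fun_prop
      simpa using (this.tendsto t).mono_left nhdsWithin_le_nhds
    refine squeeze_zero' (Eventually.of_forall fun _ => norm_nonneg _) ?_ h2
    filter_upwards [self_mem_nhdsWithin] with b hb using hlip t b ht hb
  have hder : ∀ t, 0 ≤ t → HasDerivWithinAt m (stepHistory C δ (measurableSet_Ioi (a := t)) e)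
      (Ici t) t := by
    intro t ht
    rw [hasDerivWithinAt_Ici_iff_tendsto, tendsto_iff_norm_sub_tendsto_zero]
    have h2 : Tendsto (fun h : ℝ => ‖e‖ * √(C * h)) (𝓝[>] 0) (𝓝 0) := by
      simpa using (tendsto_sqrt_mul_zero.mono_left nhdsWithin_le_nhds).const_mul ‖e‖
    refine squeeze_zero' (Eventually.of_forall fun _ => norm_nonneg _) ?_ h2
    filter_upwards [self_mem_nhdsWithin] with h (hh : 0 < h)
    have h3 := norm_volterra_stepHistory_sub_le (C := C) (δ := δ) ht
      (le_add_of_nonneg_right hh.le : t ≤ t + h) e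
    rw [add_sub_cancel_left, ← hadd t (t + h) ht (by linarith)] at h3
    have h4 : h⁻¹ • (m (t + h) - m t) - stepHistory C δ (measurableSet_Ioi (a := t)) e =
        h⁻¹ • (m (t + h) - m t - h • stepHistory C δ (measurableSet_Ioi (a := t)) e) := by
      rw [smul_sub h⁻¹ _ (h • _), smul_smul, inv_mul_cancel₀ hh.ne', one_smul]
    rw [h4, norm_smul, norm_inv, Real.norm_of_nonneg hh.le, inv_mul_le_iff₀ hh]
    exact h3
  have hm0 : m 0 = 0 := by
    have : stepHistory C δ (measurableSet_Ioc (a := (0 : ℝ)) (b := 0)) e = 0 := by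
      have h := norm_stepHistory_Ioc_le (C := C) (δ := δ) (le_refl (0 : ℝ)) e
      simpa using h
    rw [hm]; simp only; rw [this, map_zero]
  have hgraph : ∀ t, 0 ≤ t → (m t, stepHistory C δ (measurableSet_Ioi (a := t)) e -
      stepHistory C δ MeasurableSet.univ e) ∈ transportGraph C δ X := by
    intro t ht
    rw [mem_transportGraph]
    have h1 : stepHistory C δ MeasurableSet.univ e =
        stepHistory C δ (measurableSet_Ioc (a := (0 : ℝ)) (b := t)) e +
          stepHistory C δ (measurableSet_Ioi (a := t)) e := by
      refine Lp.ext (ae_histMeasure_iff.2 ?_)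
      filter_upwards [coeFn_stepHistory (C := C) (δ := δ) MeasurableSet.univ e,
        coeFn_stepHistory (C := C) (δ := δ) (measurableSet_Ioc (a := (0 : ℝ)) (b := t)) e,
        coeFn_stepHistory (C := C) (δ := δ) (measurableSet_Ioi (a := t)) e,
        ae_histMeasure_iff.1 (Lp.coeFn_add
          (stepHistory C δ (measurableSet_Ioc (a := (0 : ℝ)) (b := t)) e)
          (stepHistory C δ (measurableSet_Ioi (a := t)) e)),
        ae_restrict_mem measurableSet_Ioi] with s h1 h2 h3 h4 (hs : 0 < s)
      rw [h1, h4, Pi.add_apply, h2, h3]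
      by_cases hst : s ≤ t
      · simp [hs, hst, not_lt.2 hst]
      · simp [hst, not_le.1 hst]
    rw [h1, sub_add_cancel_right, map_neg]
    exact add_neg_cancel _
  have hduh : ∀ t, 0 ≤ t → m t =
      ∫ r in (0 : ℝ)..t, S r (stepHistory C δ MeasurableSet.univ e) := by
    intro t ht
    have h := hS.duhamel (η := m) (η' := fun t => stepHistory C δ (measurableSet_Ioi (a := t)) e)
      (f := fun _ => stepHistory C δ MeasurableSet.univ e) ht (hcont.mono Icc_subset_Ici_self)
      continuousOn_const (fun r hr => hder r hr.1) (fun r hr => hgraph r hr.1)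
    rw [hm0, map_zero, zero_add] at h
    have h' := intervalIntegral.integral_comp_sub_left (a := 0) (b := t)
      (fun r => S r (stepHistory C δ MeasurableSet.univ e)) t
    rw [sub_self, sub_zero] at h'
    exact h.trans h'
  have h1 := (continuousOn_hasDerivWithinAt_integral (t := τ + 1) (by linarith)
    ((hS.continuousOn (stepHistory C δ MeasurableSet.univ e)).mono Icc_subset_Ici_self)).2 τ
    ⟨hτ, by linarith⟩
  have h2 : HasDerivWithinAt m (S τ (stepHistory C δ MeasurableSet.univ e)) (Ici τ) τ :=
    h1.congr (fun t ht => hduh t (hτ.trans ht)) (hduh τ hτ)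
  exact (uniqueDiffWithinAt_Ici τ).eq_deriv _ h2 (hder τ hτ)

end Shift

/-! ### Admissible kernels -/

namespace IsKernel

variable {C δ : ℝ} {ν : ℝ → ℝ}

lemma continuousOn_d1 (hν : IsKernel C δ ν) : ContinuousOn (d1 ν) (Ici 0) :=
  hν.contDiffOn.continuousOn_derivWithin (uniqueDiffOn_Ici 0) (by norm_num)

lemma continuousOn_d2 (hν : IsKernel C δ ν) : ContinuousOn (d2 ν) (Ici 0) :=
  hν.contDiffOn.continuousOn_iteratedDerivWithin le_rfl (uniqueDiffOn_Ici 0)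

lemma hasDerivAt_d1 (hν : IsKernel C δ ν) {s : ℝ} (hs : 0 < s) :
    HasDerivAt (d1 ν) (d2 ν s) s := by
  have h1 : DifferentiableOn ℝ (iteratedDerivWithin 1 ν (Ici 0)) (Ici 0) :=
    hν.contDiffOn.differentiableOn_iteratedDerivWithin (by norm_num) (uniqueDiffOn_Ici 0)
  have h2 : iteratedDerivWithin 1 ν (Ici 0) = d1 ν := iteratedDerivWithin_one
  rw [h2] at h1
  have h3 := (h1 s hs.le).hasDerivWithinAt
  have h4 : derivWithin (d1 ν) (Ici 0) s = d2 ν s := by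
    rw [← h2, d2, ← iteratedDerivWithin_succ]
  rw [h4] at h3
  exact h3.hasDerivAt (Ici_mem_nhds hs)

variable [hC : Fact (0 < C)] [hδ : Fact (0 < δ)]

lemma aestronglyMeasurable_d2 (hν : IsKernel C δ ν) :
    AEStronglyMeasurable (d2 ν) (volume.restrict (Ioi 0)) :=
  (hν.continuousOn_d2.mono Ioi_subset_Ici_self).aestronglyMeasurable measurableSet_Ioi

lemma abs_d2_le_weight (hν : IsKernel C δ ν) (s : ℝ) (hs : 0 < s) :
    |d2 ν s| ≤ 1 * weight C δ s := by
  rw [one_mul]; exact hν.abs_d2_le s hs.le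

lemma integrableOn_d2 (hν : IsKernel C δ ν) : IntegrableOn (d2 ν) (Ioi 0) := by
  refine (integrableOn_weight (C := C) (δ := δ)).mono' hν.aestronglyMeasurable_d2 ?_
  filter_upwards [ae_restrict_mem measurableSet_Ioi] with s hs
  exact hν.abs_d2_le s (le_of_lt hs)

lemma integral_d2 (hν : IsKernel C δ ν) {a : ℝ} (ha : 0 ≤ a) :
    ∫ s in Ioi a, d2 ν s = -d1 ν a := by
  rw [integral_Ioi_of_hasDerivAt_of_tendsto
    ((hν.continuousOn_d1 a ha).mono (Ici_subset_Ici.2 ha))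
    (fun s hs => hν.hasDerivAt_d1 (ha.trans_lt hs))
    (hν.integrableOn_d2.mono_set (Ioi_subset_Ioi ha)) hν.tendsto_d1, zero_sub]

lemma abs_d1_le (hν : IsKernel C δ ν) {a : ℝ} (ha : 0 ≤ a) :
    |d1 ν a| ≤ C / δ * Real.exp (-δ * a) := by
  rw [← abs_neg, ← hν.integral_d2 ha]
  refine (norm_integral_le_of_norm_le (integrableOn_weight.mono_set (Ioi_subset_Ioi ha))
    (f := d2 ν) (g := weight C δ) ?_).trans_eq ?_
  · filter_upwards [ae_restrict_mem measurableSet_Ioi] with s hs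
    exact hν.abs_d2_le s (ha.trans (le_of_lt hs))
  · have hd := hδ.out
    unfold weight
    rw [integral_const_mul, integral_exp_mul_Ioi (by linarith)]
    field_simp

lemma integrableOn_d1 (hν : IsKernel C δ ν) : IntegrableOn (d1 ν) (Ioi 0) := by
  refine ((exp_neg_integrableOn_Ioi 0 hδ.out).const_mul (C / δ)).mono'
    ((hν.continuousOn_d1.mono Ioi_subset_Ici_self).aestronglyMeasurable measurableSet_Ioi) ?_
  filter_upwards [ae_restrict_mem measurableSet_Ioi] with s hs
  exact hν.abs_d1_le (le_of_lt hs)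

variable {X : Type*} [NormedAddCommGroup X] [InnerProductSpace ℂ X] [CompleteSpace X]

lemma exists_memory (hν : IsKernel C δ ν) (X : Type*) [NormedAddCommGroup X]
    [InnerProductSpace ℂ X] [CompleteSpace X] :
    ∃ L : L2w C δ X →L[ℂ] X, ∀ ζ, L ζ = ∫ s in Ioi (0 : ℝ), d2 ν s • ζ s :=
  exists_weightedIntegral (d2 ν) hν.aestronglyMeasurable_d2 hν.abs_d2_le_weight

/-- The memory operator `η ↦ ∫_0^∞ ν''(s) η(s) ds`. -/
def memory (hν : IsKernel C δ ν) (X : Type*) [NormedAddCommGroup X]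
    [InnerProductSpace ℂ X] [CompleteSpace X] : L2w C δ X →L[ℂ] X :=
  (hν.exists_memory X).choose

lemma memory_apply (hν : IsKernel C δ ν) (ζ : L2w C δ X) :
    hν.memory X ζ = ∫ s in Ioi (0 : ℝ), d2 ν s • ζ s :=
  (hν.exists_memory X).choose_spec ζ

/-- The response of the memory operator to a constant history which has been shifted by `τ`. -/
lemma memory_stepHistory_Ioi (hν : IsKernel C δ ν) {τ : ℝ} (hτ : 0 ≤ τ) (e : X) :
    hν.memory X (stepHistory C δ (measurableSet_Ioi (a := τ)) e) = -(d1 ν τ • e) := by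
  rw [memory_apply, ← neg_smul, ← hν.integral_d2 hτ, ← integral_smul_const]
  have h : ∫ s in Ioi (0 : ℝ), d2 ν s • stepHistory C δ (measurableSet_Ioi (a := τ)) e s =
      ∫ s in Ioi (0 : ℝ), (Ioi τ).indicator (fun s => d2 ν s • e) s := by
    refine integral_congr_ae ?_
    filter_upwards [coeFn_stepHistory (C := C) (δ := δ) (measurableSet_Ioi (a := τ)) e] with s hs
    rw [hs]
    by_cases h : s ∈ Ioi τ
    · rw [indicator_of_mem h, indicator_of_mem h]
    · rw [indicator_of_notMem h, indicator_of_notMem h, smul_zero]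
  rw [h, setIntegral_indicator measurableSet_Ioi, Ioi_inter_Ioi, sup_of_le_right hτ]

end IsKernel

/-! ### Passivity in the time domain -/

section Passivity

open FourierTransform Convolution

variable {X : Type*} [NormedAddCommGroup X] [InnerProductSpace ℂ X] [CompleteSpace X]

/-- On `L¹ ∩ L²` the Fourier transform of `L²` is given by the Fourier integral. -/
lemma fourier_toLp_ae_eq {f : ℝ → X} (hf : Integrable f) (hf2 : MemLp f 2) :
    (𝓕 (hf2.toLp f) : Lp X 2 (volume : Measure ℝ)) =ᵐ[volume] 𝓕 f := by
  have hcont : Continuous (𝓕 f) :=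
    VectorFourier.fourierIntegral_continuous Real.continuous_fourierChar
      (L := innerₗ ℝ) (by exact continuous_inner) hf
  refine ae_eq_of_integral_contDiff_smul_eq
    ((Lp.memLp (𝓕 (hf2.toLp f))).locallyIntegrable one_le_two) hcont.locallyIntegrable
    fun g hg hgc => ?_
  have hg1 : HasCompactSupport (Complex.ofRealCLM ∘ g) := hgc.comp_left rfl
  have hg2 : ContDiff ℝ (⊤ : ℕ∞) (Complex.ofRealCLM ∘ g) := by fun_prop
  let G : SchwartzMap ℝ ℂ := hg1.toSchwartzMap hg2
  have hG : ∀ x, G x = (g x : ℂ) := fun x => rfl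
  have h1 := congrArg (fun D => D G) (Lp.fourier_toTemperedDistribution_eq (hf2.toLp f))
  simp only [TemperedDistribution.fourier_apply, Lp.toTemperedDistribution_apply] at h1
  have h2 : ∫ x, (𝓕 G : SchwartzMap ℝ ℂ) x • (hf2.toLp f) x = ∫ x, 𝓕 (G : ℝ → ℂ) x • f x := by
    refine integral_congr_ae ?_
    filter_upwards [hf2.coeFn_toLp] with x hx
    rw [hx, SchwartzMap.fourier_coe]
  have h3 : ∫ x, 𝓕 (G : ℝ → ℂ) x • f x = ∫ x, G x • 𝓕 f x := by
    have h := VectorFourier.integral_fourierIntegral_smul_eq_flip (μ := volume) (ν := volume)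
      (L := innerₗ ℝ) Real.continuous_fourierChar (by exact continuous_inner)
      G.integrable hf
    rwa [flip_innerₗ] at h
  have h4 := h1.symm.trans (h2.trans h3)
  simp only [hG, Complex.coe_smul] at h4
  exact h4

lemma inner_toLp_eq_integral {f g : ℝ → X} (hf : MemLp f 2) (hg : MemLp g 2) :
    inner ℂ (hf.toLp f) (hg.toLp g) = ∫ r, inner ℂ (f r) (g r) := by
  rw [L2.inner_def]
  refine integral_congr_ae ?_
  filter_upwards [hf.coeFn_toLp, hg.coeFn_toLp] with r h1 h2
  rw [h1, h2]

/-- The causal kernel `1_{(0, ∞)} ν'`. -/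
def causal (ν : ℝ → ℝ) : ℝ → ℂ := (Ioi (0 : ℝ)).indicator fun s => (d1 ν s : ℂ)

variable {C δ : ℝ} [hC : Fact (0 < C)] [hδ : Fact (0 < δ)] {ν : ℝ → ℝ}

lemma IsKernel.integrable_causal (hν : IsKernel C δ ν) : Integrable (causal ν) :=
  (integrable_indicator_iff measurableSet_Ioi).2 hν.integrableOn_d1.ofReal

lemma symbol_eq_add_fourier (ν : ℝ → ℝ) (ω : ℝ) :
    symbol ν (2 * Real.pi * ω) = (ν 0 : ℂ) + 𝓕 (causal ν) ω := by
  rw [symbol, Real.fourier_eq', ← integral_indicator measurableSet_Ioi]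
  congr 2
  ext s
  by_cases hs : s ∈ Ioi (0 : ℝ)
  · rw [indicator_of_mem hs, causal, indicator_of_mem hs, smul_eq_mul]
    congr 2
    simp only [RCLike.inner_apply, conj_trivial]
    push_cast
    ring
  · rw [indicator_of_notMem hs, causal, indicator_of_notMem hs, smul_zero]

/-- Passivity in the time domain: by Plancherel's theorem, the convolution becomes multiplication
by the symbol, whose real part is nonnegative. -/
lemma IsPassive.integral_nonneg (hν : IsKernel C δ ν) (hp : IsPassive ν) {f : ℝ → X}
    (hf : Integrable f) {B : ℝ} (hB : ∀ r, ‖f r‖ ≤ B) :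
    Integrable (fun r => (inner ℂ (f r)
      ((ν 0 : ℂ) • f r + (causal ν ⋆[ContinuousLinearMap.lsmul ℂ ℂ] f) r)).re) ∧
    0 ≤ ∫ r, (inner ℂ (f r)
      ((ν 0 : ℂ) • f r + (causal ν ⋆[ContinuousLinearMap.lsmul ℂ ℂ] f) r)).re := by
  set h := causal ν ⋆[ContinuousLinearMap.lsmul ℂ ℂ] f with hh
  have hk := hν.integrable_causal
  have hhi : Integrable h := hk.integrable_convolution _ hf
  have hhB : ∀ r, ‖h r‖ ≤ (∫ s, ‖causal ν s‖) * B := by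
    intro r
    rw [← integral_mul_const]
    refine norm_integral_le_of_norm_le (hk.norm.mul_const B) (Eventually.of_forall fun s => ?_)
    rw [ContinuousLinearMap.lsmul_apply, norm_smul]
    exact mul_le_mul_of_nonneg_left (hB _) (norm_nonneg _)
  have hL2 : ∀ {u : ℝ → X} {b : ℝ}, Integrable u → (∀ r, ‖u r‖ ≤ b) → MemLp u 2 := by
    intro u b hu hb
    rw [memLp_two_iff_integrable_sq_norm hu.1]
    refine (hu.norm.const_mul b).mono' (hu.1.norm.pow 2) (Eventually.of_forall fun r => ?_)
    rw [Real.norm_of_nonneg (by positivity), sq]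
    exact mul_le_mul_of_nonneg_right (hb r) (norm_nonneg _)
  have hf2 : MemLp f 2 := hL2 hf hB
  set g : ℝ → X := fun r => (ν 0 : ℂ) • f r + h r with hg
  have hgi : Integrable g := (hf.smul (ν 0 : ℂ)).add hhi
  have hg2 : MemLp g 2 := (hf2.const_smul (ν 0 : ℂ)).add (hL2 hhi hhB)
  have hFg : ∀ ω, 𝓕 g ω = symbol ν (2 * Real.pi * ω) • 𝓕 f ω := by
    intro ω
    rw [symbol_eq_add_fourier, add_smul, ← Real.fourier_smul_convolution_eq hk hf]
    have e1 : 𝓕 g = 𝓕 ((ν 0 : ℂ) • f) + 𝓕 h :=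
      (VectorFourier.fourierIntegral_add (L := innerₗ ℝ) Real.continuous_fourierChar
        (by exact continuous_inner)
        (hf.smul (ν 0 : ℂ)) hhi)
    have e2 : 𝓕 ((ν 0 : ℂ) • f) = (ν 0 : ℂ) • 𝓕 f :=
      VectorFourier.fourierIntegral_const_smul _ _ _ _ _
    rw [e1, e2]
    rfl
  have hint : Integrable fun r => inner ℂ (f r) (g r) := by
    refine (L2.integrable_inner (𝕜 := ℂ) (hf2.toLp f) (hg2.toLp g)).congr ?_
    filter_upwards [hf2.coeFn_toLp, hg2.coeFn_toLp] with r h1 h2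
    rw [h1, h2]
  refine ⟨hint.re, ?_⟩
  have h1 : ∫ r, (inner ℂ (f r) (g r)).re = (inner ℂ (hf2.toLp f) (hg2.toLp g)).re := by
    rw [inner_toLp_eq_integral]
    exact integral_re hint
  rw [h1, ← Lp.inner_fourier_eq, L2.inner_def, ← RCLike.re_to_complex,
    ← integral_re (L2.integrable_inner (𝕜 := ℂ) _ _)]
  refine integral_nonneg_of_ae ?_
  filter_upwards [fourier_toLp_ae_eq hf hf2, fourier_toLp_ae_eq hgi hg2] with ω h2 h3
  rw [h2, h3, hFg, inner_smul_right, inner_self_eq_norm_sq_to_K, RCLike.re_to_complex]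
  have h4 : ((‖𝓕 f ω‖ : ℂ)) ^ 2 = ((‖𝓕 f ω‖ ^ 2 : ℝ) : ℂ) := by push_cast; rfl
  simp only [Pi.zero_apply]
  rw [show ((RCLike.ofReal ‖𝓕 f ω‖ : ℂ)) = ((‖𝓕 f ω‖ : ℝ) : ℂ) from rfl, h4, mul_comm,
    Complex.re_ofReal_mul]
  exact mul_nonneg (by positivity) (hp _)

/-- Passivity on a bounded time interval, by extending the signal by zero: up to time `t` the
causal convolution only sees the values of the signal before `t`. -/
lemma IsPassive.intervalIntegral_nonneg (hν : IsKernel C δ ν) (hp : IsPassive ν) {f : ℝ → X}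
    {t : ℝ} (ht : 0 ≤ t) (hf : ContinuousOn f (Icc 0 t)) :
    0 ≤ ∫ r in (0 : ℝ)..t, (inner ℂ (f r)
      (ν 0 • f r + ∫ q in (0 : ℝ)..r, d1 ν (r - q) • f q)).re := by
  set F : ℝ → X := (Ioc 0 t).indicator f with hF
  have hFi : Integrable F := (integrable_indicator_iff measurableSet_Ioc).2
    ((hf.integrableOn_compact isCompact_Icc).mono_set Ioc_subset_Icc_self)
  obtain ⟨B, hB⟩ := isCompact_Icc.exists_bound_of_continuousOn hf
  have hB0 : 0 ≤ B := (norm_nonneg _).trans (hB 0 ⟨le_rfl, ht⟩)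
  have hFB : ∀ r, ‖F r‖ ≤ B := by
    intro r
    by_cases hr : r ∈ Ioc 0 t
    · rw [hF, indicator_of_mem hr]; exact hB r (Ioc_subset_Icc_self hr)
    · rw [hF, indicator_of_notMem hr, norm_zero]; exact hB0
  refine (hp.integral_nonneg hν hFi hFB).2.trans_eq ?_
  rw [intervalIntegral.integral_of_le ht, ← integral_indicator measurableSet_Ioc]
  congr 1
  ext r
  by_cases hr : r ∈ Ioc 0 t
  · rw [indicator_of_mem hr, hF, indicator_of_mem hr, Complex.coe_smul]
    congr 4
    rw [convolution_eq_swap, intervalIntegral.integral_of_le hr.1.le,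
      ← integral_indicator measurableSet_Ioc]
    -- the endpoint `q = r` is a null set
    refine integral_congr_ae ?_
    filter_upwards [compl_mem_ae_iff.2 (measure_singleton r)] with q hq
    rw [ContinuousLinearMap.lsmul_apply]
    by_cases h1 : q ∈ Ioc 0 r
    · have h2 : r - q ∈ Ioi (0 : ℝ) := sub_pos.2 (lt_of_le_of_ne h1.2 hq)
      rw [indicator_of_mem h1, causal, indicator_of_mem h2,
        indicator_of_mem (show q ∈ Ioc 0 t from ⟨h1.1, h1.2.trans hr.2⟩), Complex.coe_smul]
    · rw [indicator_of_notMem h1]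
      by_cases h2 : 0 < q
      · have h3 : r - q ∉ Ioi (0 : ℝ) := by
          rw [mem_Ioi, sub_pos, not_lt]
          by_contra h4
          exact h1 ⟨h2, (not_le.1 h4).le⟩
        rw [causal, indicator_of_notMem h3, zero_smul]
      · rw [indicator_of_notMem (fun h : q ∈ Ioc 0 t => h2 h.1), smul_zero]
  · rw [indicator_of_notMem hr, hF, indicator_of_notMem hr, inner_zero_left, Complex.zero_re]

end Passivity

/-! ### Classical vector calculus -/

section Calculus

/-- The curl as a linear function of the derivative. -/
def curlL : (R3 →L[ℝ] C3) →ₗ[ℝ] C3 where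
  toFun A := !₂[A (EuclideanSpace.single 1 1) 2 - A (EuclideanSpace.single 2 1) 1,
    A (EuclideanSpace.single 2 1) 0 - A (EuclideanSpace.single 0 1) 2,
    A (EuclideanSpace.single 0 1) 1 - A (EuclideanSpace.single 1 1) 0]
  map_add' A B := by ext i; fin_cases i <;> simp <;> ring
  map_smul' c A := by ext i; fin_cases i <;> simp <;> ring

/-- The gradient as a linear function of the derivative. -/
def gradL : (R3 →L[ℝ] ℂ) →ₗ[ℝ] C3 where
  toFun A := !₂[A (EuclideanSpace.single 0 1), A (EuclideanSpace.single 1 1),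
    A (EuclideanSpace.single 2 1)]
  map_add' A B := by ext i; fin_cases i <;> simp
  map_smul' c A := by ext i; fin_cases i <;> simp

lemma curl_eq (φ : R3 → C3) (x : R3) : curl φ x = curlL (fderiv ℝ φ x) := rfl

lemma curl_add {φ ψ : R3 → C3} (hφ : Differentiable ℝ φ) (hψ : Differentiable ℝ ψ) :
    curl (φ + ψ) = curl φ + curl ψ := by
  ext1 x
  rw [Pi.add_apply, curl_eq, curl_eq, curl_eq, fderiv_add (hφ x) (hψ x), map_add]

lemma curl_smul (c : ℂ) {φ : R3 → C3} (hφ : Differentiable ℝ φ) :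
    curl (c • φ) = c • curl φ := by
  ext1 x
  have h : fderiv ℝ (c • φ) x = c • fderiv ℝ φ x := fderiv_const_smul (hφ x) c
  rw [Pi.smul_apply, curl_eq, h]
  ext i
  fin_cases i <;> simp [curl, pderiv, curlL, mul_sub]

section Test

variable {V F : Type*} [NormedAddCommGroup V] [NormedSpace ℝ V] [NormedAddCommGroup F]
  [NormedSpace ℝ F] {U : Set V}

lemma IsTest.differentiable {φ : V → F} (h : IsTest U φ) : Differentiable ℝ φ :=
  h.1.differentiable (by simp)

lemma IsTest.mono {U' : Set V} {φ : V → F} (h : IsTest U φ) (hU : U ⊆ U') : IsTest U' φ :=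
  ⟨h.1, h.2.1, h.2.2.trans hU⟩

lemma IsTest.apply_eq_zero {φ : V → F} (hφ : IsTest U φ) {x : V} (hx : x ∉ U) : φ x = 0 :=
  image_eq_zero_of_notMem_tsupport fun h => hx (hφ.2.2 h)

lemma IsTest.clm_fderiv {φ : V → F} (h : IsTest U φ) {G : Type*} [NormedAddCommGroup G]
    [NormedSpace ℝ G] (L : (V →L[ℝ] F) →L[ℝ] G) : IsTest U fun x => L (fderiv ℝ φ x) := by
  refine ⟨L.contDiff.comp (h.1.fderiv_right le_rfl), (h.2.1.fderiv ℝ).comp_left (map_zero L), ?_⟩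
  refine ((closure_mono fun x hx => ?_).trans (tsupport_fderiv_subset ℝ)).trans h.2.2
  intro h0
  exact hx (by simp only; rw [h0, map_zero])

lemma IsTest.memLp [MeasurableSpace V] [BorelSpace V] [FiniteDimensional ℝ V] {φ : V → F}
    (h : IsTest U φ) (μ : Measure V) [IsFiniteMeasureOnCompacts μ] : MemLp φ 2 μ :=
  h.1.continuous.memLp_of_hasCompactSupport h.2.1

end Test

variable {Ω : Set R3}

lemma IsTest.curl {φ : R3 → C3} (h : IsTest Ω φ) : IsTest Ω (curl φ) :=
  h.clm_fderiv (LinearMap.toContinuousLinearMap curlL)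

lemma IsTest.grad {ψ : R3 → ℂ} (h : IsTest Ω ψ) : IsTest Ω (grad ψ) :=
  h.clm_fderiv (LinearMap.toContinuousLinearMap gradL)

lemma pderiv_coord {φ : R3 → C3} (hφ : Differentiable ℝ φ) (i j : Fin 3) (x : R3) :
    pderiv j φ x i = pderiv j (fun y => φ y i) x := by
  have h := ((EuclideanSpace.proj (𝕜 := ℂ) i : C3 →L[ℂ] ℂ).restrictScalars ℝ).hasFDerivAt.comp x
    (hφ x).hasFDerivAt
  have h2 : fderiv ℝ (fun y => φ y i) x = _ := h.fderiv
  rw [pderiv, pderiv, h2]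
  rfl

lemma grad_coord (ψ : R3 → ℂ) (i : Fin 3) (x : R3) : grad ψ x i = pderiv i ψ x := by
  fin_cases i <;> rfl

lemma pderiv_comm {ψ : R3 → ℂ} (hψ : ContDiff ℝ (⊤ : ℕ∞) ψ) (i j : Fin 3) (x : R3) :
    pderiv i (pderiv j ψ) x = pderiv j (pderiv i ψ) x := by
  have hd : DifferentiableAt ℝ (fderiv ℝ ψ) x :=
    ((hψ.fderiv_right (m := (⊤ : ℕ∞)) le_rfl).differentiable (by simp)) x
  have h : ∀ i j : Fin 3, pderiv i (pderiv j ψ) x =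
      fderiv ℝ (fderiv ℝ ψ) x (EuclideanSpace.single i 1) (EuclideanSpace.single j 1) := by
    intro i j
    have h1 : HasFDerivAt (pderiv j ψ) _ x :=
      (ContinuousLinearMap.apply ℝ ℂ (EuclideanSpace.single j (1 : ℝ))).hasFDerivAt.comp x
        hd.hasFDerivAt
    rw [pderiv, h1.fderiv]
    rfl
  rw [h, h]
  have h2 : minSmoothness ℝ 2 ≤ ((⊤ : ℕ∞) : WithTop ℕ∞) := by
    rw [minSmoothness_of_isRCLikeNormedField]
    exact WithTop.coe_le_coe.2 (le_top : (2 : ℕ∞) ≤ ⊤)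
  exact (hψ.contDiffAt.isSymmSndFDerivAt h2) _ _

lemma curl_grad {ψ : R3 → ℂ} (hψ : ContDiff ℝ (⊤ : ℕ∞) ψ) : curl (grad ψ) = 0 := by
  have hd : Differentiable ℝ (grad ψ) := by
    have h1 : ContDiff ℝ (⊤ : ℕ∞) (fun x => LinearMap.toContinuousLinearMap gradL (fderiv ℝ ψ x)) :=
      (LinearMap.toContinuousLinearMap gradL).contDiff.comp
        (hψ.fderiv_right le_rfl)
    exact h1.differentiable (by simp)
  have h : ∀ i j x, pderiv j (grad ψ) x i = pderiv i (grad ψ) x j := by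
    intro i j x
    rw [pderiv_coord hd, pderiv_coord hd]
    simp only [grad_coord]
    exact pderiv_comm hψ j i x
  ext x i
  fin_cases i
  · exact sub_eq_zero.2 (h 2 1 x)
  · exact sub_eq_zero.2 (h 0 2 x)
  · exact sub_eq_zero.2 (h 1 0 x)

/-- Integration by parts for one partial derivative. -/
lemma integral_conj_mul_pderiv {a b : R3 → ℂ} (ha : ContDiff ℝ (⊤ : ℕ∞) a)
    (hb : IsTest univ b) (j : Fin 3) :
    Integrable (fun x => starRingEnd ℂ (a x) * pderiv j b x) ∧
    Integrable (fun x => starRingEnd ℂ (pderiv j a x) * b x) ∧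
    ∫ x, starRingEnd ℂ (a x) * pderiv j b x = -∫ x, starRingEnd ℂ (pderiv j a x) * b x := by
  have hda : Differentiable ℝ a := ha.differentiable (by simp)
  have hca : Differentiable ℝ fun x => starRingEnd ℂ (a x) :=
    Complex.conjCLE.differentiable.comp hda
  have hcd : ∀ x, fderiv ℝ (fun x => starRingEnd ℂ (a x)) x (EuclideanSpace.single j 1) =
      starRingEnd ℂ (pderiv j a x) := by
    intro x
    have h1 : HasFDerivAt (fun x => starRingEnd ℂ (a x)) _ x :=
      ((Complex.conjCLE : ℂ →L[ℝ] ℂ).hasFDerivAt).comp x (hda x).hasFDerivAt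
    rw [h1.fderiv]
    rfl
  have hcont_a' : Continuous (pderiv j a) :=
    (ha.continuous_fderiv (by simp)).clm_apply continuous_const
  have hcont_b' : Continuous (pderiv j b) :=
    (hb.1.continuous_fderiv (by simp)).clm_apply continuous_const
  have hsupp_b' : HasCompactSupport (pderiv j b) := by
    refine (hb.2.1.fderiv ℝ).comp_left (g := fun A : R3 →L[ℝ] ℂ => A (EuclideanSpace.single j 1)) ?_
    rfl
  have i1 : Integrable (fun x => starRingEnd ℂ (a x) * pderiv j b x) :=
    Continuous.integrable_of_hasCompactSupport
      ((Complex.continuous_conj.comp ha.continuous).mul hcont_b') hsupp_b'.mul_left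
  have i2 : Integrable (fun x => starRingEnd ℂ (pderiv j a x) * b x) :=
    Continuous.integrable_of_hasCompactSupport
      ((Complex.continuous_conj.comp hcont_a').mul hb.1.continuous) hb.2.1.mul_left
  have i3 : Integrable (fun x => starRingEnd ℂ (a x) * b x) :=
    Continuous.integrable_of_hasCompactSupport
      ((Complex.continuous_conj.comp ha.continuous).mul hb.1.continuous) hb.2.1.mul_left
  refine ⟨i1, i2, ?_⟩
  have h := integral_mul_fderiv_eq_neg_fderiv_mul_of_integrable (μ := volume)
    (f := fun x => starRingEnd ℂ (a x)) (g := b) (v := EuclideanSpace.single j 1)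
    (by simpa only [hcd] using i2) i1 i3 (fun x _ => hca x) (fun x _ => hb.differentiable x)
  simp only [hcd] at h
  exact h

lemma integral_sub_add_sub_add_sub {f₁ f₂ f₃ f₄ f₅ f₆ : R3 → ℂ} (h₁ : Integrable f₁)
    (h₂ : Integrable f₂) (h₃ : Integrable f₃) (h₄ : Integrable f₄) (h₅ : Integrable f₅)
    (h₆ : Integrable f₆) :
    ∫ x, (f₁ x - f₂ x) + (f₃ x - f₄ x) + (f₅ x - f₆ x) =
      (∫ x, f₁ x) - (∫ x, f₂ x) + ((∫ x, f₃ x) - ∫ x, f₄ x) + ((∫ x, f₅ x) - ∫ x, f₆ x) := by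
  have e₁ := integral_add (f := fun x => f₁ x - f₂ x) (g := fun x => f₃ x - f₄ x)
    (h₁.sub h₂) (h₃.sub h₄)
  have e₂ := integral_add (f := fun x => (f₁ x - f₂ x) + (f₃ x - f₄ x))
    (g := fun x => f₅ x - f₆ x) ((h₁.sub h₂).add (h₃.sub h₄)) (h₅.sub h₆)
  rw [e₂, e₁, integral_sub h₁ h₂, integral_sub h₃ h₄, integral_sub h₅ h₆]

/-- The curl is formally symmetric. -/
lemma integral_inner_curl {u φ : R3 → C3} (hu : ContDiff ℝ (⊤ : ℕ∞) u) (hφ : IsTest univ φ) :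
    ∫ x, inner ℂ (u x) (curl φ x) = ∫ x, inner ℂ (curl u x) (φ x) := by
  have hproj : ∀ {w : R3 → C3} (i : Fin 3), ContDiff ℝ (⊤ : ℕ∞) w →
      ContDiff ℝ (⊤ : ℕ∞) (fun x => w x i) := fun i hw =>
    ((EuclideanSpace.proj (𝕜 := ℂ) i : C3 →L[ℂ] ℂ).restrictScalars ℝ).contDiff.comp hw
  have ht : ∀ i, IsTest univ (fun x => φ x i) := fun i =>
    ⟨hproj i hφ.1, hφ.2.1.comp_left (g := fun z : C3 => z i) rfl, subset_univ _⟩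
  have key := fun i k j => integral_conj_mul_pderiv (hproj i hu) (ht k) j
  have hdu : Differentiable ℝ u := hu.differentiable (by simp)
  have e1 : ∀ x, inner ℂ (u x) (curl φ x) =
      (starRingEnd ℂ (u x 0) * pderiv 1 (fun y => φ y 2) x
        - starRingEnd ℂ (u x 0) * pderiv 2 (fun y => φ y 1) x)
      + (starRingEnd ℂ (u x 1) * pderiv 2 (fun y => φ y 0) x
        - starRingEnd ℂ (u x 1) * pderiv 0 (fun y => φ y 2) x)
      + (starRingEnd ℂ (u x 2) * pderiv 0 (fun y => φ y 1) x
        - starRingEnd ℂ (u x 2) * pderiv 1 (fun y => φ y 0) x) := by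
    intro x
    simp only [← pderiv_coord hφ.differentiable]
    simp only [PiLp.inner_apply, Fin.sum_univ_three, RCLike.inner_apply, curl]
    simp
    ring
  have e2 : ∀ x, inner ℂ (curl u x) (φ x) =
      (starRingEnd ℂ (pderiv 1 (fun y => u y 2) x) * φ x 0
        - starRingEnd ℂ (pderiv 2 (fun y => u y 1) x) * φ x 0)
      + (starRingEnd ℂ (pderiv 2 (fun y => u y 0) x) * φ x 1
        - starRingEnd ℂ (pderiv 0 (fun y => u y 2) x) * φ x 1)
      + (starRingEnd ℂ (pderiv 0 (fun y => u y 1) x) * φ x 2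
        - starRingEnd ℂ (pderiv 1 (fun y => u y 0) x) * φ x 2) := by
    intro x
    simp only [← pderiv_coord hdu]
    simp only [PiLp.inner_apply, Fin.sum_univ_three, RCLike.inner_apply, curl]
    simp
    ring
  simp only [e1, e2]
  rw [integral_sub_add_sub_add_sub (key 0 2 1).1 (key 0 1 2).1 (key 1 0 2).1 (key 1 2 0).1
      (key 2 1 0).1 (key 2 0 1).1,
    integral_sub_add_sub_add_sub (key 2 0 1).2.1 (key 1 0 2).2.1 (key 0 1 2).2.1 (key 2 1 0).2.1
      (key 1 2 0).2.1 (key 0 2 1).2.1]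
  rw [(key 0 2 1).2.2, (key 0 1 2).2.2, (key 1 0 2).2.2, (key 1 2 0).2.2, (key 2 1 0).2.2,
    (key 2 0 1).2.2]
  ring

end Calculus

/-! ### The curl with and without boundary condition -/

section WeakCurl

variable {Ω : Set R3}

/-- The graph of the curl on `C_c^∞(Ω)³` as a subspace. -/
def testCurlSubmodule (Ω : Set R3) : Submodule ℂ (L2 Ω × L2 Ω) where
  carrier := testCurlGraph Ω
  add_mem' := by
    rintro p q ⟨φ, hφ, h1, h2⟩ ⟨ψ, hψ, h3, h4⟩
    refine ⟨φ + ψ, ⟨hφ.1.add hψ.1, hφ.2.1.add hψ.2.1,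
      (tsupport_add _ _).trans (union_subset hφ.2.2 hψ.2.2)⟩, ?_, ?_⟩
    · exact (Lp.coeFn_add _ _).trans (h1.add h3)
    · rw [curl_add hφ.differentiable hψ.differentiable]
      exact (Lp.coeFn_add _ _).trans (h2.add h4)
  zero_mem' := by
    refine ⟨0, ⟨contDiff_const, HasCompactSupport.zero, by simp⟩, Lp.coeFn_zero _ _ _, ?_⟩
    have : curl 0 = 0 := by
      have := curl_smul 0 (φ := 0) (differentiable_const 0)
      rwa [zero_smul, zero_smul] at this
    rw [this]
    exact Lp.coeFn_zero _ _ _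
  smul_mem' := by
    rintro c p ⟨φ, hφ, h1, h2⟩
    refine ⟨c • φ, ⟨contDiff_const.smul hφ.1, hφ.2.1.smul_left (f := fun _ => c),
      (closure_mono (Function.support_const_smul_subset c φ)).trans hφ.2.2⟩, ?_, ?_⟩
    · exact (Lp.coeFn_smul _ _).trans (h1.const_smul c)
    · rw [curl_smul c hφ.differentiable]
      exact (Lp.coeFn_smul _ _).trans (h2.const_smul c)

/-- The graph of the curl on `H₀(curl, Ω)`. -/
def curlZero (Ω : Set R3) : Submodule ℂ (L2 Ω × L2 Ω) := (testCurlSubmodule Ω).topologicalClosure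

lemma IsTest.mem_testCurlGraph {φ : R3 → C3} (hφ : IsTest Ω φ) :
    ((hφ.memLp (volume.restrict Ω)).toLp φ,
      (hφ.curl.memLp (volume.restrict Ω)).toLp (Maxwell.curl φ)) ∈ testCurlGraph Ω :=
  ⟨φ, hφ, MemLp.coeFn_toLp (hφ.memLp _), MemLp.coeFn_toLp (hφ.curl.memLp _)⟩

lemma inner_eq_integral_of_ae {u v : L2 Ω} {f g : R3 → C3} (hu : u =ᵐ[volume.restrict Ω] f)
    (hv : v =ᵐ[volume.restrict Ω] g) : inner ℂ u v = ∫ x in Ω, inner ℂ (f x) (g x) := by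
  rw [L2.inner_def]
  refine integral_congr_ae ?_
  filter_upwards [hu, hv] with x h1 h2
  rw [h1, h2]

lemma setIntegral_inner_of_isTest_right {f g : R3 → C3} (hg : IsTest Ω g) :
    ∫ x in Ω, inner ℂ (f x) (g x) = ∫ x, inner ℂ (f x) (g x) :=
  setIntegral_eq_integral_of_forall_compl_eq_zero fun x hx => by
    rw [hg.apply_eq_zero hx, inner_zero_right]

/-- Weak curls are unique, as the test fields are dense in `L²(Ω)³`. -/
lemma IsWeakCurl.unique (hΩ : IsOpen Ω) {u v w : L2 Ω} (hv : IsWeakCurl u v)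
    (hw : IsWeakCurl u w) : v = w := by
  rw [← sub_eq_zero]
  set z := v - w with hz
  have h0 : ∀ φ : R3 → C3, IsTest Ω φ → ∫ x in Ω, inner ℂ (φ x) (z x) = 0 := by
    intro φ hφ
    rw [← inner_eq_integral_of_ae (MemLp.coeFn_toLp (hφ.memLp (volume.restrict Ω)))
      (ae_eq_refl _), hz, inner_sub_right, ← hv _ hφ.mem_testCurlGraph,
      ← hw _ hφ.mem_testCurlGraph, sub_self]
  have h1 : ∀ c : C3, ∀ᵐ x ∂volume.restrict Ω, inner ℂ c (z x) = 0 := by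
    intro c
    have hli : LocallyIntegrableOn (fun x => inner ℂ c (z x)) Ω := by
      refine locallyIntegrableOn_of_locallyIntegrable_restrict ?_
      exact ((Lp.memLp z).const_inner (𝕜 := ℂ) c).locallyIntegrable one_le_two
    have key := hΩ.ae_eq_zero_of_integral_contDiff_smul_eq_zero hli (fun g hg hgc hgs => ?_)
    · exact (ae_restrict_iff' hΩ.measurableSet).2 key
    have hφ : IsTest Ω (fun x => g x • c) :=
      ⟨hg.smul contDiff_const, hgc.smul_right, (closure_mono (by
        intro x hx h0
        exact hx (by simp only; rw [h0, zero_smul]))).trans hgs⟩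
    have h2 := h0 _ hφ
    rw [setIntegral_eq_integral_of_forall_compl_eq_zero (fun x hx => by
      rw [hφ.apply_eq_zero hx, inner_zero_left])] at h2
    rw [← h2]
    congr 1
    ext x
    rw [← Complex.coe_smul, ← Complex.coe_smul, inner_smul_left, Complex.conj_ofReal, smul_eq_mul]
  have h2 : ∀ᵐ x ∂volume.restrict Ω, ∀ i : Fin 3,
      inner ℂ (EuclideanSpace.single i (1 : ℂ)) (z x) = 0 := ae_all_iff.2 fun i => h1 _
  refine (Lp.eq_zero_iff_ae_eq_zero).2 ?_
  filter_upwards [h2] with x hx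
  ext i
  have := hx i
  rw [EuclideanSpace.inner_single_left] at this
  simpa using this

/-- Green's formula for `H₀(curl, Ω)` and `H(curl, Ω)`. -/
lemma inner_curl_eq {p : L2 Ω × L2 Ω} (hp : p ∈ curlZero Ω) {u v : L2 Ω} (h : IsWeakCurl u v) :
    inner ℂ p.2 u = inner ℂ p.1 v := by
  have hc : IsClosed {p : L2 Ω × L2 Ω | inner ℂ p.2 u = inner ℂ p.1 v} :=
    isClosed_eq (continuous_snd.inner continuous_const) (continuous_fst.inner continuous_const)
  exact closure_minimal (fun p hp => h p hp) hc hp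

/-- Fields in `H₀(curl, Ω)` have a weak curl: the curl is symmetric on test fields. -/
lemma isWeakCurl_of_mem_curlZero {p : L2 Ω × L2 Ω} (hp : p ∈ curlZero Ω) :
    IsWeakCurl p.1 p.2 := by
  intro q hq
  have hc : IsClosed {p : L2 Ω × L2 Ω | inner ℂ q.2 p.1 = inner ℂ q.1 p.2} :=
    isClosed_eq (continuous_const.inner continuous_fst) (continuous_const.inner continuous_snd)
  refine closure_minimal (fun p hp => ?_) hc hp
  obtain ⟨φ, hφ, h1, h2⟩ := hq
  obtain ⟨ψ, hψ, h3, h4⟩ := hp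
  change inner ℂ q.2 p.1 = inner ℂ q.1 p.2
  rw [inner_eq_integral_of_ae h2 h3, inner_eq_integral_of_ae h1 h4,
    setIntegral_inner_of_isTest_right hψ, setIntegral_inner_of_isTest_right hψ.curl]
  exact (integral_inner_curl hφ.1 (hψ.mono (subset_univ Ω))).symm

/-- The value of the closed operator on `H₀(curl, Ω)` is determined by the weak curl. -/
lemma mem_curlZero_iff (hΩ : IsOpen Ω) {u v : L2 Ω} :
    (u, v) ∈ curlZero Ω ↔ IsWeakCurl u v ∧ ZeroTangentialTrace u := by
  refine ⟨fun h => ⟨isWeakCurl_of_mem_curlZero h, v, h⟩, fun ⟨h1, w, hw⟩ => ?_⟩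
  have h2 : IsWeakCurl u w := isWeakCurl_of_mem_curlZero (p := (u, w)) hw
  rw [h1.unique hΩ h2]
  exact hw

/-- Weak curls are divergence free: test with the gradients of test functions. -/
lemma IsWeakCurl.mem_J {u v : L2 Ω} (h : IsWeakCurl u v) : v ∈ J Ω := by
  rw [J, Submodule.mem_orthogonal]
  intro g hg
  induction hg using Submodule.span_induction with
  | mem g hg =>
    obtain ⟨ψ, hψ, hgψ⟩ := hg
    have hmem : (g, (0 : L2 Ω)) ∈ testCurlGraph Ω :=
      ⟨grad ψ, hψ.grad, hgψ, by rw [curl_grad hψ.1]; exact Lp.coeFn_zero _ _ _⟩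
    rw [← h _ hmem, inner_zero_left]
  | zero => exact inner_zero_left _
  | add x y _ _ hx hy => rw [inner_add_left, hx, hy, add_zero]
  | smul c x _ hx => rw [inner_smul_left, hx, mul_zero]

/-- The curl of a field in `H₀(curl, Ω)` is divergence free and tangential to the boundary. -/
lemma mem_Jhat_of_mem_curlZero {p : L2 Ω × L2 Ω} (hp : p ∈ curlZero Ω) : p.2 ∈ Jhat Ω := by
  have hc : IsClosed {p : L2 Ω × L2 Ω | p.2 ∈ Jhat Ω} :=
    (Submodule.isClosed_orthogonal _).preimage continuous_snd
  refine closure_minimal (fun p hp => ?_) hc hp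
  obtain ⟨φ, hφ, -, h2⟩ := hp
  change p.2 ∈ Jhat Ω
  rw [Jhat, Submodule.mem_orthogonal]
  intro g hg
  induction hg using Submodule.span_induction with
  | mem g hg =>
    obtain ⟨ψ, hψ, hgψ⟩ := hg
    rw [inner_eq_integral_of_ae hgψ h2, setIntegral_inner_of_isTest_right hφ.curl,
      integral_inner_curl hψ.grad.1 (hφ.mono (subset_univ Ω)), curl_grad hψ.1]
    simp
  | zero => exact inner_zero_left _
  | add x y _ _ hx hy => rw [inner_add_left, hx, hy, add_zero]
  | smul c x _ hx => rw [inner_smul_left, hx, mul_zero]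

/-- The first order system `u - κ curl h = a`, `h + κ curl u = b` with `u` in `H₀(curl, Ω)`, solved
by projecting `(a, b)` orthogonally onto the graph of `κ curl`. -/
lemma exists_curl_system {κ : ℝ} (hκ : 0 < κ) (a b : L2 Ω) :
    ∃ u v h k : L2 Ω, (u, v) ∈ curlZero Ω ∧ IsWeakCurl h k ∧
      u - (κ : ℂ) • k = a ∧ h + (κ : ℂ) • v = b := by
  have hκ' : (κ : ℂ) ≠ 0 := Complex.ofReal_ne_zero.2 hκ.ne'
  let Φ : WithLp 2 (L2 Ω × L2 Ω) →L[ℂ] L2 Ω × L2 Ω :=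
    ((WithLp.fstL 2 ℂ (L2 Ω) (L2 Ω))).prod ((κ : ℂ)⁻¹ • WithLp.sndL 2 ℂ (L2 Ω) (L2 Ω))
  let K : Submodule ℂ (WithLp 2 (L2 Ω × L2 Ω)) := (curlZero Ω).comap (Φ : _ →ₗ[ℂ] L2 Ω × L2 Ω)
  have hK : ∀ p, p ∈ K ↔ (p.fst, (κ : ℂ)⁻¹ • p.snd) ∈ curlZero Ω := fun p => Iff.rfl
  have hclosed : IsClosed (K : Set (WithLp 2 (L2 Ω × L2 Ω))) :=
    ((testCurlSubmodule Ω).isClosed_topologicalClosure).preimage Φ.continuous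
  have : CompleteSpace K := hclosed.completeSpace_coe
  set z : WithLp 2 (L2 Ω × L2 Ω) := WithLp.toLp 2 (a, b) with hz
  set p : WithLp 2 (L2 Ω × L2 Ω) := K.starProjection z with hp
  have hpK : p ∈ K := K.starProjection_apply_mem z
  have horth : ∀ q ∈ K, inner ℂ q (z - p) = 0 := fun q hq =>
    Submodule.inner_right_of_mem_orthogonal hq (K.sub_starProjection_mem_orthogonal z)
  -- The residual is orthogonal to the graph: `⟨φ, a - u⟩ + κ ⟨curl φ, h⟩ = 0` for test fields `φ`,
  -- which says that `h = b - κ curl u` has the weak curl `-κ⁻¹ (a - u)`.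
  refine ⟨p.fst, (κ : ℂ)⁻¹ • p.snd, b - p.snd, -((κ : ℂ)⁻¹ • (a - p.fst)), hpK, ?_, ?_, ?_⟩
  · intro q hq
    have hq' : WithLp.toLp 2 (q.1, (κ : ℂ) • q.2) ∈ K := by
      rw [hK]
      change (q.1, (κ : ℂ)⁻¹ • (κ : ℂ) • q.2) ∈ curlZero Ω
      rw [smul_smul, inv_mul_cancel₀ hκ', one_smul]
      exact subset_closure hq
    have h := horth _ hq'
    rw [WithLp.prod_inner_apply] at h
    change inner ℂ q.1 (a - p.fst) + inner ℂ ((κ : ℂ) • q.2) (b - p.snd) = 0 at h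
    rw [inner_smul_left, Complex.conj_ofReal] at h
    rw [inner_neg_right, inner_smul_right, eq_neg_of_add_eq_zero_left h, mul_neg, neg_neg,
      inv_mul_cancel_left₀ hκ']
  · rw [smul_neg, smul_smul, mul_inv_cancel₀ hκ', one_smul]; abel
  · rw [smul_smul, mul_inv_cancel₀ hκ', one_smul]; abel

lemma smul_add_smul_eq_of_add_smul_eq {M : Type*} [AddCommGroup M] [Module ℂ M]
    {l e r a b κ : ℂ} {u k f : M} (h : u + κ • k = a • f) (h₁ : l * e * r * κ = b)
    (h₂ : l * e * r * a = e) : l • e • r • u + b • k = e • f := by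
  rw [smul_smul, smul_smul, ← h₁, mul_smul _ κ, ← smul_add, h, smul_smul, h₂]

lemma smul_sub_smul_eq_of_sub_smul_eq {M : Type*} [AddCommGroup M] [Module ℂ M]
    {l e r a b κ : ℂ} {u k f : M} (h : u - κ • k = a • f) (h₁ : l * e * r * κ = b)
    (h₂ : l * e * r * a = e) : l • e • r • u - b • k = e • f := by
  rw [smul_smul, smul_smul, ← h₁, mul_smul _ κ, ← smul_sub, h, smul_smul, h₂]

lemma mem_of_smul_smul_eq {M : Type*} [AddCommGroup M] [Module ℂ M] (N : Submodule ℂ M) {l e : ℂ}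
    {u k f : M} (hl : l ≠ 0) (he : e ≠ 0) (hf : f ∈ N) (hk : k ∈ N) (h : l • e • u = e • f + k) :
    u ∈ N := by
  have h' : l • e • u ∈ N := h ▸ N.add_mem (N.smul_mem _ hf) hk
  rw [smul_smul] at h'
  exact (N.smul_mem_iff (mul_ne_zero hl he)).1 h'

/-- The resolvent of the Maxwell operator without memory. The solution inherits the constraints on
the divergence and the normal trace from the data, as the curls satisfy them. -/
lemma exists_maxwell_resolvent {ε μ lam : ℝ} (hε : 0 < ε) (hμ : 0 < μ) (hl : 0 < lam)
    (f : J Ω) (g : Jhat Ω) :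
    ∃ (E : J Ω) (H : Jhat Ω) (cE cH : L2 Ω), ((E : L2 Ω), cE) ∈ curlZero Ω ∧
      IsWeakCurl (H : L2 Ω) cH ∧
      (lam : ℂ) • (ε : ℂ) • (E : L2 Ω) - cH = (ε : ℂ) • (f : L2 Ω) ∧
      (lam : ℂ) • (μ : ℂ) • (H : L2 Ω) + cE = (μ : ℂ) • (g : L2 Ω) := by
  -- The scaling `E = √μ u`, `H = √ε h` makes the two off-diagonal coefficients equal.
  set α := √μ with hα
  set β := √ε with hβ
  have hα0 : 0 < α := Real.sqrt_pos.2 hμ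
  have hβ0 : 0 < β := Real.sqrt_pos.2 hε
  have hαμ : μ = α ^ 2 := (Real.sq_sqrt hμ.le).symm
  have hβε : ε = β ^ 2 := (Real.sq_sqrt hε.le).symm
  obtain ⟨u, v, h, k, huv, hhk, h1, h2⟩ := exists_curl_system (κ := (lam * α * β)⁻¹)
    (by positivity) (((lam * α)⁻¹ : ℂ) • (f : L2 Ω)) (((lam * β)⁻¹ : ℂ) • (g : L2 Ω))
  have eα : (α : ℂ) ≠ 0 := Complex.ofReal_ne_zero.2 hα0.ne'
  have eβ : (β : ℂ) ≠ 0 := Complex.ofReal_ne_zero.2 hβ0.ne'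
  have el : (lam : ℂ) ≠ 0 := Complex.ofReal_ne_zero.2 hl.ne'
  have hE : ((α : ℂ) • u, (α : ℂ) • v) ∈ curlZero Ω := (curlZero Ω).smul_mem (α : ℂ) huv
  have hH : IsWeakCurl ((β : ℂ) • h) ((β : ℂ) • k) := fun p hp => by
    rw [inner_smul_right, inner_smul_right, hhk p hp]
  have e1 : (lam : ℂ) • (ε : ℂ) • ((α : ℂ) • u) - (β : ℂ) • k = (ε : ℂ) • (f : L2 Ω) := by
    refine smul_sub_smul_eq_of_sub_smul_eq h1 ?_ ?_ <;>
    · rw [hβε]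
      push_cast
      field_simp
  have e2 : (lam : ℂ) • (μ : ℂ) • ((β : ℂ) • h) + (α : ℂ) • v = (μ : ℂ) • (g : L2 Ω) := by
    refine smul_add_smul_eq_of_add_smul_eq h2 ?_ ?_ <;>
    · rw [hαμ]
      push_cast
      field_simp
  have hEJ : (α : ℂ) • u ∈ J Ω :=
    mem_of_smul_smul_eq (J Ω) el (Complex.ofReal_ne_zero.2 hε.ne') f.2 hH.mem_J
      (sub_eq_iff_eq_add.1 e1)
  have hHJ : (β : ℂ) • h ∈ Jhat Ω :=
    mem_of_smul_smul_eq (Jhat Ω) el (Complex.ofReal_ne_zero.2 hμ.ne') g.2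
      ((Jhat Ω).neg_mem (mem_Jhat_of_mem_curlZero hE)) ((eq_sub_of_add_eq e2).trans
        (sub_eq_add_neg _ _))
  exact ⟨⟨_, hEJ⟩, ⟨_, hHJ⟩, _, _, hE, hH, e1, e2⟩

end WeakCurl

/-! ### Histories with values in a closed subspace -/

section Inclusion

variable {C δ : ℝ} [hC : Fact (0 < C)] [hδ : Fact (0 < δ)]
  {X : Type*} [NormedAddCommGroup X] [InnerProductSpace ℂ X] [CompleteSpace X]
  {Y : Type*} [NormedAddCommGroup Y] [NormedSpace ℂ Y] [NormedSpace ℝ Y] [IsScalarTower ℝ ℂ Y]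
  [CompleteSpace Y]

lemma ofReal_smul_eq (r : ℝ) (y : Y) : (r : ℂ) • y = r • y := algebraMap_smul ℂ r y

/-- A complex linear isometry, viewed as a real linear one for a given real structure of its
codomain. -/
def realIsometry (ι : X →ₗᵢ[ℂ] Y) : X →ₗᵢ[ℝ] Y where
  toFun := ι
  map_add' := ι.map_add
  map_smul' r x := by
    rw [← Complex.coe_smul, map_smul, ofReal_smul_eq]
    rfl
  norm_map' := ι.norm_map

lemma coe_realIsometry (ι : X →ₗᵢ[ℂ] Y) (x : X) : realIsometry ι x = ι x := rfl

lemma IsKernel.map_memory {ν : ℝ → ℝ} (hν : IsKernel C δ ν) (ι : X →ₗᵢ[ℂ] Y)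
    (η : L2w C δ X) : ι (hν.memory X η) = ∫ s in Ioi (0 : ℝ), d2 ν s • ι (η s) := by
  rw [hν.memory_apply, ← coe_realIsometry, ← LinearIsometry.integral_comp_comm]
  simp only [map_smul, coe_realIsometry]

variable (C δ X) in
/-- The constant histories. -/
def constHistory : X →L[ℂ] L2w C δ X := Lp.constL 2 (histMeasure C δ) ℂ

lemma constHistory_apply (e : X) :
    constHistory C δ X e = stepHistory C δ MeasurableSet.univ e :=
  (indicatorConstLp_univ (p := 2) (μ := histMeasure C δ) (c := e)).symm

lemma coeFn_constHistory (e : X) : constHistory C δ X e =ᵐ[histMeasure C δ] fun _ => e :=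
  Lp.coeFn_const 2 (histMeasure C δ) e

/-- The equation `v = -∂_s η + e`, `η(0) = 0` for histories in terms of the transport operator. -/
lemma exists_isHistoryDeriv_iff (ι : X →ₗᵢ[ℂ] Y) (η v : L2w C δ X) (e : X) :
    (∃ ζ : L2w C δ X, IsHistoryDeriv (fun s => ι (η s)) (fun s => ι (ζ s)) ∧
      ∀ᵐ s ∂histMeasure C δ, v s = -ζ s + e) ↔
    (η, v - constHistory C δ X e) ∈ transportGraph C δ X := by
  have h1 : ∀ ζ : L2w C δ X, (∀ᵐ s ∂histMeasure C δ, v s = -ζ s + e) ↔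
      v = -ζ + constHistory C δ X e := by
    intro ζ
    rw [Lp.ext_iff]
    refine eventually_congr ?_
    filter_upwards [Lp.coeFn_add (-ζ) (constHistory C δ X e), Lp.coeFn_neg ζ,
      coeFn_constHistory (C := C) (δ := δ) e] with s h2 h3 h4
    rw [h2, Pi.add_apply, h3, h4, Pi.neg_apply]
  rw [mem_transportGraph]
  constructor
  · rintro ⟨ζ, h2, h3⟩
    rw [(h1 ζ).1 h3, add_sub_cancel_right, map_neg,
      (isHistoryDeriv_iff (realIsometry ι) η ζ).1 h2, add_neg_cancel]
  · intro h2
    refine ⟨constHistory C δ X e - v, (isHistoryDeriv_iff (realIsometry ι) η _).2 ?_, (h1 _).2 ?_⟩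
    · rw [← neg_sub, map_neg]
      exact eq_neg_of_add_eq_zero_left h2
    · abel

/-- The damping and memory terms `c⁻¹ (-ν(0) e + ∫ ν''(s) η(s) ds)` of the field equations. -/
def IsKernel.response {ν : ℝ → ℝ} (hν : IsKernel C δ ν) (X : Type*) [NormedAddCommGroup X]
    [InnerProductSpace ℂ X] [CompleteSpace X] (c : ℝ) : X × L2w C δ X →L[ℂ] X :=
  ((c⁻¹ : ℝ) : ℂ) • (hν.memory X ∘L ContinuousLinearMap.snd ℂ X (L2w C δ X) -
    ((ν 0 : ℝ) : ℂ) • ContinuousLinearMap.fst ℂ X (L2w C δ X))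

lemma IsKernel.smul_response {ν : ℝ → ℝ} (hν : IsKernel C δ ν) {c : ℝ} (hc : 0 < c) (e : X)
    (η : L2w C δ X) :
    (c : ℂ) • hν.response X c (e, η) = hν.memory X η - (ν 0 : ℂ) • e := by
  change (c : ℂ) • ((c⁻¹ : ℝ) : ℂ) • (hν.memory X η - (ν 0 : ℂ) • e) = _
  rw [smul_smul, ← Complex.ofReal_mul, mul_inv_cancel₀ hc.ne', Complex.ofReal_one, one_smul]

/-- A field equation, read in the larger space `Y`, expresses the curl term `k` as what remains of
the time derivative after the bounded terms are subtracted. -/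
lemma IsKernel.field_equation_iff {ν : ℝ → ℝ} (hν : IsKernel C δ ν) {c : ℝ} (hc : 0 < c)
    (ι : X →ₗᵢ[ℂ] Y) (e v : X) (η : L2w C δ X) (k : Y) :
    c • ι v = -(ν 0 • ι e) + (∫ s in Ioi (0 : ℝ), d2 ν s • ι (η s)) + k ↔
      (c : ℂ) • ι (v - hν.response X c (e, η)) = k := by
  rw [map_sub, smul_sub, ← map_smul ι, ← map_smul ι, hν.smul_response hc, map_sub, map_smul,
    map_smul, hν.map_memory, ofReal_smul_eq, ofReal_smul_eq, sub_eq_iff_eq_add']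
  refine Eq.congr rfl ?_
  abel

end Inclusion

/-! ### Fields with histories -/

section Histories

variable {C δ : ℝ} [hC : Fact (0 < C)] [hδ : Fact (0 < δ)]
  {X : Type*} [NormedAddCommGroup X] [InnerProductSpace ℂ X] [CompleteSpace X]
  {S : ℝ → L2w C δ X →L[ℂ] L2w C δ X} {e : ℝ → X} {η η' : ℝ → L2w C δ X} {t : ℝ}

/-- Variation of constants for the histories. -/
lemma history_eq (hS : IsSemigroupGeneratedBy S fun x y => (x, y) ∈ transportGraph C δ X)
    (ht : 0 ≤ t) (he : ContinuousOn e (Icc 0 t)) (hη : ContinuousOn η (Icc 0 t))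
    (hd : ∀ r ∈ Ico 0 t, HasDerivWithinAt η (η' r) (Ici r) r)
    (hA : ∀ r ∈ Ico 0 t, (η r, η' r - constHistory C δ X (e r)) ∈ transportGraph C δ X) :
    η t = S t (η 0) + ∫ r in (0 : ℝ)..t, S (t - r) (constHistory C δ X (e r)) :=
  hS.duhamel ht hη ((constHistory C δ X).continuous.comp_continuousOn he) hd hA

lemma exp_integral_le {c : ℝ} (hc : 0 < c) (t : ℝ) :
    ∫ r in (0 : ℝ)..t, Real.exp (-c * r) ≤ c⁻¹ := by
  have h : ∀ r ∈ uIcc 0 t,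
      HasDerivAt (fun r => -c⁻¹ * Real.exp (-c * r)) (Real.exp (-c * r)) r := by
    intro r _
    have := (((hasDerivAt_id r).const_mul (-c)).exp).const_mul (-c⁻¹)
    refine this.congr_deriv ?_
    simp only [id]
    field_simp
  rw [intervalIntegral.integral_eq_sub_of_hasDerivAt h
    ((by fun_prop : Continuous fun r => Real.exp (-c * r)).intervalIntegrable _ _)]
  have h1 : 0 < c⁻¹ * Real.exp (-c * t) := by positivity
  simp only [mul_zero, Real.exp_zero]
  linarith

/-- By the decay of the shift semigroup, the histories are bounded by the initial history and the
supremum of the field, uniformly in time. -/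
lemma norm_history_le (hS : IsSemigroupGeneratedBy S fun x y => (x, y) ∈ transportGraph C δ X)
    (hSb : ∀ t, 0 ≤ t → ∀ x, ‖S t x‖ ≤ Real.exp (-(δ / 2) * t) * ‖x‖)
    (ht : 0 ≤ t) (he : ContinuousOn e (Icc 0 t)) (hη : ContinuousOn η (Icc 0 t))
    (hd : ∀ r ∈ Ico 0 t, HasDerivWithinAt η (η' r) (Ici r) r)
    (hA : ∀ r ∈ Ico 0 t, (η r, η' r - constHistory C δ X (e r)) ∈ transportGraph C δ X)
    {K : ℝ} (hK : ∀ r ∈ Icc 0 t, ‖e r‖ ≤ K) :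
    ‖η t‖ ≤ ‖η 0‖ + (δ / 2)⁻¹ * (‖constHistory C δ X‖ * K) := by
  have hd2 : 0 < δ / 2 := half_pos hδ.out
  have hK0 : 0 ≤ K := (norm_nonneg _).trans (hK 0 ⟨le_rfl, ht⟩)
  have hL : 0 ≤ ‖constHistory C δ X‖ * K :=
    mul_nonneg (ContinuousLinearMap.opNorm_nonneg _) hK0
  rw [history_eq hS ht he hη hd hA]
  refine (norm_add_le _ _).trans (add_le_add ?_ ?_)
  · refine (hSb t ht _).trans (mul_le_of_le_one_left (norm_nonneg _) ?_)
    rw [Real.exp_le_one_iff]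
    have := mul_nonneg hd2.le ht
    linarith
  · have h1 : ‖∫ r in (0 : ℝ)..t, S (t - r) (constHistory C δ X (e r))‖ ≤
        ∫ r in (0 : ℝ)..t, Real.exp (-(δ / 2) * (t - r)) * (‖constHistory C δ X‖ * K) := by
      refine intervalIntegral.norm_integral_le_of_norm_le ht (.of_forall fun r hr => ?_)
        ((by fun_prop : Continuous fun r => Real.exp (-(δ / 2) * (t - r)) *
          (‖constHistory C δ X‖ * K)).intervalIntegrable _ _)
      refine (hSb _ (sub_nonneg.2 hr.2) _).trans (mul_le_mul_of_nonneg_left ?_ (Real.exp_pos _).le)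
      exact ((constHistory C δ X).le_opNorm _).trans
        (mul_le_mul_of_nonneg_left (hK r ⟨hr.1.le, hr.2⟩) (ContinuousLinearMap.opNorm_nonneg _))
    refine h1.trans ?_
    rw [intervalIntegral.integral_mul_const,
      intervalIntegral.integral_comp_sub_left (fun r => Real.exp (-(δ / 2) * r)), sub_self,
      sub_zero]
    exact mul_le_mul_of_nonneg_right (exp_integral_le hd2 t) hL

/-- The memory term is the convolution of `-ν'` with the field, up to the contribution of the
initial history: the shifted constant histories `1_{(τ, ∞)} e` contribute
`∫_τ^∞ ν''(s) e ds = -ν'(τ) e`. -/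
lemma memory_history_eq {ν : ℝ → ℝ} (hν : IsKernel C δ ν)
    (hS : IsSemigroupGeneratedBy S fun x y => (x, y) ∈ transportGraph C δ X)
    (ht : 0 ≤ t) (he : ContinuousOn e (Icc 0 t)) (hη : ContinuousOn η (Icc 0 t))
    (hd : ∀ r ∈ Ico 0 t, HasDerivWithinAt η (η' r) (Ici r) r)
    (hA : ∀ r ∈ Ico 0 t, (η r, η' r - constHistory C δ X (e r)) ∈ transportGraph C δ X) :
    hν.memory X (η t) =
      hν.memory X (S t (η 0)) - ∫ r in (0 : ℝ)..t, d1 ν (t - r) • e r := by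
  have hc : ContinuousOn (fun r => S (t - r) (constHistory C δ X (e r))) (Icc 0 t) :=
    hS.continuousOn_sub ((constHistory C δ X).continuous.comp_continuousOn he)
  have hi : IntervalIntegrable (fun r => S (t - r) (constHistory C δ X (e r))) volume 0 t :=
    hc.intervalIntegrable_of_Icc ht
  have h1 := (hν.memory X).intervalIntegral_comp_comm hi
  have h2 : ∫ r in (0 : ℝ)..t, hν.memory X (S (t - r) (constHistory C δ X (e r))) =
      ∫ r in (0 : ℝ)..t, -(d1 ν (t - r) • e r) := by
    refine intervalIntegral.integral_congr fun r hr => ?_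
    rw [uIcc_of_le ht] at hr
    rw [constHistory_apply, shift_const hS (sub_nonneg.2 hr.2),
      hν.memory_stepHistory_Ioi (sub_nonneg.2 hr.2)]
  rw [history_eq hS ht he hη hd hA, map_add, sub_eq_add_neg, ← intervalIntegral.integral_neg, ← h2]
  exact congrArg _ h1.symm

/-- Passivity bounds the work done by the damping and memory terms by the initial history. -/
lemma work_le {ν : ℝ → ℝ} (hν : IsKernel C δ ν) (hp : IsPassive ν)
    (hS : IsSemigroupGeneratedBy S fun x y => (x, y) ∈ transportGraph C δ X)
    (hSb : ∀ t, 0 ≤ t → ∀ x, ‖S t x‖ ≤ Real.exp (-(δ / 2) * t) * ‖x‖)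
    (ht : 0 ≤ t) (he : ContinuousOn e (Icc 0 t)) (hη : ContinuousOn η (Icc 0 t))
    (hd : ∀ r ∈ Ico 0 t, HasDerivWithinAt η (η' r) (Ici r) r)
    (hA : ∀ r ∈ Ico 0 t, (η r, η' r - constHistory C δ X (e r)) ∈ transportGraph C δ X)
    {K : ℝ} (hK : ∀ r ∈ Icc 0 t, ‖e r‖ ≤ K) :
    ∫ r in (0 : ℝ)..t, (inner ℂ (e r) (hν.memory X (η r) - (ν 0 : ℂ) • e r)).re ≤
      (δ / 2)⁻¹ * (K * (‖hν.memory X‖ * ‖η 0‖)) := by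
  have hd2 : 0 < δ / 2 := half_pos hδ.out
  have hK0 : 0 ≤ K := (norm_nonneg _).trans (hK 0 ⟨le_rfl, ht⟩)
  have hL : 0 ≤ K * (‖hν.memory X‖ * ‖η 0‖) := by positivity
  have hsub : ∀ r ∈ Icc 0 t, Icc 0 r ⊆ Icc 0 t := fun r hr => Icc_subset_Icc_right hr.2
  have hsub' : ∀ r ∈ Icc 0 t, Ico 0 r ⊆ Ico 0 t := fun r hr => Ico_subset_Ico_right hr.2
  have hconv : ∀ r ∈ Icc 0 t, hν.memory X (η r) - (ν 0 : ℂ) • e r =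
      hν.memory X (S r (η 0)) - (ν 0 • e r + ∫ q in (0 : ℝ)..r, d1 ν (r - q) • e q) := by
    intro r hr
    rw [memory_history_eq hν hS hr.1 (he.mono (hsub r hr)) (hη.mono (hsub r hr))
      (fun q hq => hd q (hsub' r hr hq)) (fun q hq => hA q (hsub' r hr hq)), Complex.coe_smul]
    abel
  have hFc : ContinuousOn (fun r => hν.memory X (S r (η 0))) (Icc 0 t) :=
    (hν.memory X).continuous.comp_continuousOn ((hS.continuousOn _).mono Icc_subset_Ici_self)
  have hmc : ContinuousOn (fun r => hν.memory X (η r) - (ν 0 : ℂ) • e r) (Icc 0 t) :=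
    ((hν.memory X).continuous.comp_continuousOn hη).sub (continuousOn_const.smul he)
  have hgc : ContinuousOn (fun r => ν 0 • e r + ∫ q in (0 : ℝ)..r, d1 ν (r - q) • e q)
      (Icc 0 t) := by
    refine (hFc.sub hmc).congr fun r hr => ?_
    exact (sub_sub_cancel _ _).symm.trans (congrArg _ (hconv r hr).symm)
  have i1 : IntervalIntegrable (fun r => (inner ℂ (e r) (hν.memory X (S r (η 0)))).re)
      volume 0 t :=
    (Complex.continuous_re.comp_continuousOn (he.inner hFc)).intervalIntegrable_of_Icc ht
  have i2 : IntervalIntegrable (fun r => (inner ℂ (e r)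
      (ν 0 • e r + ∫ q in (0 : ℝ)..r, d1 ν (r - q) • e q)).re) volume 0 t :=
    (Complex.continuous_re.comp_continuousOn (he.inner hgc)).intervalIntegrable_of_Icc ht
  have h1 : ∫ r in (0 : ℝ)..t, (inner ℂ (e r) (hν.memory X (η r) - (ν 0 : ℂ) • e r)).re =
      (∫ r in (0 : ℝ)..t, (inner ℂ (e r) (hν.memory X (S r (η 0)))).re) -
      ∫ r in (0 : ℝ)..t, (inner ℂ (e r)
        (ν 0 • e r + ∫ q in (0 : ℝ)..r, d1 ν (r - q) • e q)).re := by
    rw [← intervalIntegral.integral_sub i1 i2]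
    refine intervalIntegral.integral_congr fun r hr => ?_
    rw [uIcc_of_le ht] at hr
    rw [hconv r hr, inner_sub_right, Complex.sub_re]
  have h2 := hp.intervalIntegral_nonneg hν ht he
  have h3 : ∫ r in (0 : ℝ)..t, (inner ℂ (e r) (hν.memory X (S r (η 0)))).re ≤
      ∫ r in (0 : ℝ)..t, Real.exp (-(δ / 2) * r) * (K * (‖hν.memory X‖ * ‖η 0‖)) := by
    refine intervalIntegral.integral_mono_on ht i1
      ((by fun_prop : Continuous fun r => Real.exp (-(δ / 2) * r) *
        (K * (‖hν.memory X‖ * ‖η 0‖))).intervalIntegrable _ _) fun r hr => ?_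
    calc (inner ℂ (e r) (hν.memory X (S r (η 0)))).re
        ≤ ‖e r‖ * ‖hν.memory X (S r (η 0))‖ := re_inner_le_norm_mul _ _
      _ ≤ K * (‖hν.memory X‖ * (Real.exp (-(δ / 2) * r) * ‖η 0‖)) := by
          refine mul_le_mul (hK r hr) ?_ (norm_nonneg _) hK0
          exact ((hν.memory X).le_opNorm _).trans
            (mul_le_mul_of_nonneg_left (hSb r hr.1 _) (ContinuousLinearMap.opNorm_nonneg _))
      _ = _ := by ring
  rw [intervalIntegral.integral_mul_const] at h3
  have h4 := mul_le_mul_of_nonneg_right (exp_integral_le hd2 t) hL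
  linarith

end Histories

/-! ### The abstract evolution problem -/

/-- Two relations `G ⊆ X × Z` and `G' ⊆ Z × X` which are formally adjoint to each other, such that
the skew block operator formed from them is m-dissipative: the properties of the curl on
`H₀(curl, Ω)` and on `H(curl, Ω)` that are used below. -/
structure IsCurlPair {X Z : Type*} [NormedAddCommGroup X] [InnerProductSpace ℂ X]
    [NormedAddCommGroup Z] [InnerProductSpace ℂ Z] (ε μ : ℝ) (G : Submodule ℂ (X × Z))
    (G' : Submodule ℂ (Z × X)) : Prop where
  inner_eq : ∀ p ∈ G, ∀ q ∈ G', inner ℂ p.2 q.1 = inner ℂ p.1 q.2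
  exists_resolvent : ∀ lam : ℝ, 0 < lam → ∀ (f : X) (g : Z), ∃ p ∈ G, ∃ q ∈ G',
    (lam : ℂ) • (ε : ℂ) • p.1 - q.2 = (ε : ℂ) • f ∧ (lam : ℂ) • (μ : ℂ) • q.1 + p.2 = (μ : ℂ) • g
  eq_zero : ∀ z, ((0 : X), z) ∈ G → z = 0
  eq_zero' : ∀ x, ((0 : Z), x) ∈ G' → x = 0

/-- A Hilbert space `S` whose elements are the states `(E, H, ηE, ηH)` with fields `E` in `X` and
`H` in `Z`, the fields being weighted by `ε` and `μ` in the inner product. -/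
structure StateModel (X Z S : Type*) [NormedAddCommGroup X] [InnerProductSpace ℂ X]
    [NormedAddCommGroup Z] [InnerProductSpace ℂ Z] [NormedAddCommGroup S] [InnerProductSpace ℂ S]
    (C δ ε μ : ℝ) where
  toProd : S ≃ₗ[ℂ] X × Z × L2w C δ X × L2w C δ Z
  inner_eq : ∀ U V, inner ℂ U V = (ε : ℂ) * inner ℂ (toProd U).1 (toProd V).1 +
    (μ : ℂ) * inner ℂ (toProd U).2.1 (toProd V).2.1 +
    inner ℂ (toProd U).2.2.1 (toProd V).2.2.1 + inner ℂ (toProd U).2.2.2 (toProd V).2.2.2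

namespace StateModel

variable {X Z S : Type*} [NormedAddCommGroup X] [InnerProductSpace ℂ X] [CompleteSpace X]
  [NormedAddCommGroup Z] [InnerProductSpace ℂ Z] [CompleteSpace Z]
  [NormedAddCommGroup S] [InnerProductSpace ℂ S] {C δ ε μ : ℝ}
  [hε : Fact (0 < ε)] [hμ : Fact (0 < μ)] (m : StateModel X Z S C δ ε μ)

lemma norm_sq_eq (U : S) : ‖U‖ ^ 2 = ε * ‖(m.toProd U).1‖ ^ 2 + μ * ‖(m.toProd U).2.1‖ ^ 2 +
    ‖(m.toProd U).2.2.1‖ ^ 2 + ‖(m.toProd U).2.2.2‖ ^ 2 := by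
  rw [norm_sq_eq_re_inner (𝕜 := ℂ) U, norm_sq_eq_re_inner (𝕜 := ℂ) (m.toProd U).1,
    norm_sq_eq_re_inner (𝕜 := ℂ) (m.toProd U).2.1, norm_sq_eq_re_inner (𝕜 := ℂ) (m.toProd U).2.2.1,
    norm_sq_eq_re_inner (𝕜 := ℂ) (m.toProd U).2.2.2, m.inner_eq]
  simp only [RCLike.re_to_complex, Complex.add_re, Complex.re_ofReal_mul]

lemma norm_le_of_sq_le {a b c : ℝ} (ha : 0 ≤ a) (hc : 0 ≤ c) (h : b ^ 2 ≤ c * a ^ 2) :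
    b ≤ √c * a := by
  rw [← Real.sqrt_sq ha, ← Real.sqrt_mul hc]
  exact Real.le_sqrt_of_sq_le h

lemma norm_toProd_le (U : S) : ‖m.toProd U‖ ≤ √(ε⁻¹ + μ⁻¹ + 1) * ‖U‖ := by
  have h := m.norm_sq_eq U
  have h1 := sq_nonneg ‖(m.toProd U).1‖
  have h2 := sq_nonneg ‖(m.toProd U).2.1‖
  have h3 := sq_nonneg ‖(m.toProd U).2.2.1‖
  have h4 := sq_nonneg ‖(m.toProd U).2.2.2‖
  have hε' := hε.out
  have hμ' := hμ.out
  have n1 := mul_nonneg hε'.le h1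
  have n2 := mul_nonneg hμ'.le h2
  have k1 : 0 ≤ ε⁻¹ * ‖U‖ ^ 2 := by positivity
  have k2 : 0 ≤ μ⁻¹ * ‖U‖ ^ 2 := by positivity
  have m1 : ‖(m.toProd U).1‖ ^ 2 ≤ ε⁻¹ * ‖U‖ ^ 2 := by
    rw [le_inv_mul_iff₀ hε']
    linarith
  have m2 : ‖(m.toProd U).2.1‖ ^ 2 ≤ μ⁻¹ * ‖U‖ ^ 2 := by
    rw [le_inv_mul_iff₀ hμ']
    linarith
  have hc : 0 ≤ ε⁻¹ + μ⁻¹ + 1 := by positivity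
  refine max_le ?_ (max_le ?_ (max_le ?_ ?_)) <;>
    refine norm_le_of_sq_le (norm_nonneg _) hc ?_ <;> linarith

lemma norm_toProd_symm_le (p : X × Z × L2w C δ X × L2w C δ Z) :
    ‖m.toProd.symm p‖ ≤ √(ε + μ + 2) * ‖p‖ := by
  have hε' := hε.out
  have hμ' := hμ.out
  refine norm_le_of_sq_le (norm_nonneg _) (by positivity) ?_
  rw [m.norm_sq_eq, LinearEquiv.apply_symm_apply]
  have h1 : ‖p.1‖ ^ 2 ≤ ‖p‖ ^ 2 := by gcongr; exact norm_fst_le p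
  have h2 : ‖p.2.1‖ ^ 2 ≤ ‖p‖ ^ 2 := by
    gcongr; exact (norm_fst_le p.2).trans (norm_snd_le p)
  have h3 : ‖p.2.2.1‖ ^ 2 ≤ ‖p‖ ^ 2 := by
    gcongr; exact ((norm_fst_le p.2.2).trans (norm_snd_le p.2)).trans (norm_snd_le p)
  have h4 : ‖p.2.2.2‖ ^ 2 ≤ ‖p‖ ^ 2 := by
    gcongr; exact ((norm_snd_le p.2.2).trans (norm_snd_le p.2)).trans (norm_snd_le p)
  have k1 := mul_le_mul_of_nonneg_left h1 hε'.le
  have k2 := mul_le_mul_of_nonneg_left h2 hμ'.le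
  linarith

/-- The norm of the state space is equivalent to the maximum norm of the components. -/
def prodEquiv : S ≃L[ℂ] X × Z × L2w C δ X × L2w C δ Z :=
  m.toProd.toContinuousLinearEquivOfBounds _ _ m.norm_toProd_le m.norm_toProd_symm_le

lemma completeSpace (m : StateModel X Z S C δ ε μ) : CompleteSpace S :=
  (completeSpace_congr (e := m.prodEquiv.toEquiv) m.prodEquiv.isUniformEmbedding).2 inferInstance

/-- The electric field. -/
def projE : S →L[ℂ] X := ContinuousLinearMap.fst ℂ _ _ ∘L m.prodEquiv.toContinuousLinearMap

/-- The magnetic field. -/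
def projH : S →L[ℂ] Z :=
  ContinuousLinearMap.fst ℂ _ _ ∘L ContinuousLinearMap.snd ℂ _ _ ∘L
    m.prodEquiv.toContinuousLinearMap

/-- The electric history. -/
def histE : S →L[ℂ] L2w C δ X :=
  ContinuousLinearMap.fst ℂ _ _ ∘L ContinuousLinearMap.snd ℂ _ _ ∘L
    ContinuousLinearMap.snd ℂ _ _ ∘L m.prodEquiv.toContinuousLinearMap

/-- The magnetic history. -/
def histH : S →L[ℂ] L2w C δ Z :=
  ContinuousLinearMap.snd ℂ _ _ ∘L ContinuousLinearMap.snd ℂ _ _ ∘L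
    ContinuousLinearMap.snd ℂ _ _ ∘L m.prodEquiv.toContinuousLinearMap

/-- The state with given components. -/
def mk' (x : X) (z : Z) (ηE : L2w C δ X) (ηH : L2w C δ Z) : S := m.prodEquiv.symm (x, z, ηE, ηH)

section mk'

variable (x : X) (z : Z) (ηE : L2w C δ X) (ηH : L2w C δ Z)

lemma prodEquiv_mk' : m.prodEquiv (m.mk' x z ηE ηH) = (x, z, ηE, ηH) :=
  m.prodEquiv.apply_symm_apply _

lemma projE_mk' : m.projE (m.mk' x z ηE ηH) = x :=
  congrArg (fun p => p.1) (m.prodEquiv_mk' x z ηE ηH)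

lemma projH_mk' : m.projH (m.mk' x z ηE ηH) = z :=
  congrArg (fun p => p.2.1) (m.prodEquiv_mk' x z ηE ηH)

lemma histE_mk' : m.histE (m.mk' x z ηE ηH) = ηE :=
  congrArg (fun p => p.2.2.1) (m.prodEquiv_mk' x z ηE ηH)

lemma histH_mk' : m.histH (m.mk' x z ηE ηH) = ηH :=
  congrArg (fun p => p.2.2.2) (m.prodEquiv_mk' x z ηE ηH)

end mk'

lemma eq_of_components {U V : S} (h1 : m.projE U = m.projE V) (h2 : m.projH U = m.projH V)
    (h3 : m.histE U = m.histE V) (h4 : m.histH U = m.histH V) : U = V :=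
  m.prodEquiv.injective (Prod.ext h1 (Prod.ext h2 (Prod.ext h3 h4)))

lemma inner_def (U V : S) : inner ℂ U V = (ε : ℂ) * inner ℂ (m.projE U) (m.projE V) +
    (μ : ℂ) * inner ℂ (m.projH U) (m.projH V) + inner ℂ (m.histE U) (m.histE V) +
    inner ℂ (m.histH U) (m.histH V) := m.inner_eq U V

lemma norm_sq_def (U : S) : ‖U‖ ^ 2 = ε * ‖m.projE U‖ ^ 2 + μ * ‖m.projH U‖ ^ 2 +
    ‖m.histE U‖ ^ 2 + ‖m.histH U‖ ^ 2 := m.norm_sq_eq U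

variable [hC : Fact (0 < C)] [hδ : Fact (0 < δ)]

/-- The graph of the skew part of the evolution operator, `(E, H, ηE, ηH) ↦
(ε⁻¹ curl H, -μ⁻¹ curl E, -∂_s ηE, -∂_s ηH)`. -/
def skewGraph (G : Submodule ℂ (X × Z)) (G' : Submodule ℂ (Z × X)) : Submodule ℂ (S × S) where
  carrier := {p | (m.projE p.1, -((μ : ℂ) • m.projH p.2)) ∈ G ∧
    (m.projH p.1, (ε : ℂ) • m.projE p.2) ∈ G' ∧
    (m.histE p.1, m.histE p.2) ∈ transportGraph C δ X ∧
    (m.histH p.1, m.histH p.2) ∈ transportGraph C δ Z}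
  add_mem' := by
    rintro p q ⟨h1, h2, h3, h4⟩ ⟨k1, k2, k3, k4⟩
    refine ⟨?_, ?_, ?_, ?_⟩
    · convert G.add_mem h1 k1 using 1
      simp [smul_add, add_comm]
    · convert G'.add_mem h2 k2 using 1
      simp [smul_add]
    · convert (transportGraph C δ X).add_mem h3 k3 using 1
      simp
    · convert (transportGraph C δ Z).add_mem h4 k4 using 1
      simp
  zero_mem' := by
    refine ⟨?_, ?_, ?_, ?_⟩
    · convert G.zero_mem using 1
      simp
    · convert G'.zero_mem using 1
      simp
    · convert (transportGraph C δ X).zero_mem using 1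
      simp
    · convert (transportGraph C δ Z).zero_mem using 1
      simp
  smul_mem' := by
    rintro c p ⟨h1, h2, h3, h4⟩
    refine ⟨?_, ?_, ?_, ?_⟩
    · convert G.smul_mem c h1 using 1
      simp [smul_comm c]
    · convert G'.smul_mem c h2 using 1
      simp [smul_comm c]
    · convert (transportGraph C δ X).smul_mem c h3 using 1
      simp
    · convert (transportGraph C δ Z).smul_mem c h4 using 1
      simp

variable {G : Submodule ℂ (X × Z)} {G' : Submodule ℂ (Z × X)}

lemma mem_skewGraph {p : S × S} : p ∈ m.skewGraph G G' ↔
    (m.projE p.1, -((μ : ℂ) • m.projH p.2)) ∈ G ∧ (m.projH p.1, (ε : ℂ) • m.projE p.2) ∈ G' ∧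
    (m.histE p.1, m.histE p.2) ∈ transportGraph C δ X ∧
    (m.histH p.1, m.histH p.2) ∈ transportGraph C δ Z := Iff.rfl

/-- The curl terms do no work. -/
lemma re_inner_curl_eq_zero (hG : IsCurlPair ε μ G G') {x x' : X} {z z' : Z}
    (h1 : (x, -((μ : ℂ) • z')) ∈ G) (h2 : (z, (ε : ℂ) • x') ∈ G') :
    ε * (inner ℂ x x').re + μ * (inner ℂ z z').re = 0 := by
  have h := congrArg Complex.re (hG.inner_eq _ h1 _ h2)
  simp only [inner_neg_left, inner_smul_left, inner_smul_right, Complex.conj_ofReal,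
    Complex.neg_re, Complex.re_ofReal_mul] at h
  have h3 : (inner ℂ z' z).re = (inner ℂ z z').re := inner_re_symm (𝕜 := ℂ) z' z
  rw [h3] at h
  linarith

/-- The skew part is maximal dissipative componentwise: the curl block does no work, and the
transport operators are dissipative. -/
lemma isMaxDissipative_skewGraph (hG : IsCurlPair ε μ G G') :
    IsMaxDissipative 0 (m.skewGraph G G') := by
  have hd : 0 < δ / 2 := half_pos hδ.out
  refine ⟨fun p hp => ?_, fun lam hl f => ?_, fun y hy => ?_⟩
  · obtain ⟨h1, h2, h3, h4⟩ := m.mem_skewGraph.1 hp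
    have k := re_inner_curl_eq_zero hG h1 h2
    have k3 := isMaxDissipative_transportGraph.re_inner_le _ h3
    have k4 := isMaxDissipative_transportGraph.re_inner_le _ h4
    have n3 := mul_nonneg hd.le (sq_nonneg ‖m.histE p.1‖)
    have n4 := mul_nonneg hd.le (sq_nonneg ‖m.histH p.1‖)
    rw [m.inner_def]
    simp only [Complex.add_re, Complex.re_ofReal_mul] at k3 k4 ⊢
    linarith
  · obtain ⟨p, hp, q, hq, h1, h2⟩ := hG.exists_resolvent lam hl (m.projE f) (m.projH f)
    obtain ⟨r, hr, h3⟩ := isMaxDissipative_transportGraph.exists_sub_eq lam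
      (by linarith) (m.histE f)
    obtain ⟨s, hs, h4⟩ := isMaxDissipative_transportGraph.exists_sub_eq lam
      (by linarith) (m.histH f)
    have hε' : (ε : ℂ) ≠ 0 := Complex.ofReal_ne_zero.2 hε.out.ne'
    have hμ' : (μ : ℂ) ≠ 0 := Complex.ofReal_ne_zero.2 hμ.out.ne'
    refine ⟨(m.mk' p.1 q.1 r.1 s.1,
      m.mk' ((ε : ℂ)⁻¹ • q.2) (-((μ : ℂ)⁻¹ • p.2)) r.2 s.2), ?_, ?_⟩
    · rw [mem_skewGraph]
      simp only [projE_mk', projH_mk', histE_mk', histH_mk', smul_neg, smul_smul,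
        mul_inv_cancel₀ hε', mul_inv_cancel₀ hμ', one_smul, neg_neg]
      exact ⟨hp, hq, hr, hs⟩
    · refine m.eq_of_components ?_ ?_ ?_ ?_
      · simp only [map_sub, map_smul, projE_mk']
        refine smul_right_injective X hε' ?_
        simp only
        rw [smul_sub, smul_smul _ _ q.2, mul_inv_cancel₀ hε', one_smul, ← h1, smul_comm]
      · simp only [map_sub, map_smul, projH_mk']
        refine smul_right_injective Z hμ' ?_
        simp only
        rw [sub_neg_eq_add, smul_add, smul_smul _ _ p.2, mul_inv_cancel₀ hμ', one_smul, ← h2,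
          smul_comm]
      · simp only [map_sub, map_smul, histE_mk']
        exact h3
      · simp only [map_sub, map_smul, histH_mk']
        exact h4
  · obtain ⟨h1, h2, h3, h4⟩ := m.mem_skewGraph.1 hy
    simp only [map_zero] at h1 h2 h3 h4
    refine m.eq_of_components ?_ ?_ ?_ ?_
    · rw [map_zero]
      exact (smul_eq_zero_iff_right (Complex.ofReal_ne_zero.2 hε.out.ne')).1 (hG.eq_zero' _ h2)
    · rw [map_zero]
      exact (smul_eq_zero_iff_right (Complex.ofReal_ne_zero.2 hμ.out.ne')).1
        (neg_eq_zero.1 (hG.eq_zero _ h1))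
    · rw [map_zero]
      exact isMaxDissipative_transportGraph.eq_zero _ h3
    · rw [map_zero]
      exact isMaxDissipative_transportGraph.eq_zero _ h4

variable {νE νH : ℝ → ℝ} (hνE : IsKernel C δ νE) (hνH : IsKernel C δ νH)

/-- The bounded part of the evolution operator: the damping, the memory terms, and the coupling of
the histories to the fields. -/
def coupling : S →L[ℂ] S :=
  m.prodEquiv.symm.toContinuousLinearMap ∘L
    ((hνE.response X ε ∘L m.projE.prod m.histE).prod
      ((hνH.response Z μ ∘L m.projH.prod m.histH).prod
        ((constHistory C δ X ∘L m.projE).prod (constHistory C δ Z ∘L m.projH))))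

lemma coupling_eq (U : S) : m.coupling hνE hνH U = m.mk'
    (hνE.response X ε (m.projE U, m.histE U)) (hνH.response Z μ (m.projH U, m.histH U))
    (constHistory C δ X (m.projE U)) (constHistory C δ Z (m.projH U)) := rfl

lemma projE_coupling (U : S) :
    m.projE (m.coupling hνE hνH U) = hνE.response X ε (m.projE U, m.histE U) := by
  rw [coupling_eq, projE_mk']

lemma projH_coupling (U : S) :
    m.projH (m.coupling hνE hνH U) = hνH.response Z μ (m.projH U, m.histH U) := by
  rw [coupling_eq, projH_mk']

lemma histE_coupling (U : S) :
    m.histE (m.coupling hνE hνH U) = constHistory C δ X (m.projE U) := by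
  rw [coupling_eq, histE_mk']

lemma histH_coupling (U : S) :
    m.histH (m.coupling hνE hνH U) = constHistory C δ Z (m.projH U) := by
  rw [coupling_eq, histH_mk']

end StateModel

/-! ### Uniform boundedness -/

lemma hasDerivWithinAt_norm_sq {X : Type*} [NormedAddCommGroup X] [InnerProductSpace ℂ X]
    {f : ℝ → X} {f' : X} {s : Set ℝ} {r : ℝ} (h : HasDerivWithinAt f f' s r) :
    HasDerivWithinAt (fun r => ‖f r‖ ^ 2) (2 * (inner ℂ (f r) f').re) s r := by
  have h1 := Complex.reCLM.hasFDerivAt.comp_hasDerivWithinAt r (h.inner ℂ h)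
  have h2 : (fun r => ‖f r‖ ^ 2) = Complex.reCLM ∘ fun r => inner ℂ (f r) (f r) := by
    ext r
    exact norm_sq_eq_re_inner (𝕜 := ℂ) (f r)
  rw [h2]
  refine h1.congr_deriv ?_
  have h3 : (inner ℂ f' (f r)).re = (inner ℂ (f r) f').re := inner_re_symm (𝕜 := ℂ) _ _
  rw [Complex.reCLM_apply, Complex.add_re, h3]
  ring

lemma hasDerivWithinAt_clm_comp {X Y : Type*} [NormedAddCommGroup X] [NormedSpace ℂ X]
    [NormedAddCommGroup Y] [NormedSpace ℂ Y] (L : X →L[ℂ] Y) {f : ℝ → X} {f' : X} {s : Set ℝ}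
    {r : ℝ} (h : HasDerivWithinAt f f' s r) :
    HasDerivWithinAt (fun r => L (f r)) (L f') s r :=
  (L.restrictScalars ℝ).hasFDerivAt.comp_hasDerivWithinAt r h

/-- Absorption of the linear term. -/
lemma le_of_sq_le_add {a c N : ℝ} (hN : 0 ≤ N) (hc : 0 ≤ c) (h : a ^ 2 ≤ N ^ 2 + c * a * N) :
    a ≤ (1 + c) * N := by
  by_contra! hlt
  have h0 : 0 < a := (mul_nonneg (by linarith) hN).trans_lt hlt
  have h1 : N ≤ a := (le_mul_of_one_le_left hN (by linarith)).trans hlt.le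
  nlinarith [mul_pos h0 (sub_pos.2 hlt), mul_nonneg hN (sub_nonneg.2 h1)]

namespace StateModel

variable {X Z S : Type*} [NormedAddCommGroup X] [InnerProductSpace ℂ X] [CompleteSpace X]
  [NormedAddCommGroup Z] [InnerProductSpace ℂ Z] [CompleteSpace Z]
  [NormedAddCommGroup S] [InnerProductSpace ℂ S] {C δ ε μ : ℝ}
  [hε : Fact (0 < ε)] [hμ : Fact (0 < μ)] (m : StateModel X Z S C δ ε μ)
  [hC : Fact (0 < C)] [hδ : Fact (0 < δ)]
  {G : Submodule ℂ (X × Z)} {G' : Submodule ℂ (Z × X)}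
  {νE νH : ℝ → ℝ} (hνE : IsKernel C δ νE) (hνH : IsKernel C δ νH)

/-- The power balance of the fields. -/
lemma re_inner_add_re_inner_eq (hG : IsCurlPair ε μ G G') {U V : S}
    (h : (U, V - m.coupling hνE hνH U) ∈ m.skewGraph G G') :
    ε * (2 * (inner ℂ (m.projE U) (m.projE V)).re) + μ * (2 * (inner ℂ (m.projH U) (m.projH V)).re)
      = 2 * (inner ℂ (m.projE U) (hνE.memory X (m.histE U) - (νE 0 : ℂ) • m.projE U)).re +
        2 * (inner ℂ (m.projH U) (hνH.memory Z (m.histH U) - (νH 0 : ℂ) • m.projH U)).re := by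
  obtain ⟨h1, h2, -, -⟩ := m.mem_skewGraph.1 h
  have h3 := re_inner_curl_eq_zero hG h1 h2
  rw [← hνE.smul_response hε.out, ← hνH.smul_response hμ.out, inner_smul_right, inner_smul_right,
    Complex.re_ofReal_mul, Complex.re_ofReal_mul]
  rw [map_sub, map_sub, projE_coupling, projH_coupling, inner_sub_right, inner_sub_right,
    Complex.sub_re, Complex.sub_re] at h3
  linarith

/-- A uniform bound for the trajectories in the domain of the generator. The energy balance is used
up to the time `τ` in `[0, t]` at which the field energy `W` is largest: there the work is at most
`c √(W τ) ‖x‖`, so that `W τ ≤ ‖x‖² + c √(W τ) ‖x‖`, which bounds the fields on all of `[0, t]` by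
a constant that does not depend on `t`. -/
lemma exists_norm_apply_le (hG : IsCurlPair ε μ G G') (hpE : IsPassive νE) (hpH : IsPassive νH)
    {T : ℝ → S →L[ℂ] S} (hT : IsSemigroupGeneratedBy T fun U V =>
      (U, V - m.coupling hνE hνH U) ∈ m.skewGraph G G') :
    ∃ M : ℝ, 0 < M ∧ ∀ x y, (x, y - m.coupling hνE hνH x) ∈ m.skewGraph G G' →
      ∀ t, 0 ≤ t → ‖T t x‖ ≤ M * ‖x‖ := by
  have := m.completeSpace
  obtain ⟨SE, hSE, hSEb⟩ := (isMaxDissipative_transportGraph (C := C) (δ := δ)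
    (X := X)).exists_semigroup
  obtain ⟨SH, hSH, hSHb⟩ := (isMaxDissipative_transportGraph (C := C) (δ := δ)
    (X := Z)).exists_semigroup
  set a : ℝ := (√ε)⁻¹ with ha
  set b : ℝ := (√μ)⁻¹ with hb
  set d : ℝ := (δ / 2)⁻¹ with hd
  have hε0 := hε.out
  have hμ0 := hμ.out
  have hδ0 := hδ.out
  have ha0 : 0 ≤ a := by positivity
  have hb0 : 0 ≤ b := by positivity
  have hd0 : 0 ≤ d := by positivity
  set mE : ℝ := ‖hνE.memory X‖ with hmE
  set mH : ℝ := ‖hνH.memory Z‖ with hmH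
  set kE : ℝ := ‖constHistory C δ X‖ with hkE
  set kH : ℝ := ‖constHistory C δ Z‖ with hkH
  have hmE0 : 0 ≤ mE := ContinuousLinearMap.opNorm_nonneg _
  have hmH0 : 0 ≤ mH := ContinuousLinearMap.opNorm_nonneg _
  have hkE0 : 0 ≤ kE := ContinuousLinearMap.opNorm_nonneg _
  have hkH0 : 0 ≤ kH := ContinuousLinearMap.opNorm_nonneg _
  set c : ℝ := 2 * d * (a * mE + b * mH) with hc
  have hc0 : 0 ≤ c := by positivity
  set k : ℝ := 1 + d * (kE * a) + d * (kH * b) with hk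
  have hk0 : 0 < k := by positivity
  refine ⟨k * (1 + c) + 2, by positivity, fun x y hxy t ht => ?_⟩
  -- The trajectory and its components.
  have hucont := hT.continuousOn x
  have hder : ∀ r, 0 ≤ r → HasDerivWithinAt (fun r => T r x) (T r y) (Ici r) r :=
    fun r hr => hT.hasDerivWithinAt hxy hr
  have hmem : ∀ r, 0 ≤ r → (T r x, T r y - m.coupling hνE hνH (T r x)) ∈ m.skewGraph G G' :=
    fun r hr => hT.graph_apply hxy hr
  have hT0 : T 0 x = x := by rw [hT.zero]; rfl
  have hcE := m.projE.continuous.comp_continuousOn hucont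
  have hcH := m.projH.continuous.comp_continuousOn hucont
  have hcηE := m.histE.continuous.comp_continuousOn hucont
  have hcηH := m.histH.continuous.comp_continuousOn hucont
  have hAE : ∀ r, 0 ≤ r → (m.histE (T r x), m.histE (T r y) -
      constHistory C δ X (m.projE (T r x))) ∈ transportGraph C δ X := fun r hr => by
    rw [← m.histE_coupling hνE hνH, ← map_sub]
    exact (m.mem_skewGraph.1 (hmem r hr)).2.2.1
  have hAH : ∀ r, 0 ≤ r → (m.histH (T r x), m.histH (T r y) -
      constHistory C δ Z (m.projH (T r x))) ∈ transportGraph C δ Z := fun r hr => by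
    rw [← m.histH_coupling hνE hνH, ← map_sub]
    exact (m.mem_skewGraph.1 (hmem r hr)).2.2.2
  have hdηE := fun r hr => hasDerivWithinAt_clm_comp m.histE (hder r hr)
  have hdηH := fun r hr => hasDerivWithinAt_clm_comp m.histH (hder r hr)
  have hdE := fun r hr => hasDerivWithinAt_clm_comp m.projE (hder r hr)
  have hdH := fun r hr => hasDerivWithinAt_clm_comp m.projH (hder r hr)
  -- The energy of the fields, and the time at which it is maximal on `[0, t]`.
  set W : ℝ → ℝ := fun r => ε * ‖m.projE (T r x)‖ ^ 2 + μ * ‖m.projH (T r x)‖ ^ 2 with hW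
  have hWc : ContinuousOn W (Ici 0) :=
    (continuousOn_const.mul (hcE.norm.pow 2)).add (continuousOn_const.mul (hcH.norm.pow 2))
  have hW0 : ∀ r, 0 ≤ W r := fun r => by positivity
  obtain ⟨τ, hτ, hmax⟩ := isCompact_Icc.exists_isMaxOn (nonempty_Icc.2 ht)
    (hWc.mono Icc_subset_Ici_self)
  set w : ℝ := √(W τ) with hw
  have hw0 : 0 ≤ w := Real.sqrt_nonneg _
  have hwsq : w ^ 2 = W τ := Real.sq_sqrt (hW0 τ)
  have hWle : ∀ r ∈ Icc 0 t, W r ≤ w ^ 2 := fun r hr => (hmax hr).trans_eq hwsq.symm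
  have hKE : ∀ r ∈ Icc 0 t, ‖m.projE (T r x)‖ ≤ a * w := fun r hr => by
    have h1 : ε * ‖m.projE (T r x)‖ ^ 2 ≤ w ^ 2 :=
      le_trans (le_add_of_nonneg_right (by positivity)) (hWle r hr)
    rw [ha, le_inv_mul_iff₀ (Real.sqrt_pos.2 hε0)]
    refine (abs_le_of_sq_le_sq' ?_ hw0).2
    rwa [mul_pow, Real.sq_sqrt hε0.le]
  have hKH : ∀ r ∈ Icc 0 t, ‖m.projH (T r x)‖ ≤ b * w := fun r hr => by
    have h1 : μ * ‖m.projH (T r x)‖ ^ 2 ≤ w ^ 2 :=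
      le_trans (le_add_of_nonneg_left (by positivity)) (hWle r hr)
    rw [hb, le_inv_mul_iff₀ (Real.sqrt_pos.2 hμ0)]
    refine (abs_le_of_sq_le_sq' ?_ hw0).2
    rwa [mul_pow, Real.sq_sqrt hμ0.le]
  have hnorm : ∀ r, ‖T r x‖ ^ 2 = W r + ‖m.histE (T r x)‖ ^ 2 + ‖m.histH (T r x)‖ ^ 2 :=
    fun r => m.norm_sq_def _
  have hx := hnorm 0
  rw [hT0] at hx
  have hηE0 : ‖m.histE x‖ ≤ ‖x‖ := by
    refine (abs_le_of_sq_le_sq' ?_ (norm_nonneg _)).2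
    have := hW0 0
    have := sq_nonneg ‖m.histH x‖
    linarith
  have hηH0 : ‖m.histH x‖ ≤ ‖x‖ := by
    refine (abs_le_of_sq_le_sq' ?_ (norm_nonneg _)).2
    have := hW0 0
    have := sq_nonneg ‖m.histE x‖
    linarith
  -- The energy balance on `[0, τ]`.
  have hsub : Icc 0 τ ⊆ Ici 0 := Icc_subset_Ici_self
  have hτt : Icc 0 τ ⊆ Icc 0 t := Icc_subset_Icc_right hτ.2
  set PE : ℝ → ℝ := fun r => (inner ℂ (m.projE (T r x)) (hνE.memory X (m.histE (T r x)) -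
    (νE 0 : ℂ) • m.projE (T r x))).re with hPE
  set PH : ℝ → ℝ := fun r => (inner ℂ (m.projH (T r x)) (hνH.memory Z (m.histH (T r x)) -
    (νH 0 : ℂ) • m.projH (T r x))).re with hPH
  have hPEc : ContinuousOn PE (Icc 0 τ) :=
    (Complex.continuous_re.comp_continuousOn
      (hcE.inner (((hνE.memory X).continuous.comp_continuousOn hcηE).sub
        (continuousOn_const.smul hcE)))).mono hsub
  have hPHc : ContinuousOn PH (Icc 0 τ) :=
    (Complex.continuous_re.comp_continuousOn
      (hcH.inner (((hνH.memory Z).continuous.comp_continuousOn hcηH).sub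
        (continuousOn_const.smul hcH)))).mono hsub
  have hbal := eq_add_integral_of_right_deriv hτ.1 (hWc.mono hsub)
    (((continuousOn_const (c := (2 : ℝ))).mul hPEc).add
      ((continuousOn_const (c := (2 : ℝ))).mul hPHc))
    (fun r hr => ((((hasDerivWithinAt_norm_sq (hdE r hr.1)).const_mul ε).add
      ((hasDerivWithinAt_norm_sq (hdH r hr.1)).const_mul μ)).congr_deriv
      (m.re_inner_add_re_inner_eq hνE hνH hG (hmem r hr.1))))
  have hbal2 : W τ = W 0 + (2 * (∫ r in (0 : ℝ)..τ, PE r) + 2 * ∫ r in (0 : ℝ)..τ, PH r) := by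
    rw [← intervalIntegral.integral_const_mul, ← intervalIntegral.integral_const_mul,
      ← intervalIntegral.integral_add ((hPEc.intervalIntegrable_of_Icc hτ.1).const_mul 2)
        ((hPHc.intervalIntegrable_of_Icc hτ.1).const_mul 2)]
    exact hbal
  have hwE := work_le hνE hpE hSE hSEb hτ.1 (hcE.mono hsub) (hcηE.mono hsub)
    (fun r hr => hdηE r hr.1) (fun r hr => hAE r hr.1) (fun r hr => hKE r (hτt hr))
  have hwH := work_le hνH hpH hSH hSHb hτ.1 (hcH.mono hsub) (hcηH.mono hsub)
    (fun r hr => hdηH r hr.1) (fun r hr => hAH r hr.1) (fun r hr => hKH r (hτt hr))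
  have hwx : w ≤ (1 + c) * ‖x‖ := by
    refine le_of_sq_le_add (norm_nonneg _) hc0 ?_
    have h1 : W 0 ≤ ‖x‖ ^ 2 := by
      have := sq_nonneg ‖m.histE x‖
      have := sq_nonneg ‖m.histH x‖
      linarith
    have h2 : d * (a * w * (mE * ‖m.histE (T 0 x)‖)) ≤ d * (a * w * (mE * ‖x‖)) := by
      rw [hT0]; gcongr
    have h3 : d * (b * w * (mH * ‖m.histH (T 0 x)‖)) ≤ d * (b * w * (mH * ‖x‖)) := by
      rw [hT0]; gcongr
    have h4 : c * w * ‖x‖ = 2 * (d * (a * w * (mE * ‖x‖))) + 2 * (d * (b * w * (mH * ‖x‖))) := by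
      rw [hc]; ring
    rw [h4, hwsq, hbal2]
    have hwE' : ∫ r in (0 : ℝ)..τ, PE r ≤ d * (a * w * (mE * ‖x‖)) := hwE.trans h2
    have hwH' : ∫ r in (0 : ℝ)..τ, PH r ≤ d * (b * w * (mH * ‖x‖)) := hwH.trans h3
    linarith
  -- The histories are controlled by the fields.
  have hsubt : Icc 0 t ⊆ Ici 0 := Icc_subset_Ici_self
  have hhE := norm_history_le hSE hSEb ht (hcE.mono hsubt) (hcηE.mono hsubt)
    (fun r hr => hdηE r hr.1) (fun r hr => hAE r hr.1) hKE
  have hhH := norm_history_le hSH hSHb ht (hcH.mono hsubt) (hcηH.mono hsubt)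
    (fun r hr => hdηH r hr.1) (fun r hr => hAH r hr.1) hKH
  have hfin : ‖T t x‖ ≤ w + ‖m.histE (T t x)‖ + ‖m.histH (T t x)‖ := by
    refine (abs_le_of_sq_le_sq' ?_ (by positivity)).2
    rw [hnorm t]
    have h1 := hWle t ⟨ht, le_rfl⟩
    have h2 : 0 ≤ w * ‖m.histE (T t x)‖ := by positivity
    have h3 : 0 ≤ w * ‖m.histH (T t x)‖ := by positivity
    have h4 : 0 ≤ ‖m.histE (T t x)‖ * ‖m.histH (T t x)‖ := by positivity
    linarith
  have h5 := mul_le_mul_of_nonneg_left hwx hk0.le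
  have h6 : ‖m.histE (T t x)‖ ≤ ‖m.histE (T 0 x)‖ + d * (kE * (a * w)) := hhE
  have h7 : ‖m.histH (T t x)‖ ≤ ‖m.histH (T 0 x)‖ + d * (kH * (b * w)) := hhH
  rw [hT0] at h6 h7
  have h8 : k * w = w + d * (kE * (a * w)) + d * (kH * (b * w)) := by rw [hk]; ring
  linarith

/-- The semigroups generated by the evolution operator are uniformly bounded, as they are so on the
dense domain. -/
theorem exists_norm_le (hG : IsCurlPair ε μ G G') (hpE : IsPassive νE) (hpH : IsPassive νH)
    {T : ℝ → S →L[ℂ] S} (hT : IsSemigroupGeneratedBy T fun U V =>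
      (U, V - m.coupling hνE hνH U) ∈ m.skewGraph G G') :
    ∃ M : ℝ, 0 < M ∧ ∀ t : ℝ, 0 ≤ t → ‖T t‖ ≤ M := by
  have := m.completeSpace
  obtain ⟨M, hM0, hM⟩ := m.exists_norm_apply_le hνE hνH hG hpE hpH hT
  refine ⟨M, hM0, fun t ht => (T t).opNorm_le_bound hM0.le fun x => ?_⟩
  have hclosed : IsClosed {x : S | ‖T t x‖ ≤ M * ‖x‖} :=
    isClosed_le (T t).continuous.norm (continuous_const.mul continuous_norm)
  have hdense := ((m.isMaxDissipative_skewGraph hG).add_bounded (m.coupling hνE hνH)).dense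
  refine hclosed.closure_subset_iff.2 ?_ (hdense x)
  rintro _ ⟨p, hp, rfl⟩
  exact hM p.1 p.2 hp t ht

/-- The evolution operator is a bounded perturbation of a maximal dissipative one. -/
theorem exists_semigroup (hG : IsCurlPair ε μ G G') :
    ∃ T : ℝ → S →L[ℂ] S, IsSemigroupGeneratedBy T fun U V =>
      (U, V - m.coupling hνE hνH U) ∈ m.skewGraph G G' := by
  have := m.completeSpace
  obtain ⟨T, hT, -⟩ := ((m.isMaxDissipative_skewGraph hG).add_bounded
    (m.coupling hνE hνH)).exists_semigroup
  exact ⟨T, hT⟩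

end StateModel

/-! ### The Maxwell system with memory -/

/-- The defining equations of the evolution operator, for fields in subspaces of a common space `Y`
which carries the relation `P` (the weak curl) and the boundary condition `B₀`. -/
lemma StateModel.exists_equations_iff {X Z S Y : Type*} [NormedAddCommGroup X]
    [InnerProductSpace ℂ X] [CompleteSpace X] [NormedAddCommGroup Z] [InnerProductSpace ℂ Z]
    [CompleteSpace Z] [NormedAddCommGroup S] [InnerProductSpace ℂ S] [NormedAddCommGroup Y]
    [NormedSpace ℂ Y] [NormedSpace ℝ Y] [IsScalarTower ℝ ℂ Y] [CompleteSpace Y] {C δ ε μ : ℝ}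
    [hε : Fact (0 < ε)] [hμ : Fact (0 < μ)] [Fact (0 < C)] [Fact (0 < δ)]
    (m : StateModel X Z S C δ ε μ) {G : Submodule ℂ (X × Z)} {G' : Submodule ℂ (Z × X)}
    {νE νH : ℝ → ℝ} (hνE : IsKernel C δ νE) (hνH : IsKernel C δ νH)
    (ι : X →ₗᵢ[ℂ] Y) (κ : Z →ₗᵢ[ℂ] Y) (P : Y → Y → Prop) (B₀ : Y → Prop)
    (hG : ∀ x z, (x, z) ∈ G ↔ P (ι x) (κ z) ∧ B₀ (ι x)) (hG' : ∀ z x, (z, x) ∈ G' ↔ P (κ z) (ι x))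
    (U V : S) :
    (∃ (cE cH : Y) (ζE : L2w C δ X) (ζH : L2w C δ Z),
      P (ι (m.projE U)) cE ∧ P (κ (m.projH U)) cH ∧ B₀ (ι (m.projE U)) ∧
      IsHistoryDeriv (fun s => ι (m.histE U s)) (fun s => ι (ζE s)) ∧
      IsHistoryDeriv (fun s => κ (m.histH U s)) (fun s => κ (ζH s)) ∧
      ε • ι (m.projE V) =
        -(νE 0 • ι (m.projE U)) + (∫ s in Ioi (0 : ℝ), d2 νE s • ι (m.histE U s)) + cH ∧
      μ • κ (m.projH V) =
        -(νH 0 • κ (m.projH U)) + (∫ s in Ioi (0 : ℝ), d2 νH s • κ (m.histH U s)) - cE ∧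
      (∀ᵐ s ∂(histMeasure C δ), m.histE V s = -ζE s + m.projE U) ∧
      (∀ᵐ s ∂(histMeasure C δ), m.histH V s = -ζH s + m.projH U)) ↔
    (U, V - m.coupling hνE hνH U) ∈ m.skewGraph G G' := by
  rw [m.mem_skewGraph, map_sub, map_sub, map_sub, map_sub, projE_coupling, projH_coupling,
    histE_coupling, histH_coupling, hG, hG', ← exists_isHistoryDeriv_iff ι,
    ← exists_isHistoryDeriv_iff κ, map_smul, map_neg, map_smul]
  constructor
  · rintro ⟨cE, cH, ζE, ζH, h1, h2, h3, h4, h5, h6, h7, h8, h9⟩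
    rw [sub_eq_add_neg, hνH.field_equation_iff hμ.out] at h7
    rw [hνE.field_equation_iff hε.out] at h6
    rw [h6, h7, neg_neg]
    exact ⟨⟨h1, h3⟩, h2, ⟨ζE, h4, h8⟩, ⟨ζH, h5, h9⟩⟩
  · rintro ⟨⟨h1, h3⟩, h2, ⟨ζE, h4, h8⟩, ⟨ζH, h5, h9⟩⟩
    refine ⟨_, _, ζE, ζH, h1, h2, h3, h4, h5, ?_, ?_, h8, h9⟩
    · rw [hνE.field_equation_iff hε.out]
    · rw [sub_eq_add_neg, hνH.field_equation_iff hμ.out, neg_neg]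

section Maxwell

instance (Ω : Set R3) : CompleteSpace (J Ω) :=
  inferInstanceAs (CompleteSpace ((Submodule.span ℂ _ : Submodule ℂ (L2 Ω))ᗮ : Submodule ℂ (L2 Ω)))

instance (Ω : Set R3) : CompleteSpace (Jhat Ω) :=
  inferInstanceAs (CompleteSpace ((Submodule.span ℂ _ : Submodule ℂ (L2 Ω))ᗮ : Submodule ℂ (L2 Ω)))

/-- The graph of the curl on `J(Ω) ∩ H₀(curl, Ω)`, whose values lie in `Ĵ(Ω)`. -/
def curlGraphE (Ω : Set R3) : Submodule ℂ (J Ω × Jhat Ω) :=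
  (curlZero Ω).comap ((J Ω).subtype.prodMap (Jhat Ω).subtype)

lemma mem_curlGraphE {Ω : Set R3} {p : J Ω × Jhat Ω} :
    p ∈ curlGraphE Ω ↔ ((p.1 : L2 Ω), (p.2 : L2 Ω)) ∈ curlZero Ω := Iff.rfl

/-- The graph of the curl on `Ĵ(Ω) ∩ H(curl, Ω)`, whose values lie in `J(Ω)`. -/
def curlGraphH (Ω : Set R3) : Submodule ℂ (Jhat Ω × J Ω) where
  carrier := {p | IsWeakCurl (p.1 : L2 Ω) (p.2 : L2 Ω)}
  add_mem' := by
    intro p q hp hq r hr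
    have h1 := hp r hr
    have h2 := hq r hr
    change inner ℂ r.2 ((p.1 : L2 Ω) + (q.1 : L2 Ω)) = inner ℂ r.1 ((p.2 : L2 Ω) + (q.2 : L2 Ω))
    rw [inner_add_right, inner_add_right, h1, h2]
  zero_mem' := by
    intro r hr
    change inner ℂ r.2 (0 : L2 Ω) = inner ℂ r.1 (0 : L2 Ω)
    rw [inner_zero_right, inner_zero_right]
  smul_mem' := by
    intro c p hp r hr
    have h1 := hp r hr
    change inner ℂ r.2 (c • (p.1 : L2 Ω)) = inner ℂ r.1 (c • (p.2 : L2 Ω))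
    rw [inner_smul_right, inner_smul_right, h1]

lemma mem_curlGraphH {Ω : Set R3} {p : Jhat Ω × J Ω} :
    p ∈ curlGraphH Ω ↔ IsWeakCurl (p.1 : L2 Ω) (p.2 : L2 Ω) := Iff.rfl

lemma isWeakCurl_zero {Ω : Set R3} : IsWeakCurl (0 : L2 Ω) 0 := fun p _ => by
  rw [inner_zero_right, inner_zero_right]

lemma smul_smul_sub_eq_of_coe {M : Type*} [AddCommGroup M] [Module ℂ M] {N : Submodule ℂ M}
    {l e : ℂ} {x k f : N} (h : l • e • (x : M) - (k : M) = e • (f : M)) : l • e • x - k = e • f :=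
  Subtype.ext h

lemma smul_smul_add_eq_of_coe {M : Type*} [AddCommGroup M] [Module ℂ M] {N : Submodule ℂ M}
    {l e : ℂ} {x k f : N} (h : l • e • (x : M) + (k : M) = e • (f : M)) : l • e • x + k = e • f :=
  Subtype.ext h

lemma isCurlPair_curlGraph {Ω : Set R3} (hΩ : IsOpen Ω) {ε μ : ℝ} (hε : 0 < ε) (hμ : 0 < μ) :
    IsCurlPair ε μ (curlGraphE Ω) (curlGraphH Ω) where
  inner_eq p hp q hq := inner_curl_eq (mem_curlGraphE.1 hp) (mem_curlGraphH.1 hq)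
  exists_resolvent lam hl f g := by
    have h := exists_maxwell_resolvent hε hμ hl f g
    obtain ⟨E, H, cE, cH, h1, h2, h3, h4⟩ := h
    have h5 : cE ∈ Jhat Ω := mem_Jhat_of_mem_curlZero h1
    have h6 : cH ∈ J Ω := h2.mem_J
    have h7 : (lam : ℂ) • (ε : ℂ) • E - ⟨cH, h6⟩ = (ε : ℂ) • f := smul_smul_sub_eq_of_coe h3
    have h8 : (lam : ℂ) • (μ : ℂ) • H + ⟨cE, h5⟩ = (μ : ℂ) • g := smul_smul_add_eq_of_coe h4
    exact ⟨(E, ⟨cE, h5⟩), mem_curlGraphE.2 h1, (H, ⟨cH, h6⟩), mem_curlGraphH.2 h2, h7, h8⟩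
  eq_zero z hz := Subtype.ext ((isWeakCurl_of_mem_curlZero (mem_curlGraphE.1 hz)).unique hΩ
    isWeakCurl_zero)
  eq_zero' x hx := Subtype.ext ((mem_curlGraphH.1 hx).unique hΩ isWeakCurl_zero)

variable {Ω : Set R3} {C δ ε μ : ℝ} [hε : Fact (0 < ε)] [hμ : Fact (0 < μ)]
  [hC : Fact (0 < C)] [hδ : Fact (0 < δ)]

variable (Ω C δ ε μ) in
/-- The state space as a product of its components. -/
def maxwellModel : StateModel (J Ω) (Jhat Ω) (StateSpace Ω C δ ε μ) C δ ε μ where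
  toProd :=
    { toFun := fun U => U
      invFun := fun U => U
      map_add' := fun _ _ => rfl
      map_smul' := fun _ _ => rfl
      left_inv := fun _ => rfl
      right_inv := fun _ => rfl }
  inner_eq _ _ := rfl

/-- The evolution operator is the sum of the skew part and the bounded coupling. -/
lemma isOperator_iff (hΩ : IsOpen Ω) {νE νH : ℝ → ℝ} (hνE : IsKernel C δ νE)
    (hνH : IsKernel C δ νH) (U V : StateSpace Ω C δ ε μ) :
    IsOperator νE νH U V ↔ (U, V - (maxwellModel Ω C δ ε μ).coupling hνE hνH U) ∈
      (maxwellModel Ω C δ ε μ).skewGraph (curlGraphE Ω) (curlGraphH Ω) :=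
  (maxwellModel Ω C δ ε μ).exists_equations_iff hνE hνH (J Ω).subtypeₗᵢ (Jhat Ω).subtypeₗᵢ
    IsWeakCurl ZeroTangentialTrace (fun _ _ => mem_curlGraphE.trans (mem_curlZero_iff hΩ))
    (fun _ _ => mem_curlGraphH) U V

end Maxwell

end Maxwell

end

theorem lemma3p1 (Ω : Set Maxwell.R3) (hΩ : Maxwell.IsBoundedLipschitzDomain Ω)
    (ε μ : ℝ) [Fact (0 < ε)] [Fact (0 < μ)]
    (C δ : ℝ) (hC : 0 < C) (hδ : 0 < δ)
    (νE νH : ℝ → ℝ) (hνE : Maxwell.IsKernel C δ νE) (hνH : Maxwell.IsKernel C δ νH)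
    (hpE : Maxwell.IsPassive νE) (hpH : Maxwell.IsPassive νH) :
    (∃ T : ℝ → Maxwell.StateSpace Ω C δ ε μ →L[ℂ] Maxwell.StateSpace Ω C δ ε μ,
      Maxwell.IsSemigroupGeneratedBy T (Maxwell.IsOperator νE νH)) ∧
    ∀ T : ℝ → Maxwell.StateSpace Ω C δ ε μ →L[ℂ] Maxwell.StateSpace Ω C δ ε μ,
      Maxwell.IsSemigroupGeneratedBy T (Maxwell.IsOperator νE νH) →
      ∃ M : ℝ, 0 < M ∧ ∀ t : ℝ, 0 ≤ t → ‖T t‖ ≤ M := by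
  have : Fact (0 < C) := ⟨hC⟩
  have : Fact (0 < δ) := ⟨hδ⟩
  have hop : Maxwell.IsOperator νE νH = fun U V =>
      (U, V - (Maxwell.maxwellModel Ω C δ ε μ).coupling hνE hνH U) ∈
        (Maxwell.maxwellModel Ω C δ ε μ).skewGraph (Maxwell.curlGraphE Ω)
          (Maxwell.curlGraphH Ω) := by
    ext U V
    exact Maxwell.isOperator_iff hΩ.isOpen hνE hνH U V
  have hG := Maxwell.isCurlPair_curlGraph hΩ.isOpen (Fact.out : 0 < ε) (Fact.out : 0 < μ)
  rw [hop]
  exact ⟨(Maxwell.maxwellModel Ω C δ ε μ).exists_semigroup hνE hνH hG,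
    fun T hT => (Maxwell.maxwellModel Ω C δ ε μ).exists_norm_le hνE hνH hG hpE hpH hT⟩
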